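/- By a graph we mean a finite undirected graph without loops or multiple edges. For a graph $G$ let $d_G(x,y)\in\{0,1,2,\dots\}\cup\{\infty\}$ be the length of a shortest edge path from $x$ to $y$ ($\infty$ if there is none), and let $\ell(x_0,\dots,x_k)=\sum_{i=1}^{k} d_G(x_{i-1},x_i)$. For $k,l\ge 0$ let $MC_{k,l}(G)$ be the free abelian group on the tuples $(x_0,\dots,x_k)$ of vertices with $x_{i-1}\ne x_i$ for $1\le i\le k$ and $\ell(x_0,\dots,x_k)=l$. Let $\partial=\sum_{i=1}^{k-1}(-1)^{i-1}\partial_i\colon MC_{k,l}(G)\to MC_{k-1,l}(G)$, where $\partial_i(x_0,\dots,x_k)=(x_0,\dots,\widehat{x_i},\dots,x_k)$ if this tuple again has length $l$, and $\partial_i(x_0,\dots,x_k)=0$ otherwise. Then $\partial\circ\partial=0$; the magnitude homology of $G$ is $MH_{k,l}(G)=H_k(MC_{*,l}(G),\partial)$. The graph $G$ is called diagonal if $MH_{k,l}(G)=0$ whenever $k\neq l$. The cartesian product $G\mathbin{\Box}H$ of graphs has vertex set $V(G)\times V(H)$ and an edge between $(x_1,y_1)$ and $(x_2,y_2)$ if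 either $x_1=x_2$ and $\{y_1,y_2\}$ is an edge of $H$, or $y_1=y_2$ and $\{x_1,x_2\}$ is an edge of $G$. A subgraph $U$ of a graph $X$ is convex if $d_U(u,v)=d_X(u,v)$ for all vertices $u,v$ of $U$. The graph $X$ projects to a convex subgraph $U$ if for every vertex $x$ of $X$ that can be joined by an edge path to some vertex of $U$ there is a vertex $\pi(x)$ of $U$ with $d_X(x,u)=d_X(x,\pi(x))+d_X(\pi(x),u)$ for all vertices $u$ of $U$. A projecting decomposition $(X;G,H)$ consists of a graph $X$ and subgraphs $G,H$ of $X$ such that $X=G\cup H$, $G\cap H$ is convex in $X$, and $H$ projects to $G\cap H$. **Proposition.** 1. If $G$ and $H$ are diagonal graphs, then $G\mathbin{\Box}H$ is diagonal. 2. If $(X;G,H)$ is a projecting decomposition and the graphs $G$ and $H$ are diagonal, then $X$ is diagonal. -/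

import Mathlib

open CategoryTheory

namespace MagnitudeHomology

universe u

variable {V : Type u}

/-- The length `ℓ(x₀, …, x_k) = d(x₀, x₁) + ⋯ + d(x_{k-1}, x_k)` of a tuple of vertices, where `d`
is the shortest path distance, equal to `⊤` between vertices of different components. -/
noncomputable def tupleLength (G : SimpleGraph V) {k : ℕ} (x : Fin (k + 1) → V) : ℕ∞ :=
  ∑ i : Fin k, G.edist (x i.castSucc) (x i.succ)

/-- The tuples `(x₀, …, x_k)` that generate the magnitude chain group of bidegree `(k, l)`:
consecutive entries are distinct and the length is `l`. -/
def IsGenerator (G : SimpleGraph V) {k : ℕ} (l : ℕ) (x : Fin (k + 1) → V) : Prop :=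
  (∀ i : Fin k, x i.castSucc ≠ x i.succ) ∧ tupleLength G x = (l : ℕ∞)

/-- The magnitude chain group `MC_{k,l}(G)`: the free abelian group on the generating tuples. -/
abbrev MagnitudeChain (G : SimpleGraph V) (k l : ℕ) : Type u :=
  {x : Fin (k + 1) → V // IsGenerator G l x} →₀ ℤ

open Classical in
/-- A tuple, viewed as an element of `MC_{k,l}(G)` if it is one of the generators, and `0`
otherwise. -/
noncomputable def toChain (G : SimpleGraph V) {k : ℕ} (l : ℕ) (x : Fin (k + 1) → V) :
    MagnitudeChain G k l :=
  if h : IsGenerator G l x then Finsupp.single ⟨x, h⟩ 1 else 0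

/-- The boundary map `∂ = ∂₁ - ∂₂ + ⋯ : MC_{n+1,l}(G) → MC_{n,l}(G)`, where `∂ᵢ` for
`i = 1, …, n` omits the entry `xᵢ` if this preserves the length, and is `0` otherwise.
(The index `i : Fin n` below stands for the omission of the entry number `i + 1`; omitting an
inner entry without changing the length always gives a generator, see
`isGenerator_removeNth_iff`.) -/
noncomputable def boundary (G : SimpleGraph V) (l n : ℕ) :
    MagnitudeChain G (n + 1) l →ₗ[ℤ] MagnitudeChain G n l :=
  Finsupp.linearCombination ℤ fun x =>
    ∑ i : Fin n, (-1 : ℤ) ^ (i : ℕ) • toChain G l (i.succ.castSucc.removeNth x.1)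

/-! Facts needed for `∂ ∘ ∂ = 0`. -/

theorem tupleLength_succ (G : SimpleGraph V) {k : ℕ} (x : Fin (k + 2) → V) :
    tupleLength G x = G.edist (x 0) (x 1) + tupleLength G (Fin.tail x) := by
  simp only [tupleLength, Fin.sum_univ_succ (n := k)]
  rfl

theorem tupleLength_castSucc (G : SimpleGraph V) {k : ℕ} (x : Fin (k + 2) → V) :
    tupleLength G x =
      tupleLength G (Fin.init x) + G.edist (x (Fin.last k).castSucc) (x (Fin.last (k + 1))) := by
  simp only [tupleLength, Fin.sum_univ_castSucc (n := k)]
  rfl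

theorem tupleLength_removeNth_one (G : SimpleGraph V) {k : ℕ} (x : Fin (k + 3) → V) :
    tupleLength G (Fin.removeNth 1 x) =
      G.edist (x 0) (x 2) + tupleLength G (Fin.tail (Fin.tail x)) := by
  rw [tupleLength_succ]
  rfl

theorem tail_removeNth_succ {k : ℕ} (x : Fin (k + 2) → V) (i : Fin (k + 1)) :
    Fin.tail (i.succ.removeNth x) = i.removeNth (Fin.tail x) := by
  funext j
  simp [Fin.tail, Fin.removeNth]

theorem tupleLength_removeNth_le (G : SimpleGraph V) {k : ℕ} (x : Fin (k + 2) → V)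
    (i : Fin (k + 2)) : tupleLength G (i.removeNth x) ≤ tupleLength G x := by
  induction k with
  | zero => simp [tupleLength]
  | succ k ih =>
    induction i using Fin.cases with
    | zero => rw [Fin.removeNth_zero, tupleLength_succ G x]; exact le_add_self
    | succ i =>
      induction i using Fin.cases with
      | zero =>
        rw [show (0 : Fin (k + 2)).succ = 1 from rfl, tupleLength_removeNth_one,
          tupleLength_succ G x, tupleLength_succ G (Fin.tail x), ← add_assoc]
        exact add_le_add_left SimpleGraph.edist_triangle _
      | succ i =>
        rw [tupleLength_succ, tupleLength_succ G x, tail_removeNth_succ]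
        exact add_le_add le_rfl (ih _ _)

/-- Omitting an inner entry from a tuple with distinct consecutive entries, without changing the
(finite) length, again gives a tuple with distinct consecutive entries. -/
theorem ne_of_tupleLength_removeNth_eq (G : SimpleGraph V) {k : ℕ} (x : Fin (k + 2) → V)
    (i : Fin (k + 2)) (hx : ∀ j : Fin (k + 1), x j.castSucc ≠ x j.succ)
    (hfin : tupleLength G x ≠ ⊤) (h : tupleLength G (i.removeNth x) = tupleLength G x)
    (j : Fin k) : (i.removeNth x : Fin (k + 1) → V) j.castSucc ≠
      (i.removeNth x : Fin (k + 1) → V) j.succ := by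
  induction k with
  | zero => exact j.elim0
  | succ k ih =>
    induction i using Fin.cases with
    | zero => rw [Fin.removeNth_zero]; exact hx j.succ
    | succ i =>
      induction i using Fin.cases with
      | zero =>
        induction j using Fin.cases with
        | zero =>
          intro h02
          change x 0 = x 2 at h02
          rw [show (0 : Fin (k + 2)).succ = 1 from rfl, tupleLength_removeNth_one, h02,
            SimpleGraph.edist_self, zero_add, tupleLength_succ G x,
            tupleLength_succ G (Fin.tail x), ← add_assoc] at h
          rw [tupleLength_succ G x, tupleLength_succ G (Fin.tail x), ← add_assoc] at hfin
          have hT : tupleLength G (Fin.tail (Fin.tail x)) ≠ ⊤ :=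
            fun hT => hfin (by rw [hT, add_top])
          have h0 : G.edist (x 0) (x 1) + G.edist (Fin.tail x 0) (Fin.tail x 1) = 0 := by
            have h1 : 0 + tupleLength G (Fin.tail (Fin.tail x)) = _ := (zero_add _).trans h
            exact (ENat.add_left_injective_of_ne_top hT h1).symm
          exact hx 0 (SimpleGraph.edist_eq_zero_iff.1 (add_eq_zero.1 h0).1)
        | succ j => exact hx j.succ.succ
      | succ i =>
        rw [tupleLength_succ, tupleLength_succ G x, tail_removeNth_succ] at h
        rw [tupleLength_succ G x] at hfin
        have h0 : G.edist (x 0) (x 1) ≠ ⊤ := fun h0 => hfin (by rw [h0, top_add])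
        induction j using Fin.cases with
        | zero => exact hx 0
        | succ j =>
          have := ih (Fin.tail x) i.succ (fun j => hx j.succ)
            (fun hT => hfin (by rw [hT, add_top])) (ENat.add_right_injective_of_ne_top h0 h) j
          rw [← tail_removeNth_succ] at this
          exact this

theorem isGenerator_removeNth_iff (G : SimpleGraph V) {k l : ℕ} {x : Fin (k + 2) → V}
    (hx : IsGenerator G l x) (i : Fin (k + 2)) :
    IsGenerator G l (i.removeNth x) ↔ tupleLength G (i.removeNth x) = (l : ℕ∞) :=
  ⟨fun h => h.2, fun h => ⟨ne_of_tupleLength_removeNth_eq G x i hx.1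
    (by rw [hx.2]; exact ENat.natCast_ne_top l) (h.trans hx.2.symm), h⟩⟩

theorem toChain_eq_zero (G : SimpleGraph V) {k l : ℕ} {x : Fin (k + 1) → V}
    (h : tupleLength G x ≠ l) : toChain G l x = 0 :=
  dif_neg fun hx => h hx.2

theorem toChain_removeNth_zero (G : SimpleGraph V) {k l : ℕ} {x : Fin (k + 2) → V}
    (hx : IsGenerator G l x) : toChain G l (Fin.removeNth 0 x) = 0 := by
  refine toChain_eq_zero G fun h => ?_
  have h2 := hx.2
  rw [Fin.removeNth_zero] at h
  rw [tupleLength_succ, h] at h2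
  have h1 : G.edist (x 0) (x 1) + l = 0 + l := h2.trans (zero_add _).symm
  exact hx.1 0 (SimpleGraph.edist_eq_zero_iff.1
    (ENat.add_left_injective_of_ne_top (ENat.natCast_ne_top l) h1))

theorem toChain_removeNth_last (G : SimpleGraph V) {k l : ℕ} {x : Fin (k + 2) → V}
    (hx : IsGenerator G l x) : toChain G l (Fin.removeNth (Fin.last (k + 1)) x) = 0 := by
  refine toChain_eq_zero G fun h => ?_
  have h2 := hx.2
  rw [Fin.removeNth_last] at h
  rw [tupleLength_castSucc, h] at h2
  have h1 : l + G.edist (x (Fin.last k).castSucc) (x (Fin.last (k + 1))) = l + 0 :=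
    h2.trans (add_zero _).symm
  exact hx.1 (Fin.last k) (SimpleGraph.edist_eq_zero_iff.1
    (ENat.add_right_injective_of_ne_top (ENat.natCast_ne_top l) h1))

theorem boundary_single (G : SimpleGraph V) (l n : ℕ)
    (x : {x : Fin (n + 2) → V // IsGenerator G l x}) :
    boundary G l n (Finsupp.single x 1) =
      ∑ i : Fin n, (-1 : ℤ) ^ (i : ℕ) • toChain G l (i.succ.castSucc.removeNth x.1) := by
  simp [boundary, Finsupp.linearCombination_single]

/-- The outer faces of a generator do not contribute. -/
theorem boundary_toChain (G : SimpleGraph V) (l n : ℕ) {x : Fin (n + 2) → V}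
    (hx : IsGenerator G l x) :
    boundary G l n (toChain G l x) =
      -∑ i : Fin (n + 2), (-1 : ℤ) ^ (i : ℕ) • toChain G l (i.removeNth x) := by
  rw [toChain, dif_pos hx, boundary_single, Fin.sum_univ_castSucc, Fin.sum_univ_succ,
    toChain_removeNth_last G hx]
  simp only [Fin.castSucc_zero, toChain_removeNth_zero G hx, smul_zero, zero_add, add_zero,
    ← Finset.sum_neg_distrib]
  refine Finset.sum_congr rfl fun i _ => ?_
  simp [pow_succ]

theorem sum_removeNth_removeNth {A : Type*} [AddCommGroup A] {n : ℕ}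
    (φ : (Fin (n + 1) → V) → A) (x : Fin (n + 3) → V) :
    ∑ j : Fin (n + 3), ∑ i : Fin (n + 2), (-1 : ℤ) ^ ((j : ℕ) + (i : ℕ)) •
      φ (i.removeNth (j.removeNth x)) = 0 := by
  rw [← Finset.sum_product']
  refine Finset.sum_involution (fun p _ => (p.1.succAbove p.2, p.2.predAbove p.1)) ?_ ?_ ?_ ?_
  · rintro ⟨j, i⟩ -
    dsimp only
    rw [← Fin.removeNth_removeNth_eq_swap, Fin.neg_one_pow_succAbove_add_predAbove]
    simp
  · rintro ⟨j, i⟩ - - h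
    exact Fin.succAbove_ne j i (congrArg Prod.fst h)
  · simp
  · rintro ⟨j, i⟩ -
    simp [Fin.succAbove_succAbove_predAbove, Fin.predAbove_predAbove_succAbove]

theorem boundary_comp_boundary (G : SimpleGraph V) (l n : ℕ) :
    boundary G l n ∘ₗ boundary G l (n + 1) = 0 := by
  refine Finsupp.lhom_ext' fun x => LinearMap.ext_ring ?_
  have hx : Finsupp.single x (1 : ℤ) = toChain G l x.1 := by rw [toChain, dif_pos x.2]
  have key : ∀ j : Fin (n + 3), boundary G l n (toChain G l (j.removeNth x.1)) =
      -∑ i : Fin (n + 2), (-1 : ℤ) ^ (i : ℕ) •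
        toChain G l (i.removeNth (j.removeNth x.1)) := by
    intro j
    by_cases hj : IsGenerator G l (j.removeNth x.1)
    · exact boundary_toChain G l n hj
    · have hlt : tupleLength G (j.removeNth x.1) < l :=
        lt_of_le_of_ne ((tupleLength_removeNth_le G x.1 j).trans_eq x.2.2)
          fun h => hj ((isGenerator_removeNth_iff G x.2 j).2 h)
      rw [toChain, dif_neg hj, map_zero, Finset.sum_eq_zero, neg_zero]
      intro i _
      rw [toChain_eq_zero G ((tupleLength_removeNth_le G _ i).trans_lt hlt).ne, smul_zero]
  simp only [LinearMap.comp_apply, Finsupp.lsingle_apply, LinearMap.zero_apply]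
  rw [hx, boundary_toChain G l (n + 1) x.2, map_neg, map_sum, neg_eq_zero]
  simp only [map_zsmul, key, smul_neg, Finset.sum_neg_distrib, Finset.smul_sum, smul_smul,
    ← pow_add]
  rw [sum_removeNth_removeNth, neg_zero]

/-- The magnitude chain complex `MC_{*,l}(G)` in length `l`. -/
noncomputable def magnitudeComplex (G : SimpleGraph V) (l : ℕ) : ChainComplex (ModuleCat.{u} ℤ) ℕ :=
  ChainComplex.of (fun k => ModuleCat.of ℤ (MagnitudeChain G k l))
    (fun n => ModuleCat.ofHom (boundary G l n))
    (fun n => by rw [← ModuleCat.ofHom_comp, boundary_comp_boundary]; rfl)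

/-- The magnitude homology group `MH_{k,l}(G)`. -/
noncomputable def magnitudeHomology (G : SimpleGraph V) (k l : ℕ) : ModuleCat.{u} ℤ :=
  (magnitudeComplex G l).homology k

/-- A graph is diagonal if its magnitude homology is concentrated on the diagonal. -/
def IsDiagonal (G : SimpleGraph V) : Prop :=
  ∀ k l : ℕ, k ≠ l → Subsingleton (magnitudeHomology G k l)

/-- A subgraph `U` of `X` is convex if `d_U(u, v) = d_X(u, v)` for all vertices `u`, `v` of `U`. -/
def IsConvex {X : SimpleGraph V} (U : X.Subgraph) : Prop :=
  ∀ u v : U.verts, U.coe.edist u v = X.edist (u : V) (v : V)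

/-- `X` projects to the subgraph `U` if `U` is convex and every vertex `x` of `X` that is connected
by a path to some vertex of `U` has a `π(x) ∈ U` with `d(x, u) = d(x, π(x)) + d(π(x), u)` for all
`u ∈ U`. -/
def ProjectsTo {X : SimpleGraph V} (U : X.Subgraph) : Prop :=
  IsConvex U ∧
    ∀ x : V, (∃ u ∈ U.verts, X.Reachable x u) →
      ∃ p ∈ U.verts, ∀ u ∈ U.verts, X.edist x u = X.edist x p + X.edist p u

/-- `(X; G, H)` is a projecting decomposition: `X = G ∪ H`, the intersection `G ∩ H` is convex
in `X`, and the graph `H` projects to its subgraph `G ∩ H` (distances being those of `H`). -/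
structure IsProjectingDecomposition {V : Type u} (X : SimpleGraph V) (G H : X.Subgraph) : Prop where
  union_eq : G ⊔ H = ⊤
  convex_inter : IsConvex (G ⊓ H)
  projects : ProjectsTo (H.restrict (G ⊓ H))

end MagnitudeHomology

/-!
The magnitude chain complex is a bar complex. Its generators are lists of vertices, and an inner
entry `b` with neighbours `a` and `c` may be omitted when `b` lies strictly between `a` and `c` on
a geodesic (`Btw`). All computations take place in the free abelian group on all lists, with the
differential `bd β` that omits an inner entry whenever a relation `β a b c` holds; `isDiagonal_iff`
translates diagonality into the exactness of `bd (Btw G)` off the diagonal. Restricting `β` to a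
part of the faces gives the leading term of a filtration, and a contraction of the leading term
suffices (`exists_sub_mem_of_filtration`).

*Products.* Distances in `G □ H` are the sums of the distances of the coordinates, so a vertex is
between two others if it is so, in the weak sense, in both coordinates. Call a list unsorted if
some step moves in `G` and the same or a later step moves in `H`. The unsorted lists span a
subcomplex. It is acyclic (`exists_bd_eq_of_unsorted`): at the first place where this is possible,
break up a step that moves in both coordinates into a step in `G` followed by a step in `H`, or
merge two such steps, and filter by the number of pairs of a step in `H` and a later step in `G`. A
sorted list is a list in `H` followed by a list in `G`, and modulo unsorted lists the complex is
the tensor product of those of `H` and `G` (`bd_pairMap`). Since the chain groups are free, both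
factors have contracting homotopies off their diagonals (`exists_contraction`), and a tensor of
bidegrees `(i, a)` and `(j, b)` with `i + j ≠ a + b` is off the diagonal in one of the factors; so
the tensor product is exact off its diagonal (`exists_tensorBd_eq`), and so is the complex of `G □
H` (`ListDiagonal.boxProd`).

*Projecting decompositions.* Let `A` and `B` be the vertex sets of `G` and `H`. Both subgraphs are
convex (`isConvex_of_sup_eq_top`), and geodesics from `b ∈ B` to `A` can be taken through `π b`
(`IsProjectingDecomposition.exists_isGate`). If a list passes from `b ∉ A` to a vertex outside `B`,
with only vertices of `A ∩ B` between them, then inserting `π b` behind `b`, or omitting it if it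
is there, pairs off such lists. Filtering by the number of entries outside `A ∩ B`, this contracts
all lists with an entry outside `A` before one outside `B` (`IsGate.exists_straight`); with the
same argument for the reversed lists, every cycle becomes homologous to one whose lists each stay
in `A` or in `B` (`IsGate.exists_bd_eq`). Write such a cycle as `g + h` with `g` in `A` and `h` in
`B`. The boundary of `h` lies in `A ∩ B`, and `π` induces a chain map `r` from `B` to `A ∩ B` that
is the identity on `A ∩ B` and kills the lists on which `π` shortens a step. So `g + r h` and `h -
r h` are cycles in `A` and in `B`, and they bound because `G` and `H` are diagonal
(`IsGate.listDiagonal`).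
-/

namespace MagnitudeHomology

open Finsupp

/-! ### Bar complexes on lists -/

section Bar

variable {V V' : Type*}

/-- Prepending `a` to every list. -/
noncomputable def consMap (a : V) : (List V →₀ ℤ) →ₗ[ℤ] (List V →₀ ℤ) :=
  Finsupp.lmapDomain ℤ ℤ (List.cons a)

@[simp] theorem consMap_single (a : V) (l : List V) (n : ℤ) :
    consMap a (single l n) = single (a :: l) n := by
  simp [consMap, Finsupp.mapDomain_single]

open Classical in
/-- The face of `a :: l` that omits the first entry `b` of `l`, if `b` is followed by some `c` in
`l` and the relation `β a b c` holds; `0` otherwise. -/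
noncomputable def firstFace (β : V → V → V → Prop) (a : V) : List V → (List V →₀ ℤ)
  | b :: c :: l => if β a b c then single (a :: c :: l) 1 else 0
  | _ => 0

/-- The alternating sum of the lists obtained by omitting an inner entry `b`, with neighbours `a`
and `c`, for which `β a b c` holds. -/
noncomputable def listBoundary (β : V → V → V → Prop) : List V → (List V →₀ ℤ)
  | [] => 0
  | a :: l => firstFace β a l - consMap a (listBoundary β l)

theorem listBoundary_cons (β : V → V → V → Prop) (a : V) (l : List V) :
    listBoundary β (a :: l) = firstFace β a l - consMap a (listBoundary β l) := rfl

/-- The linear extension of `firstFace`. -/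
noncomputable def firstFaceMap (β : V → V → V → Prop) (a : V) :
    (List V →₀ ℤ) →ₗ[ℤ] (List V →₀ ℤ) :=
  Finsupp.linearCombination ℤ (firstFace β a)

/-- The linear extension of `listBoundary`. If `β` says that the product of the steps from `a` to
`b` and from `b` to `c` is the step from `a` to `c` (and not zero), this is the differential of the
bar complex. -/
noncomputable def bd (β : V → V → V → Prop) : (List V →₀ ℤ) →ₗ[ℤ] (List V →₀ ℤ) :=
  Finsupp.linearCombination ℤ (listBoundary β)

@[simp] theorem firstFaceMap_single (β : V → V → V → Prop) (a : V) (l : List V) :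
    firstFaceMap β a (single l 1) = firstFace β a l := by
  simp [firstFaceMap]

@[simp] theorem bd_single (β : V → V → V → Prop) (l : List V) :
    bd β (single l 1) = listBoundary β l := by
  simp [bd]

theorem firstFace_eq_zero {β : V → V → V → Prop} {a b : V} (h : ∀ c, ¬ β a b c) (l : List V) :
    firstFace β a (b :: l) = 0 := by
  cases l with
  | nil => rfl
  | cons c l => simp [firstFace, h c]

/-! ### Linear maps on spans of lists -/

section Span

variable {ι M : Type*} [AddCommGroup M]

theorem map_mem_of_supported {S : Set ι} {f : (ι →₀ ℤ) →ₗ[ℤ] M} {P : Submodule ℤ M}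
    (h : ∀ e ∈ S, f (single e 1) ∈ P) {z : ι →₀ ℤ} (hz : z ∈ supported ℤ ℤ S) : f z ∈ P := by
  rw [supported_eq_span_single] at hz
  have : Submodule.span ℤ ((fun i => single i (1 : ℤ)) '' S) ≤ P.comap f := by
    rw [Submodule.span_le]
    rintro _ ⟨e, he, rfl⟩
    exact h e he
  exact this hz

theorem eq_of_supported {S : Set ι} {f g : (ι →₀ ℤ) →ₗ[ℤ] M}
    (h : ∀ e ∈ S, f (single e 1) = g (single e 1)) {z : ι →₀ ℤ} (hz : z ∈ supported ℤ ℤ S) :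
    f z = g z := by
  have := map_mem_of_supported (f := f - g) (P := ⊥) (S := S)
    (fun e he => by simp [h e he]) hz
  simpa [sub_eq_zero] using this

theorem eq_of_single {f g : (ι →₀ ℤ) →ₗ[ℤ] M} (h : ∀ e, f (single e 1) = g (single e 1)) :
    f = g := by
  ext e
  simpa using h e

theorem exists_mem_supported_lt (μ : ι → ℕ) (z : ι →₀ ℤ) :
    ∃ n, ∀ e ∈ z.support, μ e < n :=
  ⟨z.support.sup μ + 1, fun _ he => Nat.lt_succ_of_le (Finset.le_sup he)⟩

open Classical in
/-- The projection of a free abelian group onto the span of a set of basis elements. -/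
noncomputable def spanProj (S : Set ι) : (ι →₀ ℤ) →ₗ[ℤ] (ι →₀ ℤ) :=
  Finsupp.linearCombination ℤ fun e => if e ∈ S then single e 1 else 0

theorem spanProj_single_of_mem {S : Set ι} {e : ι} (h : e ∈ S) :
    spanProj S (single e 1) = single e 1 := by
  simp [spanProj, h]

theorem spanProj_single_of_notMem {S : Set ι} {e : ι} (h : e ∉ S) :
    spanProj S (single e 1) = 0 := by
  simp [spanProj, h]

theorem spanProj_of_mem {S : Set ι} {z : ι →₀ ℤ} (h : z ∈ supported ℤ ℤ S) :
    spanProj S z = z :=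
  eq_of_supported (g := LinearMap.id) (fun _ he => spanProj_single_of_mem he) h

theorem spanProj_of_disjoint {S T : Set ι} (hST : ∀ e ∈ T, e ∉ S) {z : ι →₀ ℤ}
    (h : z ∈ supported ℤ ℤ T) : spanProj S z = 0 :=
  eq_of_supported (g := 0) (fun e he => spanProj_single_of_notMem (hST e he)) h

theorem spanProj_mem_inter (S : Set ι) {T : Set ι} {z : ι →₀ ℤ} (h : z ∈ supported ℤ ℤ T) :
    spanProj S z ∈ supported ℤ ℤ (S ∩ T) := by
  refine map_mem_of_supported (fun e he => ?_) h
  by_cases heS : e ∈ S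
  · rw [spanProj_single_of_mem heS]
    exact single_mem_supported ℤ _ ⟨heS, he⟩
  · rw [spanProj_single_of_notMem heS]
    exact zero_mem _

theorem sub_spanProj_mem (S : Set ι) {T : Set ι} {z : ι →₀ ℤ} (h : z ∈ supported ℤ ℤ T) :
    z - spanProj S z ∈ supported ℤ ℤ (T \ S) := by
  refine map_mem_of_supported (f := LinearMap.id - spanProj S) (fun e he => ?_) h
  by_cases heS : e ∈ S
  · simp [spanProj_single_of_mem heS]
  · rw [LinearMap.sub_apply, spanProj_single_of_notMem heS, sub_zero]
    exact single_mem_supported ℤ _ ⟨he, heS⟩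

end Span

/-- If `d h + h d` differs from the identity by an operator that lowers a filtration, then every
cycle is homologous to an element of the lowest term of the filtration. -/
theorem exists_sub_mem_of_filtration {M : Type*} [AddCommGroup M] {d h : M →ₗ[ℤ] M}
    (hd : ∀ z, d (d z) = 0) (F : ℕ → Submodule ℤ M)
    (hF : ∀ n, ∀ z ∈ F (n + 1), z - d (h z) - h (d z) ∈ F n) (n : ℕ) :
    ∀ z ∈ F n, d z = 0 → ∃ w, z - d w ∈ F 0 := by
  induction n with
  | zero => exact fun z hz _ => ⟨0, by simpa using hz⟩
  | succ n ih =>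
    intro z hz hdz
    have h1 := hF n z hz
    rw [hdz, map_zero, sub_zero] at h1
    obtain ⟨w, hw⟩ := ih _ h1 (by rw [map_sub, hdz, hd, sub_zero])
    exact ⟨h z + w, by rwa [map_add, ← sub_sub]⟩

/-! ### Properties of the list boundary -/

theorem bd_consMap (β : V → V → V → Prop) (a : V) (z : List V →₀ ℤ) :
    bd β (consMap a z) = firstFaceMap β a z - consMap a (bd β z) := by
  have : bd β ∘ₗ consMap a = firstFaceMap β a - consMap a ∘ₗ bd β :=
    eq_of_single fun l => by simp [listBoundary]
  exact LinearMap.congr_fun this z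

/-- `Face β l l'` says that `l'` arises from `l` by omitting an inner entry as in
`listBoundary`. -/
inductive Face (β : V → V → V → Prop) : List V → List V → Prop
  | head {a b c : V} (l : List V) : β a b c → Face β (a :: b :: c :: l) (a :: c :: l)
  | cons (a : V) {l l' : List V} : Face β l l' → Face β (a :: l) (a :: l')

theorem listBoundary_mem (β : V → V → V → Prop) (l : List V) :
    listBoundary β l ∈ supported ℤ ℤ {l' | Face β l l'} := by
  induction l with
  | nil => exact zero_mem _
  | cons a l ih =>
    refine sub_mem ?_ (map_mem_of_supported (fun e he => ?_) ih)
    · match l with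
      | [] => exact zero_mem _
      | [b] => exact zero_mem _
      | b :: c :: l =>
        rw [firstFace]
        split_ifs with h
        · exact single_mem_supported ℤ _ (Face.head l h)
        · exact zero_mem _
    · rw [consMap_single]
      exact single_mem_supported ℤ _ (Face.cons a he)

theorem listBoundary_mem_of_face {β : V → V → V → Prop} {l : List V} {S : Set (List V)}
    (h : ∀ l', Face β l l' → l' ∈ S) : listBoundary β l ∈ supported ℤ ℤ S :=
  supported_mono (fun l' hl' => h l' hl') (listBoundary_mem β l)

theorem bd_mem_of_face {β : V → V → V → Prop} {S T : Set (List V)}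
    (h : ∀ l ∈ S, ∀ l', Face β l l' → l' ∈ T) {z : List V →₀ ℤ} (hz : z ∈ supported ℤ ℤ S) :
    bd β z ∈ supported ℤ ℤ T :=
  map_mem_of_supported (fun l hl => by rw [bd_single]; exact listBoundary_mem_of_face (h l hl)) hz

theorem Face.head_eq {β : V → V → V → Prop} {a : V} {l l' : List V} (h : Face β (a :: l) l') :
    ∃ t, l' = a :: t := by
  cases h with
  | head l h => exact ⟨_, rfl⟩
  | cons a h => exact ⟨_, rfl⟩

theorem Face.exists_head {β : V → V → V → Prop} {l l' : List V} (h : Face β l l') :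
    ∃ a t t', l = a :: t ∧ l' = a :: t' := by
  cases h with
  | head l h => exact ⟨_, _, _, rfl, rfl⟩
  | cons a h => exact ⟨_, _, _, rfl, rfl⟩

theorem Face.length_eq {β : V → V → V → Prop} {l l' : List V} (h : Face β l l') :
    l.length = l'.length + 1 := by
  induction h with
  | head => rfl
  | cons a _ ih => simp [ih]

theorem Face.sublist {β : V → V → V → Prop} {l l' : List V} (h : Face β l l') :
    l'.Sublist l := by
  induction h with
  | head l _ => exact List.Sublist.cons_cons _ (List.sublist_cons_self _ _)
  | cons a _ ih => exact ih.cons_cons a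

theorem Face.mono {β γ : V → V → V → Prop} (hβ : ∀ a b c, β a b c → γ a b c) {l l' : List V}
    (h : Face β l l') : Face γ l l' := by
  induction h with
  | head l h => exact .head l (hβ _ _ _ h)
  | cons a _ ih => exact .cons a ih

/-- Lists with first entry `a`. -/
def headed (a : V) : Set (List V) := {l | ∃ t, l = a :: t}

theorem listBoundary_mem_headed (β : V → V → V → Prop) (a : V) (l : List V) :
    listBoundary β (a :: l) ∈ supported ℤ ℤ (headed a) :=
  listBoundary_mem_of_face fun _ h => h.head_eq

theorem eq_of_headed {M : Type*} [AddCommGroup M] {a : V} {f g : (List V →₀ ℤ) →ₗ[ℤ] M}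
    (h : ∀ t, f (single (a :: t) 1) = g (single (a :: t) 1)) {z : List V →₀ ℤ}
    (hz : z ∈ supported ℤ ℤ (headed a)) : f z = g z :=
  eq_of_supported (by rintro _ ⟨t, rfl⟩; exact h t) hz

open Classical in
theorem firstFaceMap_consMap (β : V → V → V → Prop) (a b : V) {c : V} {z : List V →₀ ℤ}
    (hz : z ∈ supported ℤ ℤ (headed c)) :
    firstFaceMap β a (consMap b z) = if β a b c then consMap a z else 0 := by
  split_ifs with h
  · exact eq_of_headed (f := firstFaceMap β a ∘ₗ consMap b) (fun t => by simp [firstFace, h]) hz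
  · exact eq_of_headed (f := firstFaceMap β a ∘ₗ consMap b) (g := 0)
      (fun t => by simp [firstFace, h]) hz

theorem bd_eq_bd_add_bd {β β' β'' : V → V → V → Prop}
    (h : ∀ a b c, β a b c ↔ (β' a b c ∨ β'' a b c)) (h' : ∀ a b c, β' a b c → ¬ β'' a b c) :
    bd β = bd β' + bd β'' := by
  refine eq_of_single fun l => ?_
  simp only [bd_single, LinearMap.add_apply]
  induction l with
  | nil => simp [listBoundary]
  | cons a l ih =>
    have : firstFace β a l = firstFace β' a l + firstFace β'' a l := by
      match l with
      | [] => simp [firstFace]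
      | [b] => simp [firstFace]
      | b :: c :: l =>
        by_cases h1 : β' a b c
        · simp [firstFace, h, h1, h' _ _ _ h1]
        · by_cases h2 : β'' a b c <;> simp [firstFace, h, h1, h2]
    rw [listBoundary, ih, this, listBoundary, listBoundary, map_add]
    abel

/-- The associativity of the partial multiplication encoded by `β`. -/
def IsAssocRel (β : V → V → V → Prop) : Prop :=
  ∀ a b c d, (β a b c ∧ β a c d) ↔ (β b c d ∧ β a b d)

open Classical in
theorem IsAssocRel.bd_firstFaceMap {β : V → V → V → Prop} (hβ : IsAssocRel β) (a : V)
    (z : List V →₀ ℤ) : bd β (firstFaceMap β a z) = firstFaceMap β a (bd β z) := by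
  have : bd β ∘ₗ firstFaceMap β a = firstFaceMap β a ∘ₗ bd β := by
    refine eq_of_single fun l => ?_
    match l with
    | [] => simp [firstFace, listBoundary]
    | [b] => simp [firstFace, listBoundary]
    | b :: c :: l =>
      have h1 : firstFaceMap β a (firstFace β b (c :: l)) =
          if β a b c then firstFace β a (c :: l) else 0 := by
        cases l with
        | nil => simp [firstFace]
        | cons d l =>
          have := hβ a b c d
          by_cases h1 : β a b c <;> by_cases h2 : β a c d <;> by_cases h3 : β b c d <;>
            by_cases h4 : β a b d <;> simp_all [firstFace]
      simp only [LinearMap.comp_apply, firstFaceMap_single, bd_single]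
      rw [listBoundary_cons β b, map_sub, h1,
        firstFaceMap_consMap β a b (listBoundary_mem_headed β c l), firstFace]
      split_ifs
      · rw [bd_single, listBoundary_cons]
      · simp
  exact LinearMap.congr_fun this z

theorem IsAssocRel.bd_bd {β : V → V → V → Prop} (hβ : IsAssocRel β) (z : List V →₀ ℤ) :
    bd β (bd β z) = 0 := by
  have : bd β ∘ₗ bd β = 0 := by
    refine eq_of_single fun l => ?_
    induction l with
    | nil => simp [listBoundary]
    | cons a l ih =>
      simp only [LinearMap.comp_apply, bd_single, LinearMap.zero_apply] at ih ⊢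
      rw [listBoundary, map_sub, bd_consMap, ih, map_zero, sub_zero, ← firstFaceMap_single,
        hβ.bd_firstFaceMap, bd_single, sub_self]
  exact LinearMap.congr_fun this z

/-! ### Maps of lists -/

open Classical in
/-- The map induced by `f : V → V'` on chains of lists, with the lists that violate `Q` between
consecutive entries sent to zero. -/
noncomputable def pushMap (Q : V → V → Prop) (f : V → V') :
    (List V →₀ ℤ) →ₗ[ℤ] (List V' →₀ ℤ) :=
  Finsupp.linearCombination ℤ fun l => if l.IsChain Q then single (l.map f) 1 else 0

theorem pushMap_single {Q : V → V → Prop} (f : V → V') {l : List V} (h : l.IsChain Q) :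
    pushMap Q f (single l 1) = single (l.map f) 1 := by
  simp [pushMap, h]

theorem pushMap_single_of_not {Q : V → V → Prop} (f : V → V') {l : List V} (h : ¬ l.IsChain Q) :
    pushMap Q f (single l 1) = 0 := by
  simp [pushMap, h]

theorem pushMap_single_true (f : V → V') (l : List V) :
    pushMap (fun _ _ => True) f (single l 1) = single (l.map f) 1 := by
  refine pushMap_single f ?_
  induction l with
  | nil => simp
  | cons a l ih => cases l with
    | nil => simp
    | cons b l => exact List.isChain_cons_cons.2 ⟨trivial, ih⟩

open Classical in
theorem pushMap_consMap (Q : V → V → Prop) (f : V → V') (a : V) {b : V} {z : List V →₀ ℤ}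
    (hz : z ∈ supported ℤ ℤ (headed b)) :
    pushMap Q f (consMap a z) = if Q a b then consMap (f a) (pushMap Q f z) else 0 := by
  split_ifs with h
  · refine eq_of_headed (f := pushMap Q f ∘ₗ consMap a) (g := consMap (f a) ∘ₗ pushMap Q f)
      (fun t => ?_) hz
    by_cases ht : (b :: t).IsChain Q <;> simp [pushMap, h, ht]
  · refine eq_of_headed (f := pushMap Q f ∘ₗ consMap a) (g := 0) (fun t => ?_) hz
    simp [pushMap, h]

open Classical in
/-- `pushMap Q f` is a chain map as soon as a face survives on both sides under the same
conditions. -/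
theorem bd_pushMap {β : V → V → V → Prop} {β' : V' → V' → V' → Prop} {Q : V → V → Prop}
    {f : V → V'} {S : Set V}
    (h : ∀ x ∈ S, ∀ y ∈ S, ∀ z ∈ S,
      (β x y z ∧ Q x z) ↔ (Q x y ∧ Q y z ∧ β' (f x) (f y) (f z)))
    {z : List V →₀ ℤ} (hz : z ∈ supported ℤ ℤ {l : List V | ∀ x ∈ l, x ∈ S}) :
    bd β' (pushMap Q f z) = pushMap Q f (bd β z) := by
  refine eq_of_supported (f := bd β' ∘ₗ pushMap Q f) (g := pushMap Q f ∘ₗ bd β)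
    (fun l hl => ?_) hz
  simp only [LinearMap.comp_apply, bd_single]
  induction l with
  | nil => simp [pushMap, listBoundary]
  | cons a l ih =>
    have ih := ih fun x hx => hl x (List.mem_cons_of_mem a hx)
    cases l with
    | nil => simp [pushMap, listBoundary, firstFace]
    | cons b l =>
      have h2 : pushMap Q f (firstFace β a (b :: l)) = if Q a b then
          firstFaceMap β' (f a) (pushMap Q f (single (b :: l) 1)) else 0 := by
        cases l with
        | nil => simp [pushMap, firstFace]
        | cons c l =>
          have := h a (hl a (by simp)) b (hl b (by simp)) c (hl c (by simp))
          by_cases h1 : β a b c <;> by_cases h2 : Q a c <;> by_cases h3 : Q a b <;>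
            by_cases h4 : Q b c <;> by_cases h5 : β' (f a) (f b) (f c) <;>
            by_cases h6 : (c :: l).IsChain Q <;>
            simp only [h1, h2, h3, h4, h5, and_true, and_self, and_false, iff_true, iff_false,
              not_true] at this <;>
            simp [firstFace, pushMap, h1, h2, h3, h4, h5, h6]
      have h3 : single (a :: b :: l) (1 : ℤ) = consMap a (single (b :: l) 1) := by simp
      rw [listBoundary_cons, map_sub, h2, pushMap_consMap Q f a (listBoundary_mem_headed β b l),
        ← ih, h3, pushMap_consMap Q f a (single_mem_supported ℤ _ ⟨l, rfl⟩)]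
      split_ifs
      · rw [bd_consMap]
      · simp

/-! ### Reversal -/

/-- Appending `c` to every list. -/
noncomputable def snocMap (c : V) : (List V →₀ ℤ) →ₗ[ℤ] (List V →₀ ℤ) :=
  Finsupp.lmapDomain ℤ ℤ (· ++ [c])

@[simp] theorem snocMap_single (c : V) (l : List V) (n : ℤ) :
    snocMap c (single l n) = single (l ++ [c]) n := by
  simp [snocMap, Finsupp.mapDomain_single]

theorem snocMap_consMap (c a : V) (z : List V →₀ ℤ) :
    snocMap c (consMap a z) = consMap a (snocMap c z) := by
  have : snocMap c ∘ₗ consMap a = consMap a ∘ₗ snocMap c := eq_of_single fun l => by simp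
  exact LinearMap.congr_fun this z

open Classical in
theorem listBoundary_snoc (β : V → V → V → Prop) (l : List V) (a b c : V) :
    listBoundary β (l ++ [a, b, c]) = snocMap c (listBoundary β (l ++ [a, b])) +
      (-1) ^ l.length • if β a b c then single (l ++ [a, c]) 1 else 0 := by
  induction l with
  | nil => simp [listBoundary, firstFace]
  | cons x l ih =>
    have h1 : firstFace β x (l ++ [a, b, c]) = snocMap c (firstFace β x (l ++ [a, b])) := by
      match l with
      | [] => by_cases h : β x a b <;> simp [firstFace, h]
      | [y] => by_cases h : β x y a <;> simp [firstFace, h]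
      | y :: z :: l => by_cases h : β x y z <;> simp [firstFace, h]
    rw [List.cons_append, listBoundary, ih, h1, List.cons_append, listBoundary, map_sub,
      snocMap_consMap, map_add]
    by_cases h : β a b c
    · simp [h, pow_succ]
      abel
    · simp [h]

/-- Reversal of every list. -/
noncomputable def revMap : (List V →₀ ℤ) →ₗ[ℤ] (List V →₀ ℤ) :=
  Finsupp.lmapDomain ℤ ℤ List.reverse

@[simp] theorem revMap_single (l : List V) (n : ℤ) :
    revMap (single l n) = single l.reverse n := by
  simp [revMap, Finsupp.mapDomain_single]

@[simp] theorem revMap_revMap (z : List V →₀ ℤ) : revMap (revMap z) = z := by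
  have : revMap ∘ₗ revMap = (LinearMap.id : (List V →₀ ℤ) →ₗ[ℤ] _) := eq_of_single fun l => by simp
  exact LinearMap.congr_fun this z

theorem revMap_consMap (a : V) (z : List V →₀ ℤ) :
    revMap (consMap a z) = snocMap a (revMap z) := by
  have : revMap ∘ₗ consMap a = snocMap a ∘ₗ revMap := eq_of_single fun l => by simp
  exact LinearMap.congr_fun this z

theorem listBoundary_reverse {β : V → V → V → Prop} (hβ : ∀ a b c, β a b c ↔ β c b a)
    (l : List V) :
    listBoundary β l.reverse = (-1) ^ (l.length + 1) • revMap (listBoundary β l) := by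
  match l with
  | [] => simp [listBoundary]
  | [a] => simp [listBoundary, firstFace]
  | [a, b] => simp [listBoundary, firstFace]
  | a :: b :: c :: l =>
    have ih := listBoundary_reverse hβ (b :: c :: l)
    have e : (a :: b :: c :: l).reverse = l.reverse ++ [c, b, a] := by simp
    have e' : l.reverse ++ [c, b] = (b :: c :: l).reverse := by simp
    rw [e, listBoundary_snoc, e', ih, listBoundary_cons β a, map_sub, map_smul,
      revMap_consMap, firstFace, smul_sub]
    by_cases h : β a b c
    · simp [h, (hβ _ _ _).1 h, pow_succ]
      abel
    · simp [h, mt (hβ c b a).1 h, pow_succ]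

theorem bd_revMap {β : V → V → V → Prop} (hβ : ∀ a b c, β a b c ↔ β c b a) {n : ℕ}
    {z : List V →₀ ℤ} (hz : z ∈ supported ℤ ℤ {l : List V | l.length = n}) :
    bd β (revMap z) = ((-1) ^ (n + 1) : ℤ) • revMap (bd β z) := by
  refine eq_of_supported (f := bd β ∘ₗ revMap) (g := ((-1) ^ (n + 1) : ℤ) • (revMap ∘ₗ bd β))
    (fun l hl => ?_) hz
  have hl : l.length = n := hl
  rw [LinearMap.smul_apply, LinearMap.comp_apply, LinearMap.comp_apply, revMap_single, bd_single,
    bd_single, listBoundary_reverse hβ, hl]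

end Bar

/-! ### Magnitude chains as chains of lists -/

section Graph

variable {V : Type*}

/-- `a` and `b` are distinct vertices of the same component. -/
def Adm (G : SimpleGraph V) (a b : V) : Prop := a ≠ b ∧ G.Reachable a b

/-- `b` lies strictly between `a` and `c`, on a geodesic. -/
def Btw (G : SimpleGraph V) (a b c : V) : Prop :=
  Adm G a b ∧ Adm G b c ∧ G.dist a b + G.dist b c = G.dist a c

/-- The sum of the distances of consecutive entries. -/
noncomputable def listLength (G : SimpleGraph V) : List V → ℕ
  | a :: b :: l => G.dist a b + listLength G (b :: l)
  | _ => 0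

/-- The generators of `MC_{k,l}(G)`, as lists. -/
def genSet (G : SimpleGraph V) (k l : ℕ) : Set (List V) :=
  {e | e.IsChain (Adm G) ∧ e.length = k + 1 ∧ listLength G e = l}

variable {G : SimpleGraph V}

theorem Adm.dist_pos {a b : V} (h : Adm G a b) : 0 < G.dist a b :=
  h.2.pos_dist_of_ne h.1

theorem Adm.symm {a b : V} (h : Adm G a b) : Adm G b a := ⟨h.1.symm, h.2.symm⟩

theorem adm_of_dist_pos {a b : V} (h : 0 < G.dist a b) : Adm G a b :=
  ⟨fun h' => by simp [h'] at h, by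
    by_contra h'
    rw [SimpleGraph.dist_eq_zero_of_not_reachable h'] at h
    exact h.ne rfl⟩

theorem Btw.adm {a b c : V} (h : Btw G a b c) : Adm G a c :=
  adm_of_dist_pos (by have := h.1.dist_pos; have := h.2.2; omega)

theorem btw_iff_dist {a b c : V} :
    Btw G a b c ↔ 0 < G.dist a b ∧ 0 < G.dist b c ∧ G.dist a b + G.dist b c = G.dist a c :=
  ⟨fun h => ⟨h.1.dist_pos, h.2.1.dist_pos, h.2.2⟩,
    fun h => ⟨adm_of_dist_pos h.1, adm_of_dist_pos h.2.1, h.2.2⟩⟩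

theorem Btw.symm {a b c : V} (h : Btw G a b c) : Btw G c b a :=
  ⟨h.2.1.symm, h.1.symm, by
    rw [G.dist_comm (u := c) (v := b), G.dist_comm (u := b) (v := a),
      G.dist_comm (u := c) (v := a), add_comm, h.2.2]⟩

theorem btw_comm {a b c : V} : Btw G a b c ↔ Btw G c b a := ⟨Btw.symm, Btw.symm⟩

theorem dist_triangle_of_reachable {a b c : V} (hab : G.Reachable a b) (hbc : G.Reachable b c) :
    G.dist a c ≤ G.dist a b + G.dist b c := by
  obtain ⟨p, hp⟩ := hab.exists_walk_length_eq_dist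
  obtain ⟨q, hq⟩ := hbc.exists_walk_length_eq_dist
  rw [← hp, ← hq, ← SimpleGraph.Walk.length_append]
  exact SimpleGraph.dist_le _

theorem isAssocRel_btw (G : SimpleGraph V) : IsAssocRel (Btw G) := by
  intro a b c d
  constructor
  · rintro ⟨h1, h2⟩
    have hbd := dist_triangle_of_reachable h1.2.1.2 h2.2.1.2
    have had := dist_triangle_of_reachable h1.1.2 (h1.2.1.2.trans h2.2.1.2)
    have := btw_iff_dist.1 h1
    have := btw_iff_dist.1 h2
    refine ⟨btw_iff_dist.2 ?_, btw_iff_dist.2 ?_⟩ <;> omega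
  · rintro ⟨h1, h2⟩
    have hac := dist_triangle_of_reachable h2.1.2 h1.1.2
    have had := dist_triangle_of_reachable (h2.1.2.trans h1.1.2) h1.2.1.2
    have := btw_iff_dist.1 h1
    have := btw_iff_dist.1 h2
    refine ⟨btw_iff_dist.2 ?_, btw_iff_dist.2 ?_⟩ <;> omega

theorem length_le_listLength {e : List V} (h : e.IsChain (Adm G)) :
    e.length ≤ listLength G e + 1 := by
  induction e with
  | nil => simp
  | cons a e ih =>
    cases e with
    | nil => simp
    | cons b e =>
      rw [List.isChain_cons_cons] at h
      have := ih h.2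
      have := h.1.dist_pos
      simp only [List.length_cons, listLength] at *
      omega

theorem Face.isChain_adm_iff {e e' : List V} (h : Face (Btw G) e e') :
    e'.IsChain (Adm G) ↔ e.IsChain (Adm G) := by
  induction h with
  | head l h => simp [List.isChain_cons_cons, h.1, h.2.1, h.adm]
  | cons a h ih =>
    obtain ⟨b, t, t', rfl, rfl⟩ := h.exists_head
    rw [List.isChain_cons_cons, List.isChain_cons_cons, ih]

theorem Face.listLength_eq {e e' : List V} (h : Face (Btw G) e e') :
    listLength G e' = listLength G e := by
  induction h with
  | head l h => simp only [listLength]; rw [← add_assoc, h.2.2]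
  | cons a h ih =>
    obtain ⟨b, t, t', rfl, rfl⟩ := h.exists_head
    rw [listLength, listLength, ih]

theorem Face.mem_genSet_iff {e e' : List V} (h : Face (Btw G) e e') (k l : ℕ) :
    e' ∈ genSet G k l ↔ e ∈ genSet G (k + 1) l := by
  simp only [genSet, Set.mem_ofPred_eq, h.isChain_adm_iff, h.listLength_eq, h.length_eq,
    add_left_inj]

theorem bd_spanProj (k l : ℕ) (z : List V →₀ ℤ) :
    bd (Btw G) (spanProj (genSet G (k + 1) l) z) = spanProj (genSet G k l) (bd (Btw G) z) := by
  have : bd (Btw G) ∘ₗ spanProj (genSet G (k + 1) l) =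
      spanProj (genSet G k l) ∘ₗ bd (Btw G) := by
    refine eq_of_single fun e => ?_
    simp only [LinearMap.comp_apply, bd_single]
    by_cases h : e ∈ genSet G (k + 1) l
    · rw [spanProj_single_of_mem h, spanProj_of_mem, bd_single]
      exact listBoundary_mem_of_face fun e' h' => (h'.mem_genSet_iff k l).2 h
    · rw [spanProj_single_of_notMem h, map_zero, spanProj_of_disjoint _ (listBoundary_mem _ e)]
      exact fun e' h' h'' => h ((Face.mem_genSet_iff h' k l).1 h'')
  exact LinearMap.congr_fun this z

/-- A chain that bounds a chain of bidegree `(k, l)` can be chosen of bidegree `(k + 1, l)`. -/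
theorem exists_mem_genSet_of_bd {k l : ℕ} {z : List V →₀ ℤ}
    (hz : z ∈ supported ℤ ℤ (genSet G k l)) (h : ∃ w, bd (Btw G) w = z) :
    ∃ w ∈ supported ℤ ℤ (genSet G (k + 1) l), bd (Btw G) w = z := by
  obtain ⟨w, rfl⟩ := h
  refine ⟨spanProj (genSet G (k + 1) l) w, ?_, ?_⟩
  · have := spanProj_mem_inter (genSet G (k + 1) l) (T := Set.univ) (z := w) (by simp)
    rwa [Set.inter_univ] at this
  · rw [bd_spanProj, spanProj_of_mem hz]

/-- The vanishing of the magnitude homology off the diagonal, in terms of lists. -/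
def ListDiagonal (G : SimpleGraph V) : Prop :=
  ∀ k l : ℕ, k ≠ l → ∀ z ∈ supported ℤ ℤ (genSet G k l), bd (Btw G) z = 0 →
    ∃ w, bd (Btw G) w = z

/-! ### Comparison with the magnitude complex -/

theorem isGenerator_succ_iff {k l : ℕ} {x : Fin (k + 2) → V} :
    IsGenerator G l x ↔ Adm G (x 0) (x 1) ∧
      ∃ m, l = G.dist (x 0) (x 1) + m ∧ IsGenerator G m (Fin.tail x) := by
  constructor
  · rintro ⟨h1, h2⟩
    rw [tupleLength_succ] at h2
    have h0 : G.edist (x 0) (x 1) ≠ ⊤ := fun h => by simp [h] at h2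
    have hm : tupleLength G (Fin.tail x) ≠ ⊤ := fun h => by simp [h] at h2
    obtain ⟨m, hm⟩ := ENat.ne_top_iff_exists.1 hm
    have hr := SimpleGraph.reachable_of_edist_ne_top h0
    refine ⟨⟨h1 0, hr⟩, m, ?_, fun i => h1 i.succ, hm.symm⟩
    rw [← hm, ← hr.coe_dist_eq_edist] at h2
    exact_mod_cast h2.symm
  · rintro ⟨h1, m, rfl, h2, h3⟩
    refine ⟨fun i => ?_, ?_⟩
    · induction i using Fin.cases with
      | zero => exact h1.1
      | succ i => exact h2 i
    · rw [tupleLength_succ, h3, ← h1.2.coe_dist_eq_edist]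
      simp

theorem IsGenerator.eq {k l m : ℕ} {x : Fin (k + 1) → V} (h : IsGenerator G l x)
    (h' : IsGenerator G m x) : l = m := by
  have := h.2.symm.trans h'.2
  exact_mod_cast this

theorem isGenerator_iff_ofFn {k l : ℕ} {x : Fin (k + 1) → V} :
    IsGenerator G l x ↔ List.ofFn x ∈ genSet G k l := by
  induction k generalizing l with
  | zero =>
    simp only [IsGenerator, tupleLength, genSet, List.ofFn_succ, List.ofFn_zero]
    simp [listLength]
    norm_cast
  | succ k ih =>
    rw [isGenerator_succ_iff]
    have e : List.ofFn x = x 0 :: List.ofFn (Fin.tail x) := by rw [List.ofFn_succ]; rfl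
    have e' : List.ofFn (Fin.tail x) = x 1 :: List.ofFn (Fin.tail (Fin.tail x)) := by
      rw [List.ofFn_succ]; rfl
    simp only [ih]
    simp only [genSet, Set.mem_ofPred_eq, List.length_ofFn, true_and]
    rw [e, e', List.isChain_cons_cons, listLength]
    constructor
    · rintro ⟨h1, m, rfl, h2, h3⟩
      exact ⟨⟨h1, h2⟩, by rw [h3]⟩
    · rintro ⟨⟨h1, h2⟩, h3⟩
      exact ⟨h1, _, h3.symm, h2, rfl⟩

/-- The inclusion of the magnitude chains into the chains of lists. -/
noncomputable def toLists (G : SimpleGraph V) (k l : ℕ) :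
    MagnitudeChain G k l →ₗ[ℤ] (List V →₀ ℤ) :=
  Finsupp.lmapDomain ℤ ℤ fun x => List.ofFn x.1

theorem toLists_single {k l : ℕ} (x : {x : Fin (k + 1) → V // IsGenerator G l x}) (n : ℤ) :
    toLists G k l (single x n) = single (List.ofFn x.1) n := by
  simp [toLists, Finsupp.mapDomain_single]

theorem toLists_injective (k l : ℕ) : Function.Injective (toLists G k l) :=
  Finsupp.mapDomain_injective fun _ _ h => Subtype.ext (List.ofFn_injective h)

theorem toLists_mem {k l : ℕ} (z : MagnitudeChain G k l) :
    toLists G k l z ∈ supported ℤ ℤ (genSet G k l) := by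
  refine map_mem_of_supported (S := Set.univ) (fun x _ => ?_) (by simp)
  rw [toLists_single]
  exact single_mem_supported ℤ _ (isGenerator_iff_ofFn.1 x.2)

theorem exists_toLists_eq {k l : ℕ} {z : List V →₀ ℤ} (hz : z ∈ supported ℤ ℤ (genSet G k l)) :
    ∃ y, toLists G k l y = z := by
  refine map_mem_of_supported (f := LinearMap.id) (P := LinearMap.range (toLists G k l))
    (fun e he => ?_) hz
  obtain ⟨x, rfl⟩ : ∃ x : Fin (k + 1) → V, List.ofFn x = e := by
    rw [← he.2.1]
    exact ⟨_, List.ofFn_get e⟩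
  exact ⟨single ⟨x, isGenerator_iff_ofFn.2 he⟩ 1, toLists_single _ _⟩

theorem toLists_toChain_of {k l : ℕ} {x : Fin (k + 1) → V} (h : IsGenerator G l x) :
    toLists G k l (toChain G l x) = single (List.ofFn x) 1 := by
  rw [toChain, dif_pos h, toLists_single]

theorem toLists_toChain_of_not {k l : ℕ} {x : Fin (k + 1) → V} (h : ¬ IsGenerator G l x) :
    toLists G k l (toChain G l x) = 0 := by
  rw [toChain, dif_neg h, map_zero]

theorem toLists_toChain_succ {k m : ℕ} {x : Fin (k + 2) → V} (h : Adm G (x 0) (x 1)) :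
    toLists G (k + 1) (G.dist (x 0) (x 1) + m) (toChain G (G.dist (x 0) (x 1) + m) x) =
      consMap (x 0) (toLists G k m (toChain G m (Fin.tail x))) := by
  by_cases hx : IsGenerator G m (Fin.tail x)
  · rw [toLists_toChain_of hx, toLists_toChain_of (isGenerator_succ_iff.2 ⟨h, m, rfl, hx⟩),
      consMap_single, List.ofFn_succ]
    rfl
  · rw [toLists_toChain_of_not hx, toLists_toChain_of_not, map_zero]
    intro h'
    obtain ⟨-, m', hm, h2⟩ := isGenerator_succ_iff.1 h'
    obtain rfl : m = m' := by omega
    exact hx h2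

theorem toLists_toChain_removeNth_one {k l : ℕ} {x : Fin (k + 3) → V} (hx : IsGenerator G l x) :
    toLists G (k + 1) l (toChain G l (Fin.removeNth 1 x)) =
      firstFace (Btw G) (x 0) (List.ofFn (Fin.tail x)) := by
  obtain ⟨h1, m, rfl, h2⟩ := isGenerator_succ_iff.1 hx
  obtain ⟨h3, m, rfl, h4⟩ := isGenerator_succ_iff.1 h2
  have e : List.ofFn (Fin.tail x) = x 1 :: x 2 :: List.ofFn (Fin.tail (Fin.tail (Fin.tail x))) := by
    rw [List.ofFn_succ, List.ofFn_succ]; rfl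
  rw [e, firstFace]
  split_ifs with h
  · rw [toLists_toChain_of, List.ofFn_succ, List.ofFn_succ]
    · rfl
    · exact isGenerator_succ_iff.2 ⟨h.adm, m, by rw [← add_assoc]; exact congrArg (· + m) h.2.2, h4⟩
  · rw [toLists_toChain_of_not]
    intro h'
    obtain ⟨h5, m', h6, h7⟩ := isGenerator_succ_iff.1 h'
    obtain rfl := h4.eq h7
    exact h ⟨h1, h3, Nat.add_right_cancel ((add_assoc _ _ _).trans h6)⟩

theorem sum_toLists_removeNth {n l : ℕ} {x : Fin (n + 2) → V} (hx : IsGenerator G l x) :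
    ∑ i : Fin n, (-1 : ℤ) ^ (i : ℕ) • toLists G n l (toChain G l (i.succ.castSucc.removeNth x)) =
      listBoundary (Btw G) (List.ofFn x) := by
  induction n generalizing l with
  | zero => simp [List.ofFn_succ, listBoundary, firstFace]
  | succ n ih =>
    have e : List.ofFn x = x 0 :: List.ofFn (Fin.tail x) := by rw [List.ofFn_succ]; rfl
    obtain ⟨h1, m, rfl, h2⟩ := isGenerator_succ_iff.1 hx
    rw [Fin.sum_univ_succ, e, listBoundary, ← ih h2, map_sum, ← toLists_toChain_removeNth_one hx,
      sub_eq_add_neg, ← Finset.sum_neg_distrib]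
    refine congrArg₂ (· + ·) (by simp) (Finset.sum_congr rfl fun i _ => ?_)
    have := toLists_toChain_succ (G := G) (k := n) (m := m)
      (x := i.succ.succ.castSucc.removeNth x) h1
    rw [← Fin.succ_castSucc, tail_removeNth_succ] at this
    rw [map_smul, ← Fin.succ_castSucc, Fin.val_succ, pow_succ, mul_neg_one, neg_smul]
    exact congrArg (fun t => -((-1 : ℤ) ^ (i : ℕ) • t)) this

theorem toLists_boundary {n l : ℕ} (z : MagnitudeChain G (n + 1) l) :
    toLists G n l (boundary G l n z) = bd (Btw G) (toLists G (n + 1) l z) := by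
  have : toLists G n l ∘ₗ boundary G l n = bd (Btw G) ∘ₗ toLists G (n + 1) l := by
    refine eq_of_single fun x => ?_
    simp only [LinearMap.comp_apply, boundary_single, toLists_single, bd_single, map_sum, map_smul]
    exact sum_toLists_removeNth x.2
  exact LinearMap.congr_fun this z

theorem bd_eq_zero_of_degree_zero {l : ℕ} {z : List V →₀ ℤ}
    (hz : z ∈ supported ℤ ℤ (genSet G 0 l)) : bd (Btw G) z = 0 := by
  refine eq_of_supported (g := 0) (fun e he => ?_) hz
  obtain ⟨a, rfl⟩ := List.length_eq_one_iff.1 he.2.1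
  simp [listBoundary, firstFace]

theorem subsingleton_magnitudeHomology_iff (k l : ℕ) :
    Subsingleton (magnitudeHomology G k l) ↔
      ∀ z ∈ supported ℤ ℤ (genSet G k l), bd (Btw G) z = 0 → ∃ w, bd (Btw G) w = z := by
  rw [magnitudeHomology, ← ModuleCat.isZero_iff_subsingleton,
    ← HomologicalComplex.exactAt_iff_isZero_homology]
  have key : ∀ z : MagnitudeChain G k l, (∃ y, boundary G l k y = z) ↔
      ∃ w, bd (Btw G) w = toLists G k l z := by
    refine fun z => ⟨fun ⟨y, hy⟩ => ⟨_, by rw [← toLists_boundary, hy]⟩, fun h => ?_⟩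
    obtain ⟨w, hw, h⟩ := exists_mem_genSet_of_bd (toLists_mem z) h
    obtain ⟨y, rfl⟩ := exists_toLists_eq hw
    exact ⟨y, toLists_injective k l (by rw [toLists_boundary, h])⟩
  have key' : (magnitudeComplex G l).ExactAt k ↔ ∀ z : MagnitudeChain G k l,
      bd (Btw G) (toLists G k l z) = 0 → ∃ y, boundary G l k y = z := by
    have hd : ∀ n, (magnitudeComplex G l).d (n + 1) n = ModuleCat.ofHom (boundary G l n) :=
      fun n => ChainComplex.of_d
        (fun k => ModuleCat.of ℤ (MagnitudeChain G k l))
        (fun n => ModuleCat.ofHom (boundary G l n)) n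
    cases k with
    | zero =>
      rw [HomologicalComplex.exactAt_iff' _ 1 0 0 (by simp) (by simp),
        ShortComplex.moduleCat_exact_iff]
      have h0 : (magnitudeComplex G l).d 0 0 = 0 := (magnitudeComplex G l).shape _ _ (by simp)
      refine forall_congr' fun z => ?_
      simp only [HomologicalComplex.shortComplexFunctor'_obj_f,
        HomologicalComplex.shortComplexFunctor'_obj_g, HomologicalComplex.sc', h0, hd 0]
      exact ⟨fun h _ => h rfl, fun h _ => h (bd_eq_zero_of_degree_zero (toLists_mem z))⟩
    | succ k =>
      have (z : MagnitudeChain G (k + 1) l) :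
          boundary G l k z = 0 ↔ bd (Btw G) (toLists G (k + 1) l z) = 0 := by
        rw [← toLists_boundary, ← (toLists_injective k l).eq_iff, map_zero]
      rw [HomologicalComplex.exactAt_iff' _ (k + 2) (k + 1) k (by simp) (by simp),
        ShortComplex.moduleCat_exact_iff]
      refine forall_congr' fun z => ?_
      simp only [HomologicalComplex.shortComplexFunctor'_obj_f,
        HomologicalComplex.shortComplexFunctor'_obj_g, HomologicalComplex.sc', hd]
      exact imp_congr (this z) Iff.rfl
  rw [key']
  constructor
  · intro h z hz hbz
    obtain ⟨y, rfl⟩ := exists_toLists_eq hz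
    exact (key y).1 (h y hbz)
  · exact fun h z hz => (key z).2 (h _ (toLists_mem z) hz)

theorem isDiagonal_iff : IsDiagonal G ↔ ListDiagonal G :=
  forall_congr' fun k => forall_congr' fun l => imp_congr_right fun _ =>
    subsingleton_magnitudeHomology_iff k l

/-! ### Contractions off the diagonal -/

/-- Exactness off the diagonal is witnessed by a contracting homotopy, since the chain groups are
free. It is built degree by degree; finitely many degrees suffice for the applications. -/
theorem exists_contraction (hG : ListDiagonal G) (n : ℕ) :
    ∃ s : (List V →₀ ℤ) →ₗ[ℤ] (List V →₀ ℤ),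
      (∀ e, s (single e 1) ∈ supported ℤ ℤ {e' | e'.length = e.length + 1}) ∧
      (∀ k l, ∀ e ∈ genSet G k l, s (single e 1) ∈ supported ℤ ℤ (genSet G (k + 1) l)) ∧
      ∀ k l, k < n → k ≠ l → ∀ e ∈ genSet G k l,
        bd (Btw G) (s (single e 1)) + s (bd (Btw G) (single e 1)) = single e 1 := by
  classical
  induction n with
  | zero => exact ⟨0, by simp, by simp, by simp⟩
  | succ n ih =>
    obtain ⟨s, hs1, hs2, hs3⟩ := ih
    -- the cycle `e - s (∂ e)` bounds, as its degree is not its length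
    have hw : ∀ e : List V, ∃ w, w ∈ supported ℤ ℤ {e' : List V | e'.length = e.length + 1} ∧
        ∀ l, e ∈ genSet G n l → w ∈ supported ℤ ℤ (genSet G (n + 1) l) ∧
          (n ≠ l → bd (Btw G) w + s (bd (Btw G) (single e 1)) = single e 1) := by
      intro e
      by_cases he : ∃ l, e ∈ genSet G n l ∧ n ≠ l
      · obtain ⟨l, he, hl⟩ := he
        have hbe : bd (Btw G) (single e 1) ∈
            supported ℤ ℤ {e' | ∃ k, k + 1 = n ∧ e' ∈ genSet G k l} := by
          rw [bd_single]
          refine listBoundary_mem_of_face fun e' h' => ?_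
          cases n with
          | zero =>
            have := h'.length_eq
            obtain ⟨a, t, t', rfl, rfl⟩ := h'.exists_head
            have := he.2.1
            simp_all
          | succ k => exact ⟨k, rfl, (h'.mem_genSet_iff k l).2 he⟩
        have hln : n ≤ l := by
          have := length_le_listLength he.1
          rw [he.2.1, he.2.2] at this
          omega
        have h1 : bd (Btw G) (s (bd (Btw G) (single e 1))) = bd (Btw G) (single e 1) := by
          have := eq_of_supported (f := bd (Btw G) ∘ₗ s + s ∘ₗ bd (Btw G)) (g := LinearMap.id)
            (fun e' he' => ?_) hbe
          · rwa [LinearMap.add_apply, LinearMap.comp_apply, LinearMap.comp_apply,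
              (isAssocRel_btw G).bd_bd, map_zero, add_zero] at this
          · obtain ⟨k, rfl, he'⟩ := he'
            exact hs3 k l (by omega) (by omega) e' he'
        have h2 : s (bd (Btw G) (single e 1)) ∈ supported ℤ ℤ (genSet G n l) := by
          refine map_mem_of_supported (fun e' he' => ?_) hbe
          obtain ⟨k, rfl, he'⟩ := he'
          exact hs2 k l e' he'
        obtain ⟨w, hw, hbw⟩ := exists_mem_genSet_of_bd
          (sub_mem (single_mem_supported ℤ (1 : ℤ) he) h2)
          (hG n l hl _ (sub_mem (single_mem_supported ℤ (1 : ℤ) he) h2)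
            (by rw [map_sub, h1, sub_self]))
        refine ⟨w, supported_mono (fun e' he' => ?_) hw, fun l' hl' => ?_⟩
        · exact he'.2.1.trans (by rw [he.2.1])
        · obtain rfl : l' = l := hl'.2.2.symm.trans he.2.2
          exact ⟨hw, fun _ => by rw [hbw, sub_add_cancel]⟩
      · exact ⟨0, zero_mem _, fun l hl => ⟨zero_mem _, fun h => (he ⟨l, hl, h⟩).elim⟩⟩
    choose w hw1 hw2 using hw
    let s' : (List V →₀ ℤ) →ₗ[ℤ] (List V →₀ ℤ) := Finsupp.linearCombination ℤ fun e =>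
      if e.length = n + 1 then w e else s (single e 1)
    have hs' : ∀ e : List V, e.length = n + 1 → s' (single e 1) = w e := fun e he => by
      simp [s', he]
    have hs'' : ∀ e : List V, e.length ≠ n + 1 → s' (single e 1) = s (single e 1) :=
      fun e he => by simp [s', he]
    have hbd : ∀ e : List V, e.length ≤ n + 1 →
        s' (bd (Btw G) (single e 1)) = s (bd (Btw G) (single e 1)) := by
      intro e he
      refine eq_of_supported (S := {e' | Face (Btw G) e e'}) (fun e' he' => hs'' _ ?_)
        (by rw [bd_single]; exact listBoundary_mem _ _)
      have := Face.length_eq he'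
      omega
    refine ⟨s', fun e => ?_, fun k l e he => ?_, fun k l hk hkl e he => ?_⟩
    · by_cases h : e.length = n + 1
      · rw [hs' e h]
        exact hw1 e
      · rw [hs'' e h]
        exact hs1 e
    · by_cases h : e.length = n + 1
      · obtain rfl : k = n := by have := he.2.1; omega
        rw [hs' e h]
        exact (hw2 e l he).1
      · rw [hs'' e h]
        exact hs2 k l e he
    · have hl := he.2.1
      rw [hbd e (by omega)]
      by_cases h : e.length = n + 1
      · obtain rfl : k = n := by omega
        rw [hs' e h]
        exact (hw2 e l he).2 hkl
      · rw [hs'' e h]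
        exact hs3 k l (by omega) hkl e he

end Graph

/-! ### Steps in a cartesian product -/

section Product

variable {V W : Type*} {G : SimpleGraph V} {H : SimpleGraph W}

/-- `b` lies on a geodesic from `a` to `c`, possibly at one of its ends. -/
def WeakBtw (G : SimpleGraph V) (a b c : V) : Prop :=
  G.Reachable a b ∧ G.Reachable b c ∧ G.dist a b + G.dist b c = G.dist a c

theorem WeakBtw.ne_of_left {a b c : V} (h : WeakBtw G a b c) (hab : a ≠ b) : a ≠ c := by
  rintro rfl
  have := h.1.pos_dist_of_ne hab
  have h2 := h.2.2
  rw [SimpleGraph.dist_self] at h2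
  omega

theorem WeakBtw.ne_of_right {a b c : V} (h : WeakBtw G a b c) (hbc : b ≠ c) : a ≠ c := by
  rintro rfl
  have := h.2.1.pos_dist_of_ne hbc
  have h2 := h.2.2
  rw [SimpleGraph.dist_self] at h2
  omega

theorem weakBtw_left {a b : V} : WeakBtw G a a b ↔ G.Reachable a b := by
  simp [WeakBtw]

theorem weakBtw_right {a b : V} : WeakBtw G a b b ↔ G.Reachable a b := by
  simp [WeakBtw]

theorem dist_box {p q : V × W} (h : (G.boxProd H).Reachable p q) :
    (G.boxProd H).dist p q = G.dist p.1 q.1 + H.dist p.2 q.2 := by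
  have h' := SimpleGraph.reachable_boxProd.1 h
  have := SimpleGraph.edist_boxProd (G := G) (H := H) p q
  rw [← h.coe_dist_eq_edist, ← h'.1.coe_dist_eq_edist, ← h'.2.coe_dist_eq_edist] at this
  exact_mod_cast this

theorem btw_box_iff {p q r : V × W} :
    Btw (G.boxProd H) p q r ↔
      p ≠ q ∧ q ≠ r ∧ WeakBtw G p.1 q.1 r.1 ∧ WeakBtw H p.2 q.2 r.2 := by
  constructor
  · rintro ⟨⟨h1, h2⟩, ⟨h3, h4⟩, h5⟩
    rw [dist_box h2, dist_box h4, dist_box (h2.trans h4)] at h5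
    rw [SimpleGraph.reachable_boxProd] at h2 h4
    have hG := dist_triangle_of_reachable h2.1 h4.1
    have hH := dist_triangle_of_reachable h2.2 h4.2
    exact ⟨h1, h3, ⟨h2.1, h4.1, by omega⟩, ⟨h2.2, h4.2, by omega⟩⟩
  · rintro ⟨h1, h2, h3, h4⟩
    have h5 : (G.boxProd H).Reachable p q := SimpleGraph.reachable_boxProd.2 ⟨h3.1, h4.1⟩
    have h6 : (G.boxProd H).Reachable q r := SimpleGraph.reachable_boxProd.2 ⟨h3.2.1, h4.2.1⟩
    refine ⟨⟨h1, h5⟩, ⟨h2, h6⟩, ?_⟩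
    have := h3.2.2
    have := h4.2.2
    rw [dist_box h5, dist_box h6, dist_box (h5.trans h6)]
    omega

/-- The faces of lists in `V × W` for which no step that moves in `W` is merged with a later step
that moves in `V`. -/
def SortBtw (G : SimpleGraph V) (H : SimpleGraph W) (p q r : V × W) : Prop :=
  Btw (G.boxProd H) p q r ∧ (p.2 = q.2 ∨ q.1 = r.1)

/-- The faces of lists in `V × W` that are not covered by `SortBtw`. -/
def UnsortBtw (G : SimpleGraph V) (H : SimpleGraph W) (p q r : V × W) : Prop :=
  Btw (G.boxProd H) p q r ∧ p.2 ≠ q.2 ∧ q.1 ≠ r.1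

theorem bd_box_eq : bd (Btw (G.boxProd H)) = bd (SortBtw G H) + bd (UnsortBtw G H) :=
  bd_eq_bd_add_bd (fun p q r => by unfold SortBtw UnsortBtw; tauto)
    (fun p q r => by unfold SortBtw UnsortBtw; tauto)

/-- Some step of the list moves in `W`. -/
def MovesSnd : List (V × W) → Prop
  | p :: q :: l => p.2 ≠ q.2 ∨ MovesSnd (q :: l)
  | _ => False

/-- Some step of the list moves in `V`, and the same or a later one moves in `W`. -/
def Unsorted : List (V × W) → Prop
  | p :: q :: l => (p.1 ≠ q.1 ∧ MovesSnd (p :: q :: l)) ∨ Unsorted (q :: l)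
  | _ => False

open Classical in
/-- The number of steps that move in `V`. -/
noncomputable def countFst : List (V × W) → ℕ
  | p :: q :: l => (if p.1 ≠ q.1 then 1 else 0) + countFst (q :: l)
  | _ => 0

open Classical in
/-- The number of pairs of a step that moves in `W` and a later step that moves in `V`. -/
noncomputable def inversions : List (V × W) → ℕ
  | p :: q :: l => (if p.2 ≠ q.2 then countFst (q :: l) else 0) + inversions (q :: l)
  | _ => 0

/-- The step from `q` to the first entry of the list does not move in `V`. -/
def StartsSnd (q : V × W) : List (V × W) → Prop
  | r :: _ => q.1 = r.1
  | _ => False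

open Classical in
/-- If a step `p → q` that moves in both factors comes before every pair of a step in `V` followed
by a step in `W`, the list with `(q.1, p.2)` inserted between `p` and `q`, with a sign; otherwise
`0`. -/
noncomputable def splitList : List (V × W) → (List (V × W) →₀ ℤ)
  | p :: q :: l =>
    if p.1 ≠ q.1 ∧ p.2 ≠ q.2 then single (p :: (q.1, p.2) :: q :: l) 1
    else if p.1 ≠ q.1 ∧ StartsSnd q l then 0
    else -consMap p (splitList (q :: l))
  | _ => 0

/-- The linear extension of `splitList`. -/
noncomputable def splitMap : (List (V × W) →₀ ℤ) →ₗ[ℤ] (List (V × W) →₀ ℤ) :=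
  Finsupp.linearCombination ℤ splitList

@[simp] theorem splitMap_single (l : List (V × W)) : splitMap (single l 1) = splitList l := by
  simp [splitMap]

theorem splitList_of_diag {p q : V × W} (h1 : p.1 ≠ q.1) (h2 : p.2 ≠ q.2) (l : List (V × W)) :
    splitList (p :: q :: l) = single (p :: (q.1, p.2) :: q :: l) 1 := by
  simp [splitList, h1, h2]

theorem splitList_of_turn {p q : V × W} (h1 : p.1 ≠ q.1) (h2 : p.2 = q.2) {l : List (V × W)}
    (h3 : StartsSnd q l) : splitList (p :: q :: l) = 0 := by
  simp [splitList, h1, h2, h3]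

theorem splitList_of_else {p q : V × W} {l : List (V × W)}
    (h : p.1 = q.1 ∨ (p.2 = q.2 ∧ ¬ StartsSnd q l)) :
    splitList (p :: q :: l) = -consMap p (splitList (q :: l)) := by
  rw [splitList, if_neg (by tauto), if_neg (by tauto)]

/-- `Split l l'` says that `l'` is obtained from `l` by breaking up a step that moves in both
factors. -/
inductive Split : List (V × W) → List (V × W) → Prop
  | head {p q : V × W} (l : List (V × W)) : p.1 ≠ q.1 → p.2 ≠ q.2 →
      Split (p :: q :: l) (p :: (q.1, p.2) :: q :: l)
  | cons (p : V × W) {l l' : List (V × W)} : Split l l' → Split (p :: l) (p :: l')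

theorem Split.exists_head {l l' : List (V × W)} (h : Split l l') :
    ∃ a t t', l = a :: t ∧ l' = a :: t' := by
  cases h with
  | head l _ _ => exact ⟨_, _, _, rfl, rfl⟩
  | cons a h => exact ⟨_, _, _, rfl, rfl⟩

theorem splitList_mem (l : List (V × W)) :
    splitList l ∈ supported ℤ ℤ {l' | Split l l'} := by
  induction l with
  | nil => exact zero_mem _
  | cons p l ih =>
    cases l with
    | nil => exact zero_mem _
    | cons q l =>
      rw [splitList]
      split_ifs with h1 h2
      · exact single_mem_supported ℤ _ (.head l h1.1 h1.2)
      · exact zero_mem _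
      · refine neg_mem (map_mem_of_supported (fun e he => ?_) ih)
        rw [consMap_single]
        exact single_mem_supported ℤ _ (.cons p he)

theorem splitList_mem_headed (p : V × W) (l : List (V × W)) :
    splitList (p :: l) ∈ supported ℤ ℤ (headed p) := by
  refine supported_mono (fun l' h => ?_) (splitList_mem (p :: l))
  obtain ⟨a, t, t', h1, rfl⟩ := Split.exists_head h
  exact ⟨t', by rw [(List.cons.inj h1).1]⟩

theorem Split.isChain {l l' : List (V × W)} (h : Split l l')
    (hl : l.IsChain (Adm (G.boxProd H))) : l'.IsChain (Adm (G.boxProd H)) := by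
  induction h with
  | @head p q l h1 h2 =>
    rw [List.isChain_cons_cons] at hl ⊢
    rw [List.isChain_cons_cons]
    have := SimpleGraph.reachable_boxProd.1 hl.1.2
    refine ⟨⟨fun h => h1 (Prod.ext_iff.1 h).1, SimpleGraph.reachable_boxProd.2 ⟨this.1, by rfl⟩⟩,
      ⟨fun h => h2 (Prod.ext_iff.1 h).2, SimpleGraph.reachable_boxProd.2 ⟨by rfl, this.2⟩⟩, hl.2⟩
  | cons p h ih =>
    obtain ⟨a, t, t', rfl, rfl⟩ := h.exists_head
    rw [List.isChain_cons_cons] at hl ⊢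
    exact ⟨hl.1, ih hl.2⟩

theorem Split.movesSnd_iff {l l' : List (V × W)} (h : Split l l') : MovesSnd l' ↔ MovesSnd l := by
  induction h with
  | head l h1 h2 => simp [MovesSnd]
  | cons p h ih =>
    obtain ⟨a, t, t', rfl, rfl⟩ := h.exists_head
    simp only [MovesSnd, ih]

theorem Split.countFst_eq {l l' : List (V × W)} (h : Split l l') : countFst l' = countFst l := by
  induction h with
  | head l h1 h2 => simp [countFst]
  | cons p h ih =>
    obtain ⟨a, t, t', rfl, rfl⟩ := h.exists_head
    simp only [countFst, ih]

theorem Split.inversions_eq {l l' : List (V × W)} (h : Split l l') :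
    inversions l' = inversions l := by
  induction h with
  | head l h1 h2 => simp [inversions]
  | cons p h ih =>
    obtain ⟨a, t, t', rfl, rfl⟩ := h.exists_head
    simp only [inversions, ih, h.countFst_eq]

theorem Split.unsorted {l l' : List (V × W)} (h : Split l l') (hl : Unsorted l) :
    Unsorted l' := by
  induction h with
  | head l h1 h2 => simp [Unsorted, MovesSnd, h1, h2]
  | cons p h ih =>
    have := h.movesSnd_iff
    obtain ⟨a, t, t', rfl, rfl⟩ := h.exists_head
    simp only [Unsorted, MovesSnd, this] at hl ⊢
    tauto

theorem Face.movesSnd_iff {l l' : List (V × W)} (h : Face (Btw (G.boxProd H)) l l') :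
    MovesSnd l' ↔ MovesSnd l := by
  induction h with
  | @head p q r l h =>
    obtain ⟨-, -, -, h⟩ := btw_box_iff.1 h
    have h1 := h.ne_of_left
    have h2 := h.ne_of_right
    simp only [MovesSnd]
    by_cases e1 : p.2 = q.2
    · rw [e1]; tauto
    · have := h1 e1
      tauto
  | cons p h ih =>
    obtain ⟨a, t, t', rfl, rfl⟩ := h.exists_head
    simp only [MovesSnd, ih]

theorem Face.unsorted {l l' : List (V × W)} (h : Face (Btw (G.boxProd H)) l l')
    (hl : Unsorted l) : Unsorted l' := by
  induction h with
  | @head p q r l h =>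
    have hm : MovesSnd (p :: r :: l) ↔ MovesSnd (p :: q :: r :: l) := (Face.head l h).movesSnd_iff
    obtain ⟨-, -, h, -⟩ := btw_box_iff.1 h
    have h1 := h.ne_of_left
    have h2 := h.ne_of_right
    simp only [Unsorted, hm] at hl ⊢
    simp only [MovesSnd] at hl ⊢
    tauto
  | cons p h ih =>
    have := h.movesSnd_iff
    obtain ⟨a, t, t', rfl, rfl⟩ := h.exists_head
    simp only [Unsorted, MovesSnd, this] at hl ⊢
    tauto

theorem Face.countFst_le {β : V × W → V × W → V × W → Prop} {l l' : List (V × W)}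
    (h : Face β l l') : countFst l' ≤ countFst l := by
  induction h with
  | @head p q r l h =>
    simp only [countFst]
    by_cases e1 : p.1 = q.1
    · rw [e1]; simp
    · rw [if_pos e1]
      split_ifs <;> omega
  | cons p h ih =>
    obtain ⟨a, t, t', rfl, rfl⟩ := h.exists_head
    simp only [countFst]
    omega

theorem Face.inversions_lt {l l' : List (V × W)} (h : Face (UnsortBtw G H) l l') :
    inversions l' < inversions l := by
  induction h with
  | @head p q r l h =>
    have : countFst (q :: r :: l) = 1 + countFst (r :: l) := by simp [countFst, h.2.2]
    simp only [inversions]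
    rw [if_pos h.2.1, this]
    split_ifs <;> omega
  | cons p h ih =>
    have := h.countFst_le
    obtain ⟨a, t, t', rfl, rfl⟩ := h.exists_head
    simp only [inversions]
    split_ifs <;> omega

/-! ### The contraction of the unsorted lists -/

theorem splitMap_consMap {p q : V × W} (h1 : p.1 ≠ q.1) (h2 : p.2 ≠ q.2)
    {z : List (V × W) →₀ ℤ} (hz : z ∈ supported ℤ ℤ (headed q)) :
    splitMap (consMap p z) = consMap p (consMap (q.1, p.2) z) :=
  eq_of_headed (f := splitMap ∘ₗ consMap p) (g := consMap p ∘ₗ consMap (q.1, p.2))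
    (fun t => by simp [splitList_of_diag h1 h2]) hz

/-- Up to sign, `splitMap` commutes with prepending `p` to the faces of `q :: l`, unless the step
`p → q` is the one that `splitMap` acts on. -/
theorem splitMap_consMap_face {p q : V × W} {l : List (V × W)}
    (h : p.1 = q.1 ∨ (p.2 = q.2 ∧ ¬ StartsSnd q l)) :
    splitMap (consMap p (listBoundary (SortBtw G H) (q :: l))) =
      -consMap p (splitMap (listBoundary (SortBtw G H) (q :: l))) := by
  refine eq_of_supported (f := splitMap ∘ₗ consMap p) (g := -(consMap p ∘ₗ splitMap))
    (fun e he => ?_) (listBoundary_mem (SortBtw G H) (q :: l))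
  simp only [LinearMap.comp_apply, LinearMap.neg_apply, consMap_single, splitMap_single]
  have he : Face (SortBtw G H) (q :: l) e := he
  have key : ∃ t, e = q :: t ∧ (StartsSnd q t → StartsSnd q l) := by
    cases he with
    | @head _ r s t h' =>
      obtain ⟨-, -, hw, -⟩ := btw_box_iff.1 h'.1
      refine ⟨_, rfl, fun hs => ?_⟩
      by_contra h''
      exact hw.ne_of_left h'' hs
    | cons _ h' =>
      obtain ⟨b, t, t', rfl, rfl⟩ := h'.exists_head
      exact ⟨_, rfl, id⟩
  obtain ⟨t, rfl, ht⟩ := key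
  exact splitList_of_else (by tauto)

theorem splitMap_firstFace_of_diag {p q : V × W} (h1 : p.1 ≠ q.1) (h2 : p.2 ≠ q.2)
    (hpq : (G.boxProd H).Reachable p q) (l : List (V × W)) :
    splitMap (firstFace (SortBtw G H) p (q :: l)) =
      consMap p (firstFace (SortBtw G H) (q.1, p.2) (q :: l)) := by
  cases l with
  | nil => simp [firstFace]
  | cons r l =>
    have hpq := SimpleGraph.reachable_boxProd.1 hpq
    by_cases hqr : q.1 = r.1
    · have hiff : SortBtw G H p q r ↔ SortBtw G H (q.1, p.2) q r := by
        simp only [SortBtw, btw_box_iff, hqr, weakBtw_right, or_true, and_true]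
        simp only [Prod.ext_iff, ne_eq, not_and_or]
        constructor
        · rintro ⟨-, h3, -, h4⟩
          exact ⟨.inr h2, h3, by rfl, h4⟩
        · rintro ⟨-, h3, -, h4⟩
          exact ⟨.inr h2, h3, hqr ▸ hpq.1, h4⟩
      rw [firstFace, firstFace]
      by_cases h : SortBtw G H p q r
      · rw [if_pos h, if_pos (hiff.1 h)]
        obtain ⟨-, -, -, h4⟩ := btw_box_iff.1 h.1
        rw [splitMap_single, splitList_of_diag (hqr ▸ h1) (h4.ne_of_left h2), consMap_single, hqr]
      · rw [if_neg h, if_neg (mt hiff.2 h)]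
        simp
    · rw [firstFace, firstFace, if_neg (by simp [SortBtw, h2, hqr]),
        if_neg (by simp [SortBtw, h2, hqr])]
      simp

theorem splitMap_firstFace_of_else {p q : V × W} {l : List (V × W)}
    (hl : (p :: q :: l).IsChain (Adm (G.boxProd H)))
    (h : p.1 = q.1 ∨ (p.2 = q.2 ∧ ¬ StartsSnd q l)) :
    splitMap (firstFace (SortBtw G H) p (q :: l)) =
      firstFaceMap (SortBtw G H) p (splitList (q :: l)) := by
  cases l with
  | nil => simp [firstFace, splitList]
  | cons r l =>
    rw [List.isChain_cons_cons, List.isChain_cons_cons] at hl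
    obtain ⟨hpq, hqr, -⟩ := hl
    have hne : p.1 = q.1 → p.2 ≠ q.2 := fun e e' => hpq.1 (Prod.ext e e')
    have hS : StartsSnd q (r :: l) ↔ q.1 = r.1 := Iff.rfl
    rw [hS] at h
    by_cases hd : q.1 ≠ r.1 ∧ q.2 ≠ r.2
    · rw [splitList_of_diag hd.1 hd.2, firstFaceMap_single, firstFace, firstFace]
      rcases h with h | ⟨h, -⟩
      · rw [if_neg (by simp [SortBtw, hne h, hd.1]), if_neg (by simp [SortBtw, hne h, hd.1]),
          map_zero]
      · have h1 : p.1 ≠ q.1 := fun e => hne e h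
        have hiff : SortBtw G H p q r ↔ SortBtw G H p q (r.1, q.2) ∧ H.Reachable q.2 r.2 := by
          simp only [SortBtw, btw_box_iff, h, weakBtw_left, true_or, and_true]
          simp only [Prod.ext_iff, ne_eq, not_and_or]
          have : H.Reachable q.2 q.2 := by rfl
          tauto
        have hr : H.Reachable q.2 r.2 := (SimpleGraph.reachable_boxProd.1 hqr.2).2
        by_cases h' : SortBtw G H p q r
        · obtain ⟨-, -, h3, -⟩ := btw_box_iff.1 h'.1
          rw [if_pos h', if_pos (hiff.1 h').1, splitMap_single,
            splitList_of_diag (h3.ne_of_left h1) (h ▸ hd.2), h]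
        · rw [if_neg h', if_neg fun h'' => h' (hiff.2 ⟨h'', hr⟩), map_zero]
    · by_cases ht : q.1 ≠ r.1 ∧ StartsSnd r l
      · have e : q.2 = r.2 := by tauto
        rw [splitList_of_turn ht.1 e ht.2, map_zero, firstFace]
        split_ifs with h'
        · rcases h with h | ⟨h, -⟩
          · exact absurd h'.2 (by simp [hne h, ht.1])
          · obtain ⟨-, -, h3, -⟩ := btw_box_iff.1 h'.1
            rw [splitMap_single, splitList_of_turn (h3.ne_of_right ht.1) (h.trans e) ht.2]
        · simp
      · rw [splitList_of_else (by tauto), map_neg,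
          firstFaceMap_consMap _ _ _ (splitList_mem_headed r l), firstFace]
        split_ifs with h'
        · rw [splitMap_single, splitList_of_else]
          rcases h with h | ⟨h, h3⟩
          · have := h'.2.resolve_left (hne h)
            exact .inl (h.trans this)
          · exact .inr ⟨h.trans (by tauto), fun h4 => ht ⟨h3, h4⟩⟩
        · simp

open Classical in
/-- For the leading term of the differential, `splitMap` contracts the unsorted lists: a list whose
first relevant event is a step in both factors cancels against the list where this step is split. -/
theorem split_homotopy {l : List (V × W)} (hl : l.IsChain (Adm (G.boxProd H))) :
    bd (SortBtw G H) (splitMap (single l 1)) + splitMap (bd (SortBtw G H) (single l 1)) =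
      if Unsorted l then single l 1 else 0 := by
  induction l with
  | nil => simp [splitList, listBoundary, Unsorted]
  | cons p l ih =>
    cases l with
    | nil => simp [splitList, listBoundary, Unsorted, firstFace]
    | cons q l =>
      have hpq := (List.isChain_cons_cons.1 hl).1
      have ih := ih (List.isChain_cons_cons.1 hl).2
      simp only [splitMap_single, bd_single] at ih ⊢
      by_cases hd : p.1 ≠ q.1 ∧ p.2 ≠ q.2
      · have hR : SortBtw G H p (q.1, p.2) q := by
          have := SimpleGraph.reachable_boxProd.1 hpq.2
          simp only [SortBtw, btw_box_iff, weakBtw_right, weakBtw_left, or_true, and_true]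
          exact ⟨fun e => hd.1 (Prod.ext_iff.1 e).1, fun e => hd.2 (Prod.ext_iff.1 e).2, this⟩
        have e1 : bd (SortBtw G H) (single (p :: (q.1, p.2) :: q :: l) 1) =
            single (p :: q :: l) 1 - consMap p (firstFace (SortBtw G H) (q.1, p.2) (q :: l)) +
              consMap p (consMap (q.1, p.2) (listBoundary (SortBtw G H) (q :: l))) := by
          rw [bd_single, listBoundary_cons, listBoundary_cons, firstFace, if_pos hR, map_sub]
          abel
        rw [splitList_of_diag hd.1 hd.2, e1, listBoundary_cons _ p, map_sub,
          splitMap_firstFace_of_diag hd.1 hd.2 hpq.2,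
          splitMap_consMap hd.1 hd.2 (listBoundary_mem_headed _ _ _),
          if_pos (by simp [Unsorted, MovesSnd, hd])]
        abel
      · by_cases ht : p.1 ≠ q.1 ∧ StartsSnd q l
        -- a turn at `q` is recovered by merging its two steps and splitting the result
        · have e : p.2 = q.2 := by tauto
          cases l with
          | nil => exact ht.2.elim
          | cons r l =>
            have hqr := (List.isChain_cons_cons.1 (List.isChain_cons_cons.1 hl).2).1
            have e2 : q.1 = r.1 := ht.2
            have h2 : q.2 ≠ r.2 := fun e' => hqr.1 (Prod.ext e2 e')
            have hR : SortBtw G H p q r := by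
              refine ⟨btw_box_iff.2 ⟨hpq.1, hqr.1, ?_, ?_⟩, .inl e⟩
              · rw [← e2, weakBtw_right]
                exact (SimpleGraph.reachable_boxProd.1 hpq.2).1
              · rw [e, weakBtw_left]
                exact (SimpleGraph.reachable_boxProd.1 hqr.2).2
            have e3 : splitMap (consMap p (listBoundary (SortBtw G H) (q :: r :: l))) = 0 := by
              refine eq_of_supported (f := splitMap ∘ₗ consMap p) (g := 0) (fun e' he' => ?_)
                (listBoundary_mem (SortBtw G H) (q :: r :: l))
              have he' : Face (SortBtw G H) (q :: r :: l) e' := he'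
              have : ∃ t, e' = q :: t ∧ StartsSnd q t := by
                cases he' with
                | head t h' => exact ⟨_, rfl, e2.trans (h'.2.resolve_left h2)⟩
                | cons _ h' =>
                  obtain ⟨t, rfl⟩ := h'.head_eq
                  exact ⟨_, rfl, e2⟩
              obtain ⟨t, rfl, h3⟩ := this
              simp [splitList_of_turn ht.1 e h3]
            have e4 : ((r.1, p.2) : V × W) = q := Prod.ext e2.symm e
            rw [splitList_of_turn ht.1 e ht.2, listBoundary_cons, map_sub, e3, firstFace,
              if_pos hR, splitMap_single, splitList_of_diag (e2 ▸ ht.1) (e ▸ h2), e4,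
              if_pos (by simp [Unsorted, MovesSnd, ht.1, h2])]
            simp
        · have h : p.1 = q.1 ∨ (p.2 = q.2 ∧ ¬ StartsSnd q l) := by tauto
          have hU : Unsorted (p :: q :: l) ↔ Unsorted (q :: l) := by
            simp only [Unsorted, or_iff_right_iff_imp]
            rintro ⟨h1, h2⟩
            have h3 := h.resolve_left h1
            cases l with
            | nil => simp [MovesSnd, h3.1] at h2
            | cons r l =>
              have h4 : q.1 ≠ r.1 := h3.2
              simp only [MovesSnd, h3.1, ne_eq, not_true, false_or] at h2
              simp only [Unsorted, MovesSnd]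
              exact .inl ⟨h4, h2⟩
          rw [splitList_of_else h, listBoundary_cons, map_sub, splitMap_consMap_face h,
            splitMap_firstFace_of_else hl h, map_neg, bd_consMap]
          have := congrArg (consMap p) ih
          simp only [hU]
          rw [map_add] at this
          rw [sub_neg_eq_add, neg_sub]
          calc _ = consMap p (bd (SortBtw G H) (splitList (q :: l))) +
                consMap p (splitMap (listBoundary (SortBtw G H) (q :: l))) := by abel
            _ = _ := by rw [this]; split_ifs <;> simp

/-- The unsorted generators span an acyclic subcomplex: splitting the first step that moves in both
factors is a contraction, up to terms with fewer inversions. -/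
theorem exists_bd_eq_of_unsorted {z : List (V × W) →₀ ℤ}
    (hz : z ∈ supported ℤ ℤ {l | l.IsChain (Adm (G.boxProd H)) ∧ Unsorted l})
    (hbz : bd (Btw (G.boxProd H)) z = 0) : ∃ w, bd (Btw (G.boxProd H)) w = z := by
  let F : ℕ → Submodule ℤ (List (V × W) →₀ ℤ) := fun n =>
    supported ℤ ℤ {l | (l.IsChain (Adm (G.boxProd H)) ∧ Unsorted l) ∧ inversions l < n}
  obtain ⟨n, hn⟩ := exists_mem_supported_lt inversions z
  have hzn : z ∈ F n := fun l hl => ⟨hz hl, hn l hl⟩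
  have hF : ∀ n, ∀ z ∈ F (n + 1), z - bd (Btw (G.boxProd H)) (splitMap z) -
      splitMap (bd (Btw (G.boxProd H)) z) ∈ F n := by
    intro n z hz
    refine map_mem_of_supported (f := LinearMap.id - bd (Btw (G.boxProd H)) ∘ₗ splitMap -
      splitMap ∘ₗ bd (Btw (G.boxProd H))) (fun l hl => ?_) hz
    obtain ⟨⟨hl, hlU⟩, hln⟩ := hl
    have key := split_homotopy hl
    rw [if_pos hlU] at key
    have h1 : bd (UnsortBtw G H) (splitMap (single l 1)) ∈ F n := by
      rw [splitMap_single]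
      refine bd_mem_of_face (S := {l' | Split l l'}) (fun l' hl' l'' h => ?_) (splitList_mem l)
      have h' : Face (Btw (G.boxProd H)) l' l'' := h.mono fun _ _ _ h => h.1
      have hlt := h.inversions_lt
      rw [Split.inversions_eq hl'] at hlt
      exact ⟨⟨h'.isChain_adm_iff.2 (Split.isChain hl' hl), h'.unsorted (Split.unsorted hl' hlU)⟩,
        by omega⟩
    have h2 : splitMap (bd (UnsortBtw G H) (single l 1)) ∈ F n := by
      rw [bd_single]
      refine map_mem_of_supported (fun l' hl' => ?_) (listBoundary_mem (UnsortBtw G H) l)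
      rw [splitMap_single]
      refine supported_mono (fun l'' h => ?_) (splitList_mem l')
      have h' : Face (Btw (G.boxProd H)) l l' := Face.mono (fun _ _ _ h => h.1) hl'
      have hlt := Face.inversions_lt hl'
      rw [← Split.inversions_eq h] at hlt
      exact ⟨⟨Split.isChain h (h'.isChain_adm_iff.2 hl), Split.unsorted h (h'.unsorted hlU)⟩,
        by omega⟩
    have : (LinearMap.id - bd (Btw (G.boxProd H)) ∘ₗ splitMap - splitMap ∘ₗ bd (Btw (G.boxProd H)) :
        (List (V × W) →₀ ℤ) →ₗ[ℤ] _) (single l 1) =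
        -(bd (UnsortBtw G H) (splitMap (single l 1)) +
          splitMap (bd (UnsortBtw G H) (single l 1))) := by
      simp only [bd_box_eq, LinearMap.sub_apply, LinearMap.comp_apply, LinearMap.add_apply,
        LinearMap.id_apply, map_add]
      nth_rewrite 1 [← key]
      abel
    rw [this]
    exact neg_mem (add_mem h1 h2)
  obtain ⟨w, hw⟩ := exists_sub_mem_of_filtration (isAssocRel_btw _).bd_bd F hF n z hzn hbz
  refine ⟨w, ?_⟩
  have : F 0 = ⊥ := by simp [F]
  rw [this, Submodule.mem_bot, sub_eq_zero] at hw
  exact hw.symm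

end Product

/-! ### Tensor products of list complexes -/

section Tensor

open TensorProduct

variable {V W : Type*} {G : SimpleGraph V} {H : SimpleGraph W}

/-- The tensor product of two chains of lists, as a chain of pairs of lists. -/
noncomputable def outer (y : List W →₀ ℤ) (z : List V →₀ ℤ) : List W × List V →₀ ℤ :=
  finsuppTensorFinsupp' ℤ (List W) (List V) (y ⊗ₜ z)

theorem outer_single (e : List W) (f : List V) (m n : ℤ) :
    outer (single e m) (single f n) = single (e, f) (m * n) := by
  simp [outer]

theorem single_eq_outer (e : List W × List V) :
    single e (1 : ℤ) = outer (single e.1 1) (single e.2 1) := by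
  rw [outer_single, mul_one]

theorem zero_outer (z : List V →₀ ℤ) : outer (0 : List W →₀ ℤ) z = 0 := by
  rw [outer, TensorProduct.zero_tmul, map_zero]

theorem outer_zero (y : List W →₀ ℤ) : outer y (0 : List V →₀ ℤ) = 0 := by
  rw [outer, TensorProduct.tmul_zero, map_zero]

theorem add_outer (y y' : List W →₀ ℤ) (z : List V →₀ ℤ) :
    outer (y + y') z = outer y z + outer y' z := by
  rw [outer, TensorProduct.add_tmul, map_add, outer, outer]

theorem outer_add (y : List W →₀ ℤ) (z z' : List V →₀ ℤ) :
    outer y (z + z') = outer y z + outer y z' := by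
  rw [outer, TensorProduct.tmul_add, map_add, outer, outer]

/-- `outer` as a linear map in its first argument. -/
noncomputable def outerLeft (z : List V →₀ ℤ) : (List W →₀ ℤ) →ₗ[ℤ] (List W × List V →₀ ℤ) :=
  AddMonoidHom.toIntLinearMap
    { toFun := fun y => outer y z
      map_zero' := zero_outer z
      map_add' := fun y y' => add_outer y y' z }

/-- `outer` as a linear map in its second argument. -/
noncomputable def outerRight (y : List W →₀ ℤ) : (List V →₀ ℤ) →ₗ[ℤ] (List W × List V →₀ ℤ) :=
  AddMonoidHom.toIntLinearMap
    { toFun := fun z => outer y z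
      map_zero' := outer_zero y
      map_add' := outer_add y }

theorem outerRight_apply (y : List W →₀ ℤ) (z : List V →₀ ℤ) : outerRight y z = outer y z := rfl

theorem neg_outer (y : List W →₀ ℤ) (z : List V →₀ ℤ) : outer (-y) z = -outer y z :=
  map_neg (outerLeft z) y

theorem sub_outer (y y' : List W →₀ ℤ) (z : List V →₀ ℤ) :
    outer (y - y') z = outer y z - outer y' z :=
  map_sub (outerLeft z) y y'

theorem outer_sub (y : List W →₀ ℤ) (z z' : List V →₀ ℤ) :
    outer y (z - z') = outer y z - outer y z' :=
  map_sub (outerRight y) z z'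

theorem outer_mem {A : Set (List W)} {B : Set (List V)} {y : List W →₀ ℤ} {z : List V →₀ ℤ}
    (hy : y ∈ supported ℤ ℤ A) (hz : z ∈ supported ℤ ℤ B) :
    outer y z ∈ supported ℤ ℤ (A ×ˢ B) := by
  have h1 : ∀ e ∈ A, outer (single e 1) z ∈ supported ℤ ℤ (A ×ˢ B) := fun e he =>
    map_mem_of_supported (f := outerRight (single e 1)) (fun f hf => by
      rw [outerRight_apply, outer_single]
      exact single_mem_supported ℤ _ ⟨he, hf⟩) hz
  exact map_mem_of_supported (f := outerLeft z) h1 hy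

/-- The tensor product of two linear maps. -/
noncomputable def outerMap (f : (List W →₀ ℤ) →ₗ[ℤ] (List W →₀ ℤ))
    (g : (List V →₀ ℤ) →ₗ[ℤ] (List V →₀ ℤ)) :
    (List W × List V →₀ ℤ) →ₗ[ℤ] (List W × List V →₀ ℤ) :=
  Finsupp.linearCombination ℤ fun e => outer (f (single e.1 1)) (g (single e.2 1))

/-- Linear maps that agree on tensors of basis elements agree on all tensors. -/
theorem eq_on_outer {M : Type*} [AddCommGroup M] {φ ψ : (List W →₀ ℤ) → (List V →₀ ℤ) → M}
    (hφ : ∀ z, ∃ f : (List W →₀ ℤ) →ₗ[ℤ] M, ∀ y, φ y z = f y)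
    (hφ' : ∀ y, ∃ f : (List V →₀ ℤ) →ₗ[ℤ] M, ∀ z, φ y z = f z)
    (hψ : ∀ z, ∃ f : (List W →₀ ℤ) →ₗ[ℤ] M, ∀ y, ψ y z = f y)
    (hψ' : ∀ y, ∃ f : (List V →₀ ℤ) →ₗ[ℤ] M, ∀ z, ψ y z = f z)
    {A : Set (List W)} {B : Set (List V)}
    (h : ∀ e ∈ A, ∀ f ∈ B, φ (single e 1) (single f 1) = ψ (single e 1) (single f 1))
    {y : List W →₀ ℤ} {z : List V →₀ ℤ} (hy : y ∈ supported ℤ ℤ A) (hz : z ∈ supported ℤ ℤ B) :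
    φ y z = ψ y z := by
  obtain ⟨f, hf⟩ := hφ z
  obtain ⟨g, hg⟩ := hψ z
  rw [hf, hg]
  refine eq_of_supported (fun e he => ?_) hy
  rw [← hf, ← hg]
  obtain ⟨f', hf'⟩ := hφ' (single e 1)
  obtain ⟨g', hg'⟩ := hψ' (single e 1)
  rw [hf', hg']
  exact eq_of_supported (fun e' he' => by rw [← hf', ← hg', h e he e' he']) hz

theorem outerMap_outer (f : (List W →₀ ℤ) →ₗ[ℤ] (List W →₀ ℤ))
    (g : (List V →₀ ℤ) →ₗ[ℤ] (List V →₀ ℤ)) (y : List W →₀ ℤ) (z : List V →₀ ℤ) :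
    outerMap f g (outer y z) = outer (f y) (g z) := by
  refine eq_on_outer (A := Set.univ) (B := Set.univ)
    (φ := fun y z => outerMap f g (outer y z)) (ψ := fun y z => outer (f y) (g z))
    (fun z => ⟨outerMap f g ∘ₗ outerLeft z, fun _ => rfl⟩)
    (fun y => ⟨outerMap f g ∘ₗ outerRight y, fun _ => rfl⟩)
    (fun z => ⟨outerLeft (g z) ∘ₗ f, fun _ => rfl⟩)
    (fun y => ⟨outerRight (f y) ∘ₗ g, fun _ => rfl⟩) (fun e _ e' _ => ?_) (by simp) (by simp)
  simp [outerMap, outer_single]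

theorem ext_outer {M : Type*} [AddCommGroup M] {f g : (List W × List V →₀ ℤ) →ₗ[ℤ] M}
    (h : ∀ y z, f (outer y z) = g (outer y z)) : f = g :=
  eq_of_single fun e => by rw [single_eq_outer, h]

/-- The sign `(-1) ^ n` on lists of degree `n`, that is, with `n + 1` entries. -/
noncomputable def signMap : (List V →₀ ℤ) →ₗ[ℤ] (List V →₀ ℤ) :=
  Finsupp.linearCombination ℤ fun l => single l ((-1) ^ (l.length + 1))

theorem signMap_single (l : List V) :
    signMap (single l 1) = ((-1) ^ (l.length + 1) : ℤ) • single l 1 := by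
  simp [signMap]

theorem signMap_signMap (z : List V →₀ ℤ) : signMap (signMap z) = z := by
  have : signMap ∘ₗ signMap = (LinearMap.id : (List V →₀ ℤ) →ₗ[ℤ] _) := eq_of_single fun l => by
    rw [LinearMap.comp_apply, signMap_single, map_smul, signMap_single, smul_smul, ← mul_pow]
    simp
  exact LinearMap.congr_fun this z

theorem signMap_of_length {n : ℕ} {z : List V →₀ ℤ}
    (hz : z ∈ supported ℤ ℤ {l : List V | l.length = n}) :
    signMap z = ((-1) ^ (n + 1) : ℤ) • z :=
  eq_of_supported (g := ((-1) ^ (n + 1) : ℤ) • (LinearMap.id : (List V →₀ ℤ) →ₗ[ℤ] _))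
    (fun l hl => by
      have hl : l.length = n := hl
      rw [signMap_single, hl]
      rfl) hz

theorem signMap_mem {S : Set (List V)} {z : List V →₀ ℤ} (hz : z ∈ supported ℤ ℤ S) :
    signMap z ∈ supported ℤ ℤ S :=
  map_mem_of_supported (fun l hl => by
    rw [signMap_single]
    exact Submodule.smul_mem _ _ (single_mem_supported ℤ _ hl)) hz

theorem signMap_consMap (a : V) (z : List V →₀ ℤ) :
    signMap (consMap a z) = -consMap a (signMap z) := by
  have : signMap ∘ₗ consMap a = -(consMap a ∘ₗ signMap) := eq_of_single fun l => by
    rw [LinearMap.comp_apply, consMap_single, signMap_single, LinearMap.neg_apply,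
      LinearMap.comp_apply, signMap_single, map_smul, consMap_single, List.length_cons, pow_succ,
      mul_neg_one, neg_smul]
  exact LinearMap.congr_fun this z

theorem bd_signMap (β : V → V → V → Prop) :
    bd β ∘ₗ signMap = -(signMap ∘ₗ bd β) := by
  refine eq_of_single fun l => ?_
  rw [LinearMap.comp_apply, LinearMap.neg_apply, LinearMap.comp_apply, signMap_single, map_smul,
    bd_single]
  cases h : l.length with
  | zero =>
    obtain rfl := List.length_eq_zero_iff.1 h
    simp [listBoundary]
  | succ n =>
    have : listBoundary β l ∈ supported ℤ ℤ {l' : List V | l'.length = n} :=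
      listBoundary_mem_of_face fun l' h' => by
        have := h'.length_eq
        have : l'.length = n := by omega
        exact this
    rw [signMap_of_length this, ← neg_smul]
    congr 1
    ring

theorem signMap_odd {s : (List V →₀ ℤ) →ₗ[ℤ] (List V →₀ ℤ)}
    (hs : ∀ e, s (single e 1) ∈ supported ℤ ℤ {e' | e'.length = e.length + 1}) :
    signMap ∘ₗ s = -(s ∘ₗ signMap) := by
  refine eq_of_single fun l => ?_
  rw [LinearMap.comp_apply, LinearMap.neg_apply, LinearMap.comp_apply, signMap_single, map_smul,
    signMap_of_length (hs l), ← neg_smul]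
  congr 1
  ring

/-- The differential `∂ ⊗ 1 + ε ⊗ ∂` of the tensor product of two list complexes, where `ε` is the
sign of the degree. -/
noncomputable def tensorBd (H : SimpleGraph W) (G : SimpleGraph V) :
    (List W × List V →₀ ℤ) →ₗ[ℤ] (List W × List V →₀ ℤ) :=
  outerMap (bd (Btw H)) LinearMap.id + outerMap signMap (bd (Btw G))

theorem tensorBd_outer (y : List W →₀ ℤ) (z : List V →₀ ℤ) :
    tensorBd H G (outer y z) = outer (bd (Btw H) y) z + outer (signMap y) (bd (Btw G) z) := by
  rw [tensorBd, LinearMap.add_apply, outerMap_outer, outerMap_outer, LinearMap.id_apply]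

theorem tensorBd_tensorBd (x : (List W × List V →₀ ℤ)) :
    tensorBd H G (tensorBd H G x) = 0 := by
  have : tensorBd H G ∘ₗ tensorBd H G = 0 := by
    refine ext_outer fun y z => ?_
    have := LinearMap.congr_fun (bd_signMap (Btw H)) y
    simp only [LinearMap.comp_apply, LinearMap.neg_apply] at this
    simp only [LinearMap.comp_apply, tensorBd_outer, map_add, (isAssocRel_btw _).bd_bd, this,
      zero_outer, outer_zero, neg_outer]
    simp
  exact LinearMap.congr_fun this x

/-- Nonempty lists with admissible steps. -/
def genLists (G : SimpleGraph V) : Set (List V) := {e | e.IsChain (Adm G) ∧ e ≠ []}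

theorem genSet_subset_genLists {k l : ℕ} {e : List V} (h : e ∈ genSet G k l) : e ∈ genLists G :=
  ⟨h.1, fun h' => by simp [h', genSet] at h⟩

theorem exists_mem_genSet {e : List V} (h : e ∈ genLists G) : ∃ k l, e ∈ genSet G k l :=
  ⟨e.length - 1, _, h.1, (Nat.sub_add_cancel (List.length_pos_iff.2 h.2)).symm, rfl⟩

theorem bd_mem_genLists {z : List V →₀ ℤ} (hz : z ∈ supported ℤ ℤ (genLists G)) :
    bd (Btw G) z ∈ supported ℤ ℤ (genLists G) :=
  bd_mem_of_face (fun e he e' h => by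
    refine ⟨h.isChain_adm_iff.2 he.1, ?_⟩
    obtain ⟨a, t, t', -, rfl⟩ := h.exists_head
    simp) hz

/-- A Künneth theorem: the contractions of both factors off their diagonals combine to one of the
tensor product off its diagonal. -/
theorem exists_tensorBd_eq (hH : ListDiagonal H) (hG : ListDiagonal G) {k l : ℕ} (hkl : k ≠ l)
    {x : (List W × List V →₀ ℤ)}
    (hx : x ∈ supported ℤ ℤ {e | ∃ i j a b, i + j = k ∧ a + b = l ∧
      e.1 ∈ genSet H i a ∧ e.2 ∈ genSet G j b}) (hdx : tensorBd H G x = 0) :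
    ∃ w ∈ supported ℤ ℤ (genLists H ×ˢ genLists G), tensorBd H G w = x := by
  obtain ⟨s, hs1, hs2, hs3⟩ := exists_contraction hH (k + 1)
  obtain ⟨t, ht1, ht2, ht3⟩ := exists_contraction hG (k + 1)
  have hsg : ∀ z ∈ supported ℤ ℤ (genLists H), s z ∈ supported ℤ ℤ (genLists H) := fun z hz =>
    map_mem_of_supported (fun e he => by
      obtain ⟨k, l, he⟩ := exists_mem_genSet he
      exact supported_mono (fun _ => genSet_subset_genLists) (hs2 k l e he)) hz
  have htg : ∀ z ∈ supported ℤ ℤ (genLists G), t z ∈ supported ℤ ℤ (genLists G) := fun z hz =>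
    map_mem_of_supported (fun e he => by
      obtain ⟨k, l, he⟩ := exists_mem_genSet he
      exact supported_mono (fun _ => genSet_subset_genLists) (ht2 k l e he)) hz
  let p := LinearMap.id - bd (Btw H) ∘ₗ s - s ∘ₗ bd (Btw H)
  let q := LinearMap.id - bd (Btw G) ∘ₗ t - t ∘ₗ bd (Btw G)
  let S := outerMap s (LinearMap.id : (List V →₀ ℤ) →ₗ[ℤ] _)
  let T := outerMap (signMap (V := W)) t
  have hS : ∀ x, x - tensorBd H G (S x) - S (tensorBd H G x) =
      outerMap p LinearMap.id x := by
    have : LinearMap.id - tensorBd H G ∘ₗ S - S ∘ₗ tensorBd H G =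
        outerMap p LinearMap.id := by
      refine ext_outer fun y z => ?_
      have := LinearMap.congr_fun (signMap_odd hs1) y
      simp only [LinearMap.comp_apply, LinearMap.neg_apply] at this
      simp only [S, p, LinearMap.sub_apply, LinearMap.comp_apply, LinearMap.id_apply,
        tensorBd_outer, outerMap_outer, map_add, this, sub_outer, neg_outer]
      abel
    exact LinearMap.congr_fun this
  have hT : ∀ x, x - tensorBd H G (T x) - T (tensorBd H G x) =
      outerMap LinearMap.id q x := by
    have : LinearMap.id - tensorBd H G ∘ₗ T - T ∘ₗ tensorBd H G =
        outerMap LinearMap.id q := by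
      refine ext_outer fun y z => ?_
      have := LinearMap.congr_fun (bd_signMap (Btw H)) y
      simp only [LinearMap.comp_apply, LinearMap.neg_apply] at this
      simp only [T, q, LinearMap.sub_apply, LinearMap.comp_apply, LinearMap.id_apply,
        tensorBd_outer, outerMap_outer, map_add, this, outer_sub, neg_outer, signMap_signMap]
      abel
    exact LinearMap.congr_fun this
  have h1 := hS x
  rw [hdx, map_zero, sub_zero] at h1
  have hdp : tensorBd H G (outerMap p LinearMap.id x) = 0 := by
    rw [← h1, map_sub, hdx, tensorBd_tensorBd, sub_zero]
  have h2 := hT (outerMap p LinearMap.id x)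
  rw [hdp, map_zero, sub_zero] at h2
  have h3 : outerMap LinearMap.id q (outerMap p LinearMap.id x) = 0 := by
    refine eq_of_supported (f := outerMap LinearMap.id q ∘ₗ
      outerMap p LinearMap.id) (g := 0) (fun e he => ?_) hx
    obtain ⟨i, j, a, b, hij, hab, he1, he2⟩ := he
    rw [single_eq_outer]
    simp only [LinearMap.comp_apply, outerMap_outer, LinearMap.id_apply,
      LinearMap.zero_apply]
    -- a bidegree off the diagonal is off the diagonal in one of the factors
    by_cases hia : i = a
    · have : q (single e.2 1) = 0 := by
        have := ht3 j b (by omega) (by omega) e.2 he2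
        simp only [q, LinearMap.sub_apply, LinearMap.comp_apply, LinearMap.id_apply]
        rw [sub_sub, this, sub_self]
      rw [this, outer_zero]
    · have : p (single e.1 1) = 0 := by
        have := hs3 i a (by omega) hia e.1 he1
        simp only [p, LinearMap.sub_apply, LinearMap.comp_apply, LinearMap.id_apply]
        rw [sub_sub, this, sub_self]
      rw [this, zero_outer]
  rw [h3, sub_eq_zero] at h2
  have hx' : x ∈ supported ℤ ℤ (genLists H ×ˢ genLists G) := by
    refine map_mem_of_supported (f := LinearMap.id) (fun e he => ?_) hx
    obtain ⟨i, j, a, b, hij, hab, he1, he2⟩ := he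
    exact single_mem_supported ℤ _ ⟨genSet_subset_genLists he1, genSet_subset_genLists he2⟩
  have hmem : ∀ {f : (List W →₀ ℤ) →ₗ[ℤ] (List W →₀ ℤ)} {g : (List V →₀ ℤ) →ₗ[ℤ] (List V →₀ ℤ)},
      (∀ z ∈ supported ℤ ℤ (genLists H), f z ∈ supported ℤ ℤ (genLists H)) →
      (∀ z ∈ supported ℤ ℤ (genLists G), g z ∈ supported ℤ ℤ (genLists G)) →
      ∀ x ∈ supported ℤ ℤ (genLists H ×ˢ genLists G),
        outerMap f g x ∈ supported ℤ ℤ (genLists H ×ˢ genLists G) := by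
    intro f g hf hg x hx
    refine map_mem_of_supported (fun e he => ?_) hx
    rw [single_eq_outer, outerMap_outer]
    exact outer_mem
      (hf _ (single_mem_supported ℤ _ he.1)) (hg _ (single_mem_supported ℤ _ he.2))
  refine ⟨S x + T (outerMap p LinearMap.id x), add_mem ?_ ?_, ?_⟩
  · exact hmem hsg (fun z hz => hz) x hx'
  · refine hmem (fun z hz => signMap_mem hz) htg _ (hmem (fun z hz => ?_) (fun z hz => hz) x hx')
    exact sub_mem (sub_mem hz (bd_mem_genLists (hsg z hz))) (hsg _ (bd_mem_genLists hz))
  · rw [map_add, ← h2, ← h1]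
    abel

end Tensor

/-! ### Sorted lists in a product -/

section Sorted

open TensorProduct

variable {V W : Type*} {G : SimpleGraph V} {H : SimpleGraph W}

/-- The list in `V × W` that first runs through the given list in `W`, with the first coordinate
constant, and then through the given list in `V`, with the second coordinate constant. -/
def pairList : List W → List V → List (V × W)
  | [y], xs => xs.map (·, y)
  | y :: y' :: ys, x :: xs => (x, y) :: pairList (y' :: ys) (x :: xs)
  | _, _ => []

open Classical in
/-- The second coordinates of a list, without consecutive repetitions. -/
noncomputable def sndList : List (V × W) → List W
  | p :: q :: l => if p.2 = q.2 then sndList (q :: l) else p.2 :: sndList (q :: l)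
  | [p] => [p.2]
  | [] => []

open Classical in
/-- The first coordinates of a list, without consecutive repetitions. -/
noncomputable def fstList : List (V × W) → List V
  | p :: q :: l => if p.1 = q.1 then fstList (q :: l) else p.1 :: fstList (q :: l)
  | [p] => [p.1]
  | [] => []

theorem pairList_head (y : W) (ys : List W) (x : V) (xs : List V) :
    ∃ t, pairList (y :: ys) (x :: xs) = (x, y) :: t := by
  cases ys with
  | nil => exact ⟨_, rfl⟩
  | cons y' ys => exact ⟨_, rfl⟩

theorem pairList_cons {y : W} {ys : List W} (h : ys ≠ []) (x : V) (xs : List V) :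
    pairList (y :: ys) (x :: xs) = (x, y) :: pairList ys (x :: xs) := by
  cases ys with
  | nil => exact absurd rfl h
  | cons y' ys => rfl

theorem sndList_head (p : V × W) (l : List (V × W)) : ∃ t, sndList (p :: l) = p.2 :: t := by
  induction l generalizing p with
  | nil => exact ⟨[], rfl⟩
  | cons q l ih =>
    rw [sndList]
    split_ifs with h
    · rw [h]
      exact ih q
    · exact ⟨_, rfl⟩

theorem fstList_head (p : V × W) (l : List (V × W)) : ∃ t, fstList (p :: l) = p.1 :: t := by
  induction l generalizing p with
  | nil => exact ⟨[], rfl⟩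
  | cons q l ih =>
    rw [fstList]
    split_ifs with h
    · rw [h]
      exact ih q
    · exact ⟨_, rfl⟩

theorem isChain_sndList {l : List (V × W)} (h : l.IsChain (Adm (G.boxProd H))) :
    (sndList l).IsChain (Adm H) := by
  induction l with
  | nil => simp [sndList]
  | cons p l ih =>
    cases l with
    | nil => simp [sndList]
    | cons q l =>
      rw [List.isChain_cons_cons] at h
      have ih := ih h.2
      rw [sndList]
      split_ifs with hpq
      · exact ih
      · obtain ⟨t, ht⟩ := sndList_head q l
        rw [ht] at ih ⊢
        exact List.isChain_cons_cons.2 ⟨⟨hpq, (SimpleGraph.reachable_boxProd.1 h.1.2).2⟩, ih⟩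

theorem isChain_fstList {l : List (V × W)} (h : l.IsChain (Adm (G.boxProd H))) :
    (fstList l).IsChain (Adm G) := by
  induction l with
  | nil => simp [fstList]
  | cons p l ih =>
    cases l with
    | nil => simp [fstList]
    | cons q l =>
      rw [List.isChain_cons_cons] at h
      have ih := ih h.2
      rw [fstList]
      split_ifs with hpq
      · exact ih
      · obtain ⟨t, ht⟩ := fstList_head q l
        rw [ht] at ih ⊢
        exact List.isChain_cons_cons.2 ⟨⟨hpq, (SimpleGraph.reachable_boxProd.1 h.1.2).1⟩, ih⟩

theorem listLength_sndList_add {l : List (V × W)} (h : l.IsChain (Adm (G.boxProd H))) :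
    listLength H (sndList l) + listLength G (fstList l) = listLength (G.boxProd H) l := by
  induction l with
  | nil => simp [sndList, fstList, listLength]
  | cons p l ih =>
    cases l with
    | nil => simp [sndList, fstList, listLength]
    | cons q l =>
      rw [List.isChain_cons_cons] at h
      have ih := ih h.2
      obtain ⟨t, ht⟩ := sndList_head q l
      obtain ⟨u, hu⟩ := fstList_head q l
      have h1 : listLength H (sndList (p :: q :: l)) =
          H.dist p.2 q.2 + listLength H (sndList (q :: l)) := by
        rw [sndList, ht]
        split_ifs with hpq
        · simp [hpq]
        · rfl
      have h2 : listLength G (fstList (p :: q :: l)) =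
          G.dist p.1 q.1 + listLength G (fstList (q :: l)) := by
        rw [fstList, hu]
        split_ifs with hpq
        · simp [hpq]
        · rfl
      rw [h1, h2, listLength, dist_box h.1.2, ← ih]
      omega

theorem length_sndList_add {p : V × W} {l : List (V × W)}
    (h : (p :: l).IsChain (Adm (G.boxProd H))) (hU : ¬ Unsorted (p :: l)) :
    (sndList (p :: l)).length + (fstList (p :: l)).length = (p :: l).length + 1 := by
  induction l generalizing p with
  | nil => simp [sndList, fstList]
  | cons q l ih =>
    rw [List.isChain_cons_cons] at h
    simp only [Unsorted, MovesSnd, not_or, not_and] at hU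
    have ih := ih h.2 hU.2
    rw [sndList, fstList]
    by_cases h1 : p.1 = q.1
    · have h2 : p.2 ≠ q.2 := fun e => h.1.1 (Prod.ext h1 e)
      simp only [h1, h2, if_true, if_false, List.length_cons] at *
      omega
    · have h2 : p.2 = q.2 := not_not.1 (hU.1 h1).1
      simp only [h1, h2, if_true, if_false, List.length_cons] at *
      omega

theorem mem_genSet_of_sorted {k l : ℕ} {e : List (V × W)} (he : e ∈ genSet (G.boxProd H) k l)
    (hU : ¬ Unsorted e) : ∃ i j a b, i + j = k ∧ a + b = l ∧
      sndList e ∈ genSet H i a ∧ fstList e ∈ genSet G j b := by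
  obtain ⟨h1, h2, h3⟩ := he
  cases e with
  | nil => simp at h2
  | cons p e =>
    have h4 := length_sndList_add h1 hU
    obtain ⟨t, ht⟩ := sndList_head p e
    obtain ⟨u, hu⟩ := fstList_head p e
    refine ⟨t.length, u.length, _, _, ?_, (listLength_sndList_add h1).trans h3,
      ⟨isChain_sndList h1, by simp [ht], rfl⟩, ⟨isChain_fstList h1, by simp [hu], rfl⟩⟩
    rw [ht, hu, h2] at h4
    simp only [List.length_cons] at h4
    omega

theorem eq_map_of_not_movesSnd {p : V × W} {l : List (V × W)}
    (h : (p :: l).IsChain (Adm (G.boxProd H))) (hm : ¬ MovesSnd (p :: l)) :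
    sndList (p :: l) = [p.2] ∧ (fstList (p :: l)).map (·, p.2) = p :: l := by
  induction l generalizing p with
  | nil => simp [sndList, fstList]
  | cons q l ih =>
    rw [List.isChain_cons_cons] at h
    simp only [MovesSnd, not_or, not_not, ne_eq] at hm
    obtain ⟨ih1, ih2⟩ := ih h.2 hm.2
    have h1 : p.1 ≠ q.1 := fun e => h.1.1 (Prod.ext e hm.1)
    rw [sndList, fstList, if_pos hm.1, if_neg h1, ih1, hm.1, List.map_cons, ih2, ← hm.1]
    exact ⟨rfl, rfl⟩

theorem pairList_sndList_fstList {p : V × W} {l : List (V × W)}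
    (h : (p :: l).IsChain (Adm (G.boxProd H))) (hU : ¬ Unsorted (p :: l)) :
    pairList (sndList (p :: l)) (fstList (p :: l)) = p :: l := by
  induction l generalizing p with
  | nil => simp [sndList, fstList, pairList]
  | cons q l ih =>
    by_cases hm : MovesSnd (p :: q :: l)
    · rw [List.isChain_cons_cons] at h
      simp only [Unsorted, hm, and_true, not_or, not_not, ne_eq] at hU
      have ih := ih h.2 hU.2
      have h2 : p.2 ≠ q.2 := fun e => h.1.1 (Prod.ext hU.1 e)
      obtain ⟨t, ht⟩ := sndList_head q l
      obtain ⟨u, hu⟩ := fstList_head q l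
      rw [sndList, fstList, if_pos hU.1, if_neg h2, hu, pairList_cons (by simp [ht]), ← hu, ih,
        ← hU.1]
    · obtain ⟨h1, h2⟩ := eq_map_of_not_movesSnd h hm
      rw [h1]
      exact h2

theorem sndList_map {y : W} {x : V} {xs : List V} :
    sndList ((x :: xs).map (·, y)) = [y] := by
  induction xs generalizing x with
  | nil => simp [sndList]
  | cons x' xs ih =>
    have ih := @ih x'
    simp only [List.map_cons] at ih ⊢
    rw [sndList, if_pos rfl, ih]

theorem fstList_map {y : W} {xs : List V} (h : xs.IsChain (Adm G)) :
    fstList (xs.map (·, y)) = xs := by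
  induction xs with
  | nil => simp [fstList]
  | cons x xs ih =>
    cases xs with
    | nil => simp [fstList]
    | cons x' xs =>
      rw [List.isChain_cons_cons] at h
      have ih := ih h.2
      simp only [List.map_cons] at ih ⊢
      rw [fstList, if_neg h.1.1, ih]

theorem not_unsorted_map (y : W) (xs : List V) : ¬ Unsorted (xs.map (·, y)) := by
  have hm : ∀ xs : List V, ¬ MovesSnd (xs.map (·, y)) := by
    intro xs
    induction xs with
    | nil => simp [MovesSnd]
    | cons x xs ih =>
      cases xs with
      | nil => simp [MovesSnd]
      | cons x' xs =>
        simp only [List.map_cons, MovesSnd] at ih ⊢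
        simpa using ih
  induction xs with
  | nil => simp [Unsorted]
  | cons x xs ih =>
    cases xs with
    | nil => simp [Unsorted]
    | cons x' xs =>
      have := hm (x :: x' :: xs)
      simp only [List.map_cons, Unsorted] at ih this ⊢
      tauto

theorem pairList_spec {y : W} {ys : List W} {x : V} {xs : List V}
    (hy : (y :: ys).IsChain (Adm H)) (hx : (x :: xs).IsChain (Adm G)) :
    sndList (pairList (y :: ys) (x :: xs)) = y :: ys ∧
      fstList (pairList (y :: ys) (x :: xs)) = x :: xs ∧
      ¬ Unsorted (pairList (y :: ys) (x :: xs)) := by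
  induction ys generalizing y with
  | nil => exact ⟨sndList_map, fstList_map hx, not_unsorted_map y _⟩
  | cons y' ys ih =>
    rw [List.isChain_cons_cons] at hy
    obtain ⟨h1, h2, h3⟩ := ih hy.2
    obtain ⟨t, ht⟩ := pairList_head y' ys x xs
    rw [pairList]
    rw [ht] at h1 h2 h3 ⊢
    rw [sndList, fstList, if_neg hy.1.1, if_pos rfl, h1, h2]
    exact ⟨rfl, rfl, by simpa [Unsorted] using h3⟩

/-- The linear extension of `pairList`. -/
noncomputable def pairMap :
    (List W × List V →₀ ℤ) →ₗ[ℤ] (List (V × W) →₀ ℤ) :=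
  Finsupp.lmapDomain ℤ ℤ fun e => pairList e.1 e.2

theorem pairMap_single (e : List W) (f : List V) :
    pairMap (single (e, f) 1) = single (pairList e f) 1 := by
  simp [pairMap, Finsupp.mapDomain_single]

open Classical in
/-- The left inverse of `pairMap` that vanishes on unsorted lists. -/
noncomputable def unpairMap :
    (List (V × W) →₀ ℤ) →ₗ[ℤ] (List W × List V →₀ ℤ) :=
  Finsupp.linearCombination ℤ fun e =>
    if Unsorted e then 0 else single (sndList e, fstList e) 1

theorem unpairMap_of_unsorted {z : List (V × W) →₀ ℤ}
    (hz : z ∈ supported ℤ ℤ {e | Unsorted e}) : unpairMap z = 0 :=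
  eq_of_supported (g := 0) (fun e he => by
    have he : Unsorted e := he
    simp [unpairMap, he]) hz

theorem unpairMap_single {e : List (V × W)} (he : ¬ Unsorted e) :
    unpairMap (single e 1) = single (sndList e, fstList e) 1 := by
  simp [unpairMap, he]

theorem unpairMap_pairMap {x : (List W × List V →₀ ℤ)}
    (hx : x ∈ supported ℤ ℤ (genLists H ×ˢ genLists G)) : unpairMap (pairMap x) = x := by
  refine eq_of_supported (f := unpairMap ∘ₗ pairMap) (g := LinearMap.id) ?_ hx
  rintro ⟨e, f⟩ ⟨⟨h1, h2⟩, ⟨h3, h4⟩⟩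
  obtain ⟨y, ys, rfl⟩ := List.exists_cons_of_ne_nil h2
  obtain ⟨x, xs, rfl⟩ := List.exists_cons_of_ne_nil h4
  obtain ⟨h5, h6, h7⟩ := pairList_spec h1 h3
  rw [LinearMap.comp_apply, pairMap_single, unpairMap_single h7, h5, h6, LinearMap.id_apply]

theorem pairMap_outer_single (e : List W) (f : List V) :
    pairMap (outer (single e 1) (single f 1)) = single (pairList e f) 1 := by
  rw [outer_single, mul_one, pairMap_single]

theorem pairMap_consMap_outer {x : V} {b : W} (y : W) {z : List W →₀ ℤ} {w : List V →₀ ℤ}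
    (hz : z ∈ supported ℤ ℤ (headed b)) (hw : w ∈ supported ℤ ℤ (headed x)) :
    pairMap (outer (consMap y z) w) = consMap (x, y) (pairMap (outer z w)) := by
  refine eq_on_outer (φ := fun z w => pairMap (outer (consMap y z) w))
    (ψ := fun z w => consMap (x, y) (pairMap (outer z w)))
    (fun w => ⟨pairMap ∘ₗ outerLeft w ∘ₗ consMap y, fun _ => rfl⟩)
    (fun z => ⟨pairMap ∘ₗ outerRight (consMap y z), fun _ => rfl⟩)
    (fun w => ⟨consMap (x, y) ∘ₗ pairMap ∘ₗ outerLeft w, fun _ => rfl⟩)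
    (fun z => ⟨consMap (x, y) ∘ₗ pairMap ∘ₗ outerRight z, fun _ => rfl⟩) ?_ hz hw
  rintro _ ⟨t, rfl⟩ _ ⟨u, rfl⟩
  simp [pairMap_outer_single, pairList]

theorem pairMap_singleton_outer (y : W) (z : List V →₀ ℤ) :
    pairMap (outer (single [y] 1) z) = pushMap (fun _ _ => True) (·, y) z := by
  have : pairMap ∘ₗ outerRight (single [y] 1) =
      pushMap (fun _ _ => True) (fun x : V => (x, y)) := eq_of_single fun l => by
    rw [pushMap_single_true, LinearMap.comp_apply, outerRight_apply, pairMap_outer_single, pairList]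
  exact LinearMap.congr_fun this z

theorem consMap_unsorted (p : V × W) {z : List (V × W) →₀ ℤ}
    (hz : z ∈ supported ℤ ℤ {e | Unsorted e}) : consMap p z ∈ supported ℤ ℤ {e | Unsorted e} := by
  refine map_mem_of_supported (fun e he => ?_) hz
  rw [consMap_single]
  refine single_mem_supported ℤ _ ?_
  match e, he with
  | q :: r :: l, he => exact .inr he

theorem btw_box_left {x x' x'' : V} {y : W} :
    Btw (G.boxProd H) (x, y) (x', y) (x'', y) ↔ Btw G x x' x'' := by
  have : H.Reachable y y := by rfl
  simp only [btw_box_iff, weakBtw_right]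
  simp only [WeakBtw, Btw, Adm, ne_eq, Prod.mk.injEq, and_true]
  tauto

theorem btw_box_right {x : V} {y y' y'' : W} :
    Btw (G.boxProd H) (x, y) (x, y') (x, y'') ↔ Btw H y y' y'' := by
  have : G.Reachable x x := by rfl
  simp only [btw_box_iff, weakBtw_right]
  simp only [WeakBtw, Btw, Adm, ne_eq, Prod.mk.injEq, true_and]
  tauto

theorem firstFace_pairList_sub_mem (y y' : W) (ys : List W) (x : V) (xs : List V) :
    firstFace (Btw (G.boxProd H)) (x, y) (pairList (y' :: ys) (x :: xs)) -
      pairMap (outer (firstFace (Btw H) y (y' :: ys)) (single (x :: xs) 1)) ∈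
        supported ℤ ℤ {e | Unsorted e} := by
  match ys with
  | y'' :: ys =>
    obtain ⟨t, ht⟩ := pairList_head y'' ys x xs
    have e : pairList (y :: y'' :: ys) (x :: xs) = (x, y) :: (x, y'') :: t := by
      rw [pairList, ht]
    rw [pairList, ht]
    rw [firstFace, firstFace]
    by_cases h : Btw H y y' y''
    · rw [if_pos h, if_pos (btw_box_right.2 h), pairMap_outer_single, e, sub_self]
      exact zero_mem _
    · rw [if_neg h, if_neg (mt btw_box_right.1 h), zero_outer, map_zero, sub_zero]
      exact zero_mem _
  | [] =>
    cases xs with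
    | nil => simp [firstFace, pairList, zero_outer]
    | cons x' xs =>
      simp only [firstFace, pairList, List.map_cons, zero_outer, map_zero,
        sub_zero]
      split_ifs with h
      · refine single_mem_supported ℤ _ (.inl ?_)
        obtain ⟨h1, h2, h3, h4⟩ := btw_box_iff.1 h
        simp only [ne_eq, Prod.mk.injEq, true_and, and_true] at h1 h2
        exact ⟨h2, .inl h1⟩
      · exact zero_mem _

/-- Modulo unsorted lists, `pairMap` is a chain map. -/
theorem bd_pairMap_single (y : W) (ys : List W) (x : V) (xs : List V) :
    bd (Btw (G.boxProd H)) (pairMap (outer (single (y :: ys) 1) (single (x :: xs) 1))) -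
      pairMap (tensorBd H G (outer (single (y :: ys) 1) (single (x :: xs) 1))) ∈
        supported ℤ ℤ {e | Unsorted e} := by
  induction ys generalizing y with
  | nil =>
    have h1 : bd (Btw H) (single [y] 1) = 0 := by simp [listBoundary, firstFace]
    have h2 : signMap (single [y] 1) = single [y] 1 := by simp [signMap_single]
    rw [tensorBd_outer, h1, h2, zero_outer, zero_add, pairMap_singleton_outer,
      pairMap_singleton_outer, bd_pushMap (β := Btw G) (S := Set.univ), sub_self]
    · exact zero_mem _
    · simp [btw_box_left]
    · simp
  | cons y' ys ih =>
    have ih := consMap_unsorted (x, y) (ih y')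
    have h1 := pairMap_consMap_outer (x := x) (b := y') y (z := single (y' :: ys) 1)
      (w := single (x :: xs) 1) (single_mem_supported ℤ _ ⟨_, rfl⟩)
      (single_mem_supported ℤ _ ⟨_, rfl⟩)
    have h2 := pairMap_consMap_outer (x := x) (b := y') y
      (z := listBoundary (Btw H) (y' :: ys)) (w := single (x :: xs) 1)
      (listBoundary_mem_headed _ _ _) (single_mem_supported ℤ _ ⟨_, rfl⟩)
    have h3 := pairMap_consMap_outer (x := x) (b := y') y (z := signMap (single (y' :: ys) 1))
      (w := listBoundary (Btw G) (x :: xs))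
      (signMap_mem (single_mem_supported ℤ _ ⟨_, rfl⟩)) (listBoundary_mem_headed _ _ _)
    have h4 := firstFace_pairList_sub_mem (G := G) (H := H) y y' ys x xs
    have e1 : single (y :: y' :: ys) (1 : ℤ) = consMap y (single (y' :: ys) 1) := by simp
    have : bd (Btw (G.boxProd H))
          (pairMap (outer (single (y :: y' :: ys) 1) (single (x :: xs) 1))) -
        pairMap (tensorBd H G (outer (single (y :: y' :: ys) 1) (single (x :: xs) 1))) =
      (firstFace (Btw (G.boxProd H)) (x, y) (pairList (y' :: ys) (x :: xs)) -
        pairMap (outer (firstFace (Btw H) y (y' :: ys)) (single (x :: xs) 1))) -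
      consMap (x, y) (bd (Btw (G.boxProd H))
        (pairMap (outer (single (y' :: ys) 1) (single (x :: xs) 1))) -
        pairMap (tensorBd H G (outer (single (y' :: ys) 1) (single (x :: xs) 1)))) := by
      rw [e1, tensorBd_outer, tensorBd_outer, h1, bd_consMap, bd_consMap, signMap_consMap,
        firstFaceMap_single, bd_single, bd_single, sub_outer, neg_outer]
      simp only [map_add, map_sub, map_neg, h2, h3]
      rw [pairMap_outer_single, firstFaceMap_single]
      abel
    rw [this]
    exact sub_mem h4 ih

theorem bd_pairMap {x : (List W × List V →₀ ℤ)}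
    (hx : x ∈ supported ℤ ℤ (genLists H ×ˢ genLists G)) :
    bd (Btw (G.boxProd H)) (pairMap x) - pairMap (tensorBd H G x) ∈
      supported ℤ ℤ {e | Unsorted e} := by
  refine map_mem_of_supported (f := bd (Btw (G.boxProd H)) ∘ₗ pairMap - pairMap ∘ₗ tensorBd H G)
    ?_ hx
  rintro ⟨e, f⟩ ⟨⟨-, h2⟩, ⟨-, h4⟩⟩
  obtain ⟨y, ys, rfl⟩ := List.exists_cons_of_ne_nil h2
  obtain ⟨x, xs, rfl⟩ := List.exists_cons_of_ne_nil h4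
  have := bd_pairMap_single (G := G) (H := H) y ys x xs
  rwa [outer_single, mul_one] at this

theorem tensorBd_mem {x : (List W × List V →₀ ℤ)}
    (hx : x ∈ supported ℤ ℤ (genLists H ×ˢ genLists G)) :
    tensorBd H G x ∈ supported ℤ ℤ (genLists H ×ˢ genLists G) := by
  refine map_mem_of_supported (fun e he => ?_) hx
  have h1 : single e.1 1 ∈ supported ℤ ℤ (genLists H) := single_mem_supported ℤ _ he.1
  have h2 : single e.2 1 ∈ supported ℤ ℤ (genLists G) := single_mem_supported ℤ _ he.2
  rw [single_eq_outer, tensorBd_outer]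
  exact add_mem (outer_mem (bd_mem_genLists h1) h2)
    (outer_mem (signMap_mem h1) (bd_mem_genLists h2))

theorem ListDiagonal.boxProd (hG : ListDiagonal G) (hH : ListDiagonal H) :
    ListDiagonal (G.boxProd H) := by
  intro k l hkl z hz hbz
  -- the sorted part of `z` comes from a tensor `unpairMap z`, which is a cycle
  have hz1 := sub_spanProj_mem {e | Unsorted e} hz
  have hz2 := spanProj_mem_inter {e | Unsorted e} hz
  have h0 : unpairMap (spanProj {e | Unsorted e} z) = 0 :=
    unpairMap_of_unsorted (supported_mono (fun _ h => h.1) hz2)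
  have hx : unpairMap z ∈ supported ℤ ℤ {e : List W × List V | ∃ i j a b, i + j = k ∧ a + b = l ∧
      e.1 ∈ genSet H i a ∧ e.2 ∈ genSet G j b} := by
    rw [← sub_zero (unpairMap z), ← h0, ← map_sub]
    refine map_mem_of_supported (fun e he => ?_) hz1
    rw [unpairMap_single he.2]
    exact single_mem_supported ℤ _ (mem_genSet_of_sorted he.1 he.2)
  have hx' : unpairMap z ∈ supported ℤ ℤ (genLists H ×ˢ genLists G) := by
    refine map_mem_of_supported (f := LinearMap.id) (fun e he => ?_) hx
    obtain ⟨i, j, a, b, hij, hab, he1, he2⟩ := he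
    exact single_mem_supported ℤ _ ⟨genSet_subset_genLists he1, genSet_subset_genLists he2⟩
  have hpx : pairMap (unpairMap z) = z - spanProj {e | Unsorted e} z := by
    rw [← sub_zero (unpairMap z), ← h0, ← map_sub]
    refine eq_of_supported (f := pairMap ∘ₗ unpairMap) (g := LinearMap.id) (fun e he => ?_) hz1
    obtain ⟨p, t, rfl⟩ : ∃ p t, e = p :: t :=
      List.exists_cons_of_ne_nil (genSet_subset_genLists he.1).2
    rw [LinearMap.comp_apply, unpairMap_single he.2, pairMap_single,
      pairList_sndList_fstList he.1.1 he.2, LinearMap.id_apply]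
  have hdx : tensorBd H G (unpairMap z) = 0 := by
    rw [← unpairMap_pairMap (tensorBd_mem hx')]
    have h1 := unpairMap_of_unsorted (bd_pairMap hx')
    rw [map_sub, sub_eq_zero] at h1
    rw [← h1, hpx, map_sub, hbz, zero_sub, map_neg, unpairMap_of_unsorted, neg_zero]
    exact bd_mem_of_face (fun e he e' h => h.unsorted he.1) hz2
  obtain ⟨w, hw, hdw⟩ := exists_tensorBd_eq hH hG hkl hx hdx
  -- subtracting the boundary of `pairMap w` leaves an unsorted cycle
  have h1 : z - bd (Btw (G.boxProd H)) (pairMap w) ∈ supported ℤ ℤ {e | Unsorted e} := by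
    have h2 := bd_pairMap hw
    rw [hdw, hpx] at h2
    have h3 := sub_mem (supported_mono Set.inter_subset_left hz2) h2
    convert h3 using 1
    abel
  have h2 := spanProj_mem_inter (genSet (G.boxProd H) k l) h1
  rw [map_sub, ← bd_spanProj, spanProj_of_mem hz] at h2
  have h3 : genSet (G.boxProd H) k l ∩ {e | Unsorted e} ⊆
      {e | e.IsChain (Adm (G.boxProd H)) ∧ Unsorted e} := fun e he => ⟨he.1.1, he.2⟩
  obtain ⟨v, hv⟩ := exists_bd_eq_of_unsorted (supported_mono h3 h2)
    (by rw [map_sub, hbz, (isAssocRel_btw _).bd_bd, sub_zero])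
  exact ⟨v + spanProj (genSet (G.boxProd H) (k + 1) l) (pairMap w), by
    rw [map_add, hv, sub_add_cancel]⟩

end Sorted

/-! ### Excision for projecting decompositions -/

section Excision

variable {V : Type*} {X : SimpleGraph V} {A B : Set V} {π : V → V}

/-- The sets `A` and `B` cover the vertices of `X`, and every geodesic from a vertex `b ∈ B` to `A`
can be taken through the vertex `π b` of `A ∩ B`. -/
structure IsGate (X : SimpleGraph V) (A B : Set V) (π : V → V) : Prop where
  cover : ∀ x, x ∈ A ∨ x ∈ B
  mem : ∀ b ∈ B, ∀ a ∈ A, X.Reachable b a → π b ∈ A ∩ B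
  reachable : ∀ b ∈ B, ∀ a ∈ A, X.Reachable b a → X.Reachable b (π b)
  dist_eq : ∀ b ∈ B, ∀ a ∈ A, X.Reachable b a → X.dist b a = X.dist b (π b) + X.dist (π b) a

/-- The faces that omit a vertex of `S`. -/
def BtwIn (X : SimpleGraph V) (S : Set V) (a b c : V) : Prop := Btw X a b c ∧ b ∈ S

theorem bd_eq_add (X : SimpleGraph V) (S : Set V) :
    bd (Btw X) = bd (BtwIn X S) + bd (BtwIn X Sᶜ) :=
  bd_eq_bd_add_bd (fun a b c => by simp only [BtwIn, Set.mem_compl_iff]; tauto)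
    (fun a b c => by simp only [BtwIn, Set.mem_compl_iff]; tauto)

/-- The first entry outside `A ∩ B` exists and lies outside `B`. -/
def HitsCompl (A B : Set V) : List V → Prop
  | x :: l => x ∉ B ∨ (x ∈ A ∩ B ∧ HitsCompl A B l)
  | [] => False

/-- No entry outside `A` comes before an entry outside `B`. -/
def Straight (A B : Set V) (l : List V) : Prop := l.Pairwise fun b a => b ∈ A ∨ a ∈ B

open Classical in
/-- At the first place where the list passes from a vertex `b ∉ A` through `A ∩ B` to a vertex
outside `B`, insert `π b` behind `b`, with a sign; the result is `0` if `π b` is there already. -/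
noncomputable def gateList (A B : Set V) (π : V → V) : List V → (List V →₀ ℤ)
  | x :: l =>
    if x ∉ A ∧ HitsCompl A B l then
      if l.head? = some (π x) then 0 else single (x :: π x :: l) 1
    else -consMap x (gateList A B π l)
  | [] => 0

/-- The linear extension of `gateList`. -/
noncomputable def gateMap (A B : Set V) (π : V → V) : (List V →₀ ℤ) →ₗ[ℤ] (List V →₀ ℤ) :=
  Finsupp.linearCombination ℤ (gateList A B π)

@[simp] theorem gateMap_single (l : List V) :
    gateMap A B π (single l 1) = gateList A B π l := by
  simp [gateMap]

theorem gateList_of_eq {x y : V} {l : List V} (h : x ∉ A ∧ HitsCompl A B (y :: l))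
    (hy : y = π x) : gateList A B π (x :: y :: l) = 0 := by
  rw [gateList, if_pos h, if_pos (by simp [hy])]

theorem gateList_of_ne {x y : V} {l : List V} (h : x ∉ A ∧ HitsCompl A B (y :: l))
    (hy : y ≠ π x) : gateList A B π (x :: y :: l) = single (x :: π x :: y :: l) 1 := by
  rw [gateList, if_pos h, if_neg (by simp [hy])]

theorem gateList_of_not {x : V} {l : List V} (h : ¬ (x ∉ A ∧ HitsCompl A B l)) :
    gateList A B π (x :: l) = -consMap x (gateList A B π l) := by
  rw [gateList, if_neg h]

theorem HitsCompl.exists_mem {l : List V} (h : HitsCompl A B l) : ∃ a ∈ l, a ∉ B := by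
  induction l with
  | nil => exact h.elim
  | cons x l ih =>
    rcases h with h | h
    · exact ⟨x, by simp, h⟩
    · obtain ⟨a, ha, h⟩ := ih h.2
      exact ⟨a, by simp [ha], h⟩

theorem Straight.hitsCompl {l : List V} (h : Straight A B l) (h' : ∃ a ∈ l, a ∉ B) :
    HitsCompl A B l := by
  induction l with
  | nil => simp at h'
  | cons x l ih =>
    obtain ⟨a, ha, h'⟩ := h'
    by_cases hx : x ∈ B
    · rw [Straight, List.pairwise_cons] at h
      have ha : a ∈ l := (List.mem_cons.1 ha).resolve_left (by rintro rfl; exact h' hx)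
      exact .inr ⟨⟨(h.1 a ha).resolve_right h', hx⟩, ih h.2 ⟨a, ha, h'⟩⟩
    · exact .inl hx

theorem HitsCompl.head_mem (hX : IsGate X A B π) {y : V} {l : List V}
    (h : HitsCompl A B (y :: l)) : y ∈ A := by
  rcases h with h | h
  · exact (hX.cover y).resolve_right h
  · exact h.1.1

theorem Face.hitsCompl_iff {l l' : List V} (h : Face (BtwIn X (A ∩ B)) l l') :
    HitsCompl A B l' ↔ HitsCompl A B l := by
  induction h with
  | head l h =>
    have := h.2
    have hB := h.2.2
    simp only [HitsCompl, this, hB, not_true, false_or, true_and]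
  | cons a _ ih => simp only [HitsCompl, ih]

theorem gateList_mem_headed (x : V) (l : List V) :
    gateList A B π (x :: l) ∈ supported ℤ ℤ (headed x) := by
  rw [gateList]
  split_ifs
  · exact zero_mem _
  · exact single_mem_supported ℤ _ ⟨_, rfl⟩
  · refine neg_mem (map_mem_of_supported (S := Set.univ) (fun e _ => ?_) (by simp))
    rw [consMap_single]
    exact single_mem_supported ℤ _ ⟨_, rfl⟩

theorem gateList_of_straight {l : List V} (h : Straight A B l) : gateList A B π l = 0 := by
  induction l with
  | nil => rfl
  | cons x l ih =>
    rw [Straight, List.pairwise_cons] at h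
    rw [gateList_of_not, ih h.2, map_zero, neg_zero]
    rintro ⟨h1, h2⟩
    obtain ⟨a, ha, h3⟩ := h2.exists_mem
    exact (h.1 a ha).elim h1 h3

theorem IsGate.btw (hX : IsGate X A B π) {x y : V} (hx : x ∉ A) (hy : y ∈ A)
    (hxy : X.Reachable x y) (hne : y ≠ π x) : BtwIn X (A ∩ B) x (π x) y := by
  have hxB := (hX.cover x).resolve_left hx
  have h1 := hX.mem x hxB y hy hxy
  have h2 := hX.reachable x hxB y hy hxy
  exact ⟨⟨⟨fun h => hx (h ▸ h1.1), h2⟩, ⟨hne.symm, h2.symm.trans hxy⟩,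
    (hX.dist_eq x hxB y hy hxy).symm⟩, h1⟩

theorem IsGate.gateList_mem (hX : IsGate X A B π) {l : List V} (hl : l.IsChain (Adm X)) :
    gateList A B π l ∈ supported ℤ ℤ {l' | Face (BtwIn X (A ∩ B)) l' l} := by
  induction l with
  | nil => exact zero_mem _
  | cons x l ih =>
    rw [gateList]
    split_ifs with h1 h2
    · exact zero_mem _
    · cases l with
      | nil => exact h1.2.elim
      | cons y l =>
        have hy : y ≠ π x := fun h => h2 (by simp [h])
        exact single_mem_supported ℤ _ (.head l (hX.btw h1.1 (h1.2.head_mem hX)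
          (List.isChain_cons_cons.1 hl).1.2 hy))
    · refine neg_mem (map_mem_of_supported (fun e he => ?_) (ih hl.tail))
      rw [consMap_single]
      exact single_mem_supported ℤ _ (.cons x he)

theorem gateMap_firstFace (hX : IsGate X A B π) {x y : V} {l : List V} (hx : x ∉ A)
    (hH : HitsCompl A B (y :: l)) (hy : y ≠ π x) (hl : (x :: y :: l).IsChain (Adm X)) :
    gateMap A B π (firstFace (BtwIn X (A ∩ B)) x (y :: l)) =
      consMap x (firstFace (BtwIn X (A ∩ B)) (π x) (y :: l)) := by
  cases l with
  | nil => simp [firstFace]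
  | cons z l =>
    have hxB := (hX.cover x).resolve_left hx
    have hyA := hH.head_mem hX
    have hl1 := (List.isChain_cons_cons.1 hl).1
    have hl2 := (List.isChain_cons_cons.1 (List.isChain_cons_cons.1 hl).2).1
    rw [firstFace, firstFace]
    by_cases hyB : y ∈ B
    · have hHz : HitsCompl A B (z :: l) := (hH.resolve_left (not_not.2 hyB)).2
      have hzA := hHz.head_mem hX
      have h1 := hX.btw hx hyA hl1.2 hy
      have h2 := hX.dist_eq x hxB z hzA (hl1.2.trans hl2.2)
      have h3 := h1.1.2.2
      have hiff : BtwIn X (A ∩ B) x y z ↔ BtwIn X (A ∩ B) (π x) y z := by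
        refine ⟨fun h => ⟨⟨h1.1.2.1, hl2, ?_⟩, hyA, hyB⟩, fun h => ⟨⟨hl1, hl2, ?_⟩, hyA, hyB⟩⟩
        · have := h.1.2.2
          omega
        · have := h.1.2.2
          omega
      by_cases h : BtwIn X (A ∩ B) x y z
      · rw [if_pos h, if_pos (hiff.1 h), gateMap_single,
          gateList_of_ne ⟨hx, hHz⟩ (hiff.1 h).1.adm.1.symm, consMap_single]
      · rw [if_neg h, if_neg (mt hiff.2 h), map_zero, map_zero]
    · rw [if_neg fun h => hyB h.2.2, if_neg fun h => hyB h.2.2, map_zero, map_zero]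

theorem gateMap_firstFace_of_not {x : V} {l : List V} (h : ¬ (x ∉ A ∧ HitsCompl A B l)) :
    gateMap A B π (firstFace (BtwIn X (A ∩ B)) x l) =
      firstFaceMap (BtwIn X (A ∩ B)) x (gateList A B π l) := by
  match l with
  | [] => simp [firstFace, gateList]
  | [y] => simp [firstFace, gateList, HitsCompl]
  | y :: z :: l =>
    by_cases hy : y ∈ A ∩ B
    · have hH : HitsCompl A B (y :: z :: l) ↔ HitsCompl A B (z :: l) := by
        simp only [HitsCompl, hy, hy.2, not_true, false_or, true_and]
      rw [gateList_of_not fun h => h.1 hy.1, map_neg,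
        firstFaceMap_consMap _ _ _ (gateList_mem_headed z l), firstFace]
      split_ifs
      · rw [gateMap_single, gateList_of_not (by rwa [← hH])]
      · simp
    · have h0 : ∀ c, ¬ BtwIn X (A ∩ B) x y c := fun c h => hy h.2
      rw [firstFace_eq_zero h0, map_zero]
      exact (eq_of_headed (f := firstFaceMap (BtwIn X (A ∩ B)) x) (g := 0)
        (fun t => by simp [firstFace_eq_zero h0]) (gateList_mem_headed y _)).symm

open Classical in
/-- For the faces that omit a vertex of `A ∩ B`, `gateMap` contracts the lists that are not
straight. -/
theorem IsGate.homotopy (hX : IsGate X A B π) {l : List V} (hl : l.IsChain (Adm X)) :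
    bd (BtwIn X (A ∩ B)) (gateMap A B π (single l 1)) +
      gateMap A B π (bd (BtwIn X (A ∩ B)) (single l 1)) =
        if Straight A B l then 0 else single l 1 := by
  simp only [gateMap_single, bd_single]
  induction l with
  | nil => simp [gateList, listBoundary, Straight]
  | cons x l ih =>
    have ih := ih hl.tail
    by_cases h : x ∉ A ∧ HitsCompl A B l
    · have hS : ¬ Straight A B (x :: l) := by
        rw [Straight, List.pairwise_cons]
        rintro ⟨h1, -⟩
        obtain ⟨a, ha, h2⟩ := h.2.exists_mem
        exact (h1 a ha).elim h.1 h2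
      rw [if_neg hS]
      cases l with
      | nil => exact h.2.elim
      | cons y l =>
        have hface : ∀ e, Face (BtwIn X (A ∩ B)) (y :: l) e →
            ∃ t, e = y :: t ∧ HitsCompl A B (y :: t) := fun e he => by
          obtain ⟨t, rfl⟩ := he.head_eq
          exact ⟨t, rfl, he.hitsCompl_iff.2 h.2⟩
        have hxy := (List.isChain_cons_cons.1 hl).1
        -- if `π x` is there already, the list is recovered by omitting and reinserting it
        by_cases hy : y = π x
        · have h1 : gateMap A B π (consMap x (listBoundary (BtwIn X (A ∩ B)) (y :: l))) = 0 := by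
            refine eq_of_supported (f := gateMap A B π ∘ₗ consMap x) (g := 0) (fun e he => ?_)
              (listBoundary_mem (BtwIn X (A ∩ B)) (y :: l))
            obtain ⟨t, rfl, ht⟩ := hface e he
            simp [gateList_of_eq ⟨h.1, ht⟩ hy]
          have hyU : y ∈ A ∩ B := by
            have hyA := h.2.head_mem hX
            rw [hy]
            exact hX.mem x ((hX.cover x).resolve_left h.1) y hyA hxy.2
          cases l with
          | nil => exact (h.2.elim (fun h => h hyU.2) fun h => h.2).elim
          | cons z l =>
            have hyz := (List.isChain_cons_cons.1 (List.isChain_cons_cons.1 hl).2).1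
            have hHz : HitsCompl A B (z :: l) := (h.2.resolve_left (not_not.2 hyU.2)).2
            have hz : z ≠ π x := by
              rw [← hy]
              exact hyz.1.symm
            have hR := hX.btw h.1 (hHz.head_mem hX) (hxy.2.trans hyz.2) hz
            rw [← hy] at hR
            rw [gateList_of_eq h hy, listBoundary_cons, map_sub, h1, firstFace, if_pos hR,
              gateMap_single, gateList_of_ne ⟨h.1, hHz⟩ hz, ← hy]
            simp
        · have h1 : gateMap A B π (consMap x (listBoundary (BtwIn X (A ∩ B)) (y :: l))) =
              consMap x (consMap (π x) (listBoundary (BtwIn X (A ∩ B)) (y :: l))) := by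
            refine eq_of_supported (f := gateMap A B π ∘ₗ consMap x)
              (g := consMap x ∘ₗ consMap (π x)) (fun e he => ?_)
              (listBoundary_mem (BtwIn X (A ∩ B)) (y :: l))
            obtain ⟨t, rfl, ht⟩ := hface e he
            simp [gateList_of_ne ⟨h.1, ht⟩ hy]
          have hR := hX.btw h.1 (h.2.head_mem hX) hxy.2 hy
          have h2 : bd (BtwIn X (A ∩ B)) (single (x :: π x :: y :: l) 1) =
              single (x :: y :: l) 1 - consMap x (firstFace (BtwIn X (A ∩ B)) (π x) (y :: l)) +
                consMap x (consMap (π x) (listBoundary (BtwIn X (A ∩ B)) (y :: l))) := by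
            rw [bd_single, listBoundary_cons, listBoundary_cons, firstFace, if_pos hR, map_sub]
            abel
          rw [gateList_of_ne h hy, h2, listBoundary_cons _ x, map_sub,
            gateMap_firstFace hX h.1 h.2 hy hl, h1]
          abel
    · have hS : Straight A B (x :: l) ↔ Straight A B l := by
        rw [Straight, List.pairwise_cons]
        refine ⟨fun h => h.2, fun h' => ⟨fun a ha => ?_, h'⟩⟩
        by_contra! h2
        exact h ⟨h2.1, Straight.hitsCompl h' ⟨a, ha, h2.2⟩⟩
      have h1 : gateMap A B π (consMap x (listBoundary (BtwIn X (A ∩ B)) l)) =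
          -consMap x (gateMap A B π (listBoundary (BtwIn X (A ∩ B)) l)) := by
        refine eq_of_supported (f := gateMap A B π ∘ₗ consMap x)
          (g := -(consMap x ∘ₗ gateMap A B π)) (fun e he => ?_)
          (listBoundary_mem (BtwIn X (A ∩ B)) l)
        have he : Face (BtwIn X (A ∩ B)) l e := he
        simp [gateList_of_not (x := x) (l := e) (π := π) (by rwa [he.hitsCompl_iff])]
      rw [gateList_of_not h, listBoundary_cons, map_sub, gateMap_firstFace_of_not h, h1, map_neg,
        bd_consMap]
      have := congrArg (consMap x) ih
      simp only [hS]
      rw [map_add] at this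
      rw [sub_neg_eq_add, neg_sub]
      calc _ = consMap x (bd (BtwIn X (A ∩ B)) (gateList A B π l)) +
            consMap x (gateMap A B π (listBoundary (BtwIn X (A ∩ B)) l)) := by abel
        _ = _ := by rw [this]; split_ifs <;> simp

open Classical in
/-- The number of entries outside `S`. -/
noncomputable def countOut (S : Set V) (l : List V) : ℕ := l.countP fun x => x ∉ S

theorem Face.countOut_eq {S : Set V} {l l' : List V} (h : Face (BtwIn X S) l l') :
    countOut S l' = countOut S l := by
  unfold countOut
  induction h with
  | head l h => simp [List.countP_cons, h.2]
  | cons a _ ih => rw [List.countP_cons, List.countP_cons, ih]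

theorem Face.countOut_lt {S : Set V} {l l' : List V} (h : Face (BtwIn X Sᶜ) l l') :
    countOut S l' < countOut S l := by
  unfold countOut
  induction h with
  | @head a b c l h =>
    have : b ∉ S := h.2
    simp only [List.countP_cons, this, not_false_iff, decide_true, if_true]
    omega
  | cons a _ ih =>
    rw [List.countP_cons, List.countP_cons]
    omega

/-- Every cycle is homologous to a chain of lists in which no entry outside `A` comes before an
entry outside `B`. The property `C` is carried along. -/
theorem IsGate.exists_straight (hX : IsGate X A B π) {C : List V → Prop}
    (hC : ∀ l l', Face (Btw X) l l' → C l → C l')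
    (hC' : ∀ l l', Face (BtwIn X (A ∩ B)) l' l → C l → C l')
    {z : List V →₀ ℤ} (hz : z ∈ supported ℤ ℤ {l | l.IsChain (Adm X) ∧ C l})
    (hbz : bd (Btw X) z = 0) :
    ∃ w, z - bd (Btw X) w ∈ supported ℤ ℤ {l | C l ∧ Straight A B l} := by
  let F : ℕ → Submodule ℤ (List V →₀ ℤ) := fun n => supported ℤ ℤ
    {l | (l.IsChain (Adm X) ∧ C l) ∧ (Straight A B l ∨ countOut (A ∩ B) l < n)}
  obtain ⟨n, hn⟩ := exists_mem_supported_lt (countOut (A ∩ B)) z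
  have hzn : z ∈ F n := fun l hl => ⟨hz hl, .inr (hn l hl)⟩
  have hF : ∀ n, ∀ z ∈ F (n + 1), z - bd (Btw X) (gateMap A B π z) -
      gateMap A B π (bd (Btw X) z) ∈ F n := by
    intro n z hz
    refine map_mem_of_supported (f := LinearMap.id - bd (Btw X) ∘ₗ gateMap A B π -
      gateMap A B π ∘ₗ bd (Btw X)) (fun l hl => ?_) hz
    obtain ⟨⟨hl, hlC⟩, hln⟩ := hl
    simp only [LinearMap.sub_apply, LinearMap.comp_apply, LinearMap.id_apply]
    by_cases hS : Straight A B l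
    · have h1 : gateMap A B π (bd (Btw X) (single l 1)) = 0 := by
        rw [bd_single]
        refine eq_of_supported (g := 0) (fun e he => ?_) (listBoundary_mem (Btw X) l)
        rw [gateMap_single, gateList_of_straight (hS.sublist (Face.sublist he))]
        rfl
      rw [h1, gateMap_single, gateList_of_straight hS, map_zero, sub_zero, sub_zero]
      exact single_mem_supported ℤ _ ⟨⟨hl, hlC⟩, .inl hS⟩
    · have hln := hln.resolve_left hS
      have key := hX.homotopy hl
      rw [if_neg hS] at key
      have h1 : bd (BtwIn X (A ∩ B)ᶜ) (gateMap A B π (single l 1)) ∈ F n := by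
        rw [gateMap_single]
        refine bd_mem_of_face (fun l' hl' l'' h => ?_) (hX.gateList_mem hl)
        have hl' : Face (BtwIn X (A ∩ B)) l' l := hl'
        have h' : Face (Btw X) l' l'' := h.mono fun _ _ _ h => h.1
        have h'' : Face (Btw X) l' l := hl'.mono fun _ _ _ h => h.1
        have hlt := h.countOut_lt
        rw [← hl'.countOut_eq] at hlt
        exact ⟨⟨h'.isChain_adm_iff.2 (h''.isChain_adm_iff.1 hl), hC _ _ h' (hC' _ _ hl' hlC)⟩,
          .inr (by omega)⟩
      have h2 : gateMap A B π (bd (BtwIn X (A ∩ B)ᶜ) (single l 1)) ∈ F n := by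
        rw [bd_single]
        refine map_mem_of_supported (fun l' hl' => ?_) (listBoundary_mem (BtwIn X (A ∩ B)ᶜ) l)
        have hl' : Face (BtwIn X (A ∩ B)ᶜ) l l' := hl'
        have h' : Face (Btw X) l l' := hl'.mono fun _ _ _ h => h.1
        have hch := h'.isChain_adm_iff.2 hl
        rw [gateMap_single]
        refine supported_mono (fun l'' h => ?_) (hX.gateList_mem hch)
        have h : Face (BtwIn X (A ∩ B)) l'' l' := h
        have h'' : Face (Btw X) l'' l' := h.mono fun _ _ _ h => h.1
        have hlt := hl'.countOut_lt
        rw [h.countOut_eq] at hlt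
        exact ⟨⟨h''.isChain_adm_iff.1 hch, hC' _ _ h (hC _ _ h' hlC)⟩, .inr (by omega)⟩
      have : single l 1 - bd (Btw X) (gateMap A B π (single l 1)) -
          gateMap A B π (bd (Btw X) (single l 1)) =
          -(bd (BtwIn X (A ∩ B)ᶜ) (gateMap A B π (single l 1)) +
            gateMap A B π (bd (BtwIn X (A ∩ B)ᶜ) (single l 1))) := by
        simp only [bd_eq_add X (A ∩ B), LinearMap.add_apply, map_add]
        nth_rewrite 1 [← key]
        abel
      rw [this]
      exact neg_mem (add_mem h1 h2)
  obtain ⟨w, hw⟩ := exists_sub_mem_of_filtration (isAssocRel_btw _).bd_bd F hF n z hzn hbz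
  refine ⟨w, supported_mono (fun l hl => ?_) hw⟩
  exact ⟨hl.1.2, hl.2.resolve_right (by omega)⟩

/-! ### The Mayer–Vietoris argument -/

theorem listLength_snoc (X : SimpleGraph V) (l : List V) (a b : V) :
    listLength X (l ++ [a, b]) = listLength X (l ++ [a]) + X.dist a b := by
  match l with
  | [] => simp [listLength]
  | [c] => simp [listLength]
  | c :: d :: l =>
    have := listLength_snoc X (d :: l) a b
    simp only [List.cons_append, listLength] at this ⊢
    omega

theorem listLength_reverse (X : SimpleGraph V) (l : List V) :
    listLength X l.reverse = listLength X l := by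
  match l with
  | [] => rfl
  | [a] => rfl
  | a :: b :: l =>
    have := listLength_reverse X (b :: l)
    rw [List.reverse_cons] at this
    rw [List.reverse_cons, List.reverse_cons, List.append_assoc, List.singleton_append,
      listLength_snoc, this, listLength, X.dist_comm, add_comm]

theorem reverse_mem_genSet {k l : ℕ} {e : List V} (he : e ∈ genSet X k l) :
    e.reverse ∈ genSet X k l :=
  ⟨List.isChain_reverse.2 (he.1.imp fun _ _ h => h.symm), by simpa using he.2.1,
    (listLength_reverse X e).trans he.2.2⟩

theorem revMap_mem {S T : Set (List V)} (h : ∀ e ∈ S, e.reverse ∈ T) {z : List V →₀ ℤ}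
    (hz : z ∈ supported ℤ ℤ S) : revMap z ∈ supported ℤ ℤ T :=
  map_mem_of_supported (fun e he => by
    rw [revMap_single]
    exact single_mem_supported ℤ _ (h e he)) hz

/-- A chain is a boundary if its reversal is one. -/
theorem exists_bd_eq_of_revMap {k l : ℕ} {z : List V →₀ ℤ}
    (hz : z ∈ supported ℤ ℤ (genSet X k l)) (h : ∃ w, bd (Btw X) w = revMap z) :
    ∃ w, bd (Btw X) w = z := by
  obtain ⟨w, hw, hbw⟩ := exists_mem_genSet_of_bd (revMap_mem (fun e => reverse_mem_genSet) hz) h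
  have h1 := bd_revMap (β := Btw X) (fun _ _ _ => btw_comm)
    (supported_mono (fun e (he : e ∈ genSet X (k + 1) l) => he.2.1) hw :
      w ∈ supported ℤ ℤ {e : List V | e.length = k + 1 + 1})
  rw [hbw, revMap_revMap] at h1
  refine ⟨((-1) ^ (k + 1 + 1 + 1) : ℤ) • revMap w, ?_⟩
  rw [map_smul, h1, smul_smul, ← mul_pow]
  simp

theorem Face.mem_or {S : Set V} {l l' : List V} (h : Face (BtwIn X S) l l') {x : V}
    (hx : x ∈ l) : x ∈ l' ∨ x ∈ S := by
  induction h with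
  | head l h =>
    simp only [List.mem_cons] at hx ⊢
    rcases hx with rfl | rfl | hx
    · simp
    · exact .inr h.2
    · tauto
  | cons a _ ih =>
    simp only [List.mem_cons] at hx ⊢
    tauto

/-- The reversed form of `Straight` is preserved by inserting entries of `A ∩ B`. -/
theorem Face.pairwise_of_face {l l' : List V} (h : Face (BtwIn X (A ∩ B)) l' l)
    (hl : l.Pairwise fun a b => b ∈ A ∨ a ∈ B) : l'.Pairwise fun a b => b ∈ A ∨ a ∈ B := by
  induction h with
  | @head a b c l h =>
    rw [List.pairwise_cons] at hl ⊢
    have hA := h.2.1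
    have hB := h.2.2
    refine ⟨?_, List.pairwise_cons.2 ⟨fun _ _ => .inr hB, hl.2⟩⟩
    intro d hd
    rcases List.mem_cons.1 hd with rfl | hd
    · exact .inl hA
    · exact hl.1 d hd
  | cons a h ih =>
    rw [List.pairwise_cons] at hl ⊢
    refine ⟨fun d hd => ?_, ih hl.2⟩
    rcases h.mem_or hd with hd | hd
    · exact hl.1 d hd
    · exact .inl hd.1

/-- Excision: every homology class of `X` vanishes, provided that this holds for the classes of
cycles all of whose lists stay in `A` or stay in `B`. -/
theorem IsGate.exists_bd_eq (hX : IsGate X A B π) {k l : ℕ}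
    (h : ∀ z ∈ supported ℤ ℤ (genSet X k l ∩ {e | (∀ x ∈ e, x ∈ A) ∨ ∀ x ∈ e, x ∈ B}),
      bd (Btw X) z = 0 → ∃ w, bd (Btw X) w = z)
    {z : List V →₀ ℤ} (hz : z ∈ supported ℤ ℤ (genSet X k l)) (hbz : bd (Btw X) z = 0) :
    ∃ w, bd (Btw X) w = z := by
  have htriv : genSet X k l ⊆ {e | e.IsChain (Adm X) ∧ True} := fun e he => ⟨he.1, trivial⟩
  -- the first pass excludes that an entry outside `A` precedes one outside `B`
  obtain ⟨w, hw⟩ := hX.exists_straight (C := fun _ => True) (fun _ _ _ _ => trivial)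
    (fun _ _ _ _ => trivial)
    (supported_mono htriv hz) hbz
  have hw := spanProj_mem_inter (genSet X k l) hw
  rw [map_sub, ← bd_spanProj, spanProj_of_mem hz] at hw
  set w₁ := spanProj (genSet X (k + 1) l) w
  set y := z - bd (Btw X) w₁ with hy
  have hyg : y ∈ supported ℤ ℤ (genSet X k l) := supported_mono Set.inter_subset_left hw
  have hby : bd (Btw X) y = 0 := by rw [hy, map_sub, hbz, (isAssocRel_btw X).bd_bd, sub_zero]
  suffices hs : ∃ v, bd (Btw X) v = revMap y by
    obtain ⟨v, hv⟩ := exists_bd_eq_of_revMap hyg hs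
    exact ⟨v + w₁, by rw [map_add, hv, hy, sub_add_cancel]⟩
  -- the second pass, on the reversed lists, excludes the other order
  have hbr : bd (Btw X) (revMap y) = 0 := by
    have h1 : y ∈ supported ℤ ℤ {e : List V | e.length = k + 1} :=
      supported_mono (fun e (he : e ∈ genSet X k l) => he.2.1) hyg
    rw [bd_revMap (β := Btw X) (fun _ _ _ => btw_comm) h1, hby, map_zero, smul_zero]
  have hrg : revMap y ∈ supported ℤ ℤ (genSet X k l) := revMap_mem (fun e => reverse_mem_genSet) hyg
  obtain ⟨v, hv⟩ := hX.exists_straight (C := List.Pairwise fun a b => b ∈ A ∨ a ∈ B)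
    (fun _ _ h hl => hl.sublist h.sublist) (fun _ _ h hl => h.pairwise_of_face hl)
    (z := revMap y)
    (revMap_mem (T := {e | e.IsChain (Adm X) ∧ e.Pairwise fun a b => b ∈ A ∨ a ∈ B})
      (fun e he => ⟨(reverse_mem_genSet he.1).1, List.pairwise_reverse.2 he.2.2⟩) hw) hbr
  have hv := spanProj_mem_inter (genSet X k l) hv
  rw [map_sub, ← bd_spanProj, spanProj_of_mem hrg] at hv
  set v₁ := spanProj (genSet X (k + 1) l) v
  have hAB : ∀ e : List V, e.Pairwise (fun a b => b ∈ A ∨ a ∈ B) → Straight A B e →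
      (∀ x ∈ e, x ∈ A) ∨ ∀ x ∈ e, x ∈ B := by
    intro e h1 h2
    by_contra! h3
    obtain ⟨⟨x, hx, hxA⟩, ⟨y, hy, hyB⟩⟩ := h3
    exact (List.Pairwise.forall_of_forall_of_flip (R := fun a b => a ∈ A ∨ b ∈ B)
      (fun a _ => hX.cover a) h2 h1 hx hy).elim hxA hyB
  obtain ⟨u, hu⟩ := h _ (supported_mono
      (Set.inter_subset_inter_right _ fun e he => hAB e he.1 he.2) hv)
    (by rw [map_sub, hbr, (isAssocRel_btw X).bd_bd, sub_zero])
  exact ⟨u + v₁, by rw [map_add, hu, sub_add_cancel]⟩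

/-- `b ∈ B` is joined to a vertex of `A` by a path. -/
def Joined (X : SimpleGraph V) (A B : Set V) (b : V) : Prop := b ∈ B ∧ ∃ a ∈ A, X.Reachable b a

/-- The steps between vertices of `B` whose length is preserved by `π`. -/
def Preserves (X : SimpleGraph V) (A B : Set V) (π : V → V) (x y : V) : Prop :=
  Adm X x y ∧ Joined X A B x ∧ Joined X A B y ∧ X.dist (π x) (π y) = X.dist x y

theorem IsGate.dist_le (hX : IsGate X A B π) {x y : V} (hx : Joined X A B x)
    (hy : Joined X A B y) (hxy : X.Reachable x y) : X.dist (π x) (π y) ≤ X.dist x y := by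
  obtain ⟨hxB, a, ha, hxa⟩ := hx
  obtain ⟨hyB, b, hb, hyb⟩ := hy
  have h1 := hX.mem x hxB a ha hxa
  have h2 := hX.mem y hyB b hb hyb
  have h3 := hX.reachable x hxB a ha hxa
  have h4 := hX.reachable y hyB b hb hyb
  have h5 := hX.dist_eq x hxB (π y) h2.1 (hxy.trans h4)
  have h6 := hX.dist_eq y hyB (π x) h1.1 (hxy.symm.trans h3)
  have h7 := dist_triangle_of_reachable hxy h4
  have h8 := dist_triangle_of_reachable hxy.symm h3
  rw [X.dist_comm (u := y) (v := x)] at h8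
  rw [X.dist_comm (u := π y) (v := π x)] at h6
  omega

theorem IsGate.apply_eq (hX : IsGate X A B π) {x : V} (hA : x ∈ A) (hB : x ∈ B) : π x = x := by
  have h1 := hX.dist_eq x hB x hA (by rfl)
  rw [SimpleGraph.dist_self] at h1
  exact (((hX.reachable x hB x hA (by rfl)).dist_eq_zero_iff).1 (by omega)).symm

theorem IsGate.preserves_iff (hX : IsGate X A B π) {x y z : V} (hy : y ∈ B) :
    (Btw X x y z ∧ Preserves X A B π x z) ↔
      (Preserves X A B π x y ∧ Preserves X A B π y z ∧ Btw X (π x) (π y) (π z)) := by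
  have hmem : ∀ {x}, Joined X A B x → X.Reachable x (π x) := fun ⟨hB, a, ha, h⟩ =>
    hX.reachable _ hB a ha h
  constructor
  · rintro ⟨h1, h2, h3, h4, h5⟩
    have hyJ : Joined X A B y := by
      obtain ⟨-, a, ha, h⟩ := h3
      exact ⟨hy, a, ha, h1.1.2.symm.trans h⟩
    have h6 := hX.dist_le h3 hyJ h1.1.2
    have h7 := hX.dist_le hyJ h4 h1.2.1.2
    have h8 := dist_triangle_of_reachable ((hmem h3).symm.trans (h1.1.2.trans (hmem hyJ)))
      ((hmem hyJ).symm.trans (h1.2.1.2.trans (hmem h4)))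
    have h9 := h1.2.2
    have h10 := h1.1.dist_pos
    have h11 := h1.2.1.dist_pos
    exact ⟨⟨h1.1, h3, hyJ, by omega⟩, ⟨h1.2.1, hyJ, h4, by omega⟩, btw_iff_dist.2 (by omega)⟩
  · rintro ⟨h1, h2, h3⟩
    have h4 := hX.dist_le h1.2.1 h2.2.2.1 (h1.1.2.trans h2.1.2)
    have h5 := dist_triangle_of_reachable h1.1.2 h2.1.2
    have h6 := h1.2.2.2
    have h7 := h2.2.2.2
    have h8 := h3.2.2
    have h9 : Btw X x y z := ⟨h1.1, h2.1, by omega⟩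
    exact ⟨h9, h9.adm, h1.2.1, h2.2.2.1, by omega⟩

theorem listLength_map_of_preserves {e : List V} (he : e.IsChain (Preserves X A B π)) :
    listLength X (e.map π) = listLength X e := by
  induction e with
  | nil => rfl
  | cons x e ih =>
    cases e with
    | nil => rfl
    | cons y e =>
      rw [List.isChain_cons_cons] at he
      have ih := ih he.2
      simp only [List.map_cons, listLength] at ih ⊢
      rw [ih, he.1.2.2.2]

theorem joined_of_isChain {x y : V} {e : List V} (he : (x :: y :: e).IsChain (Preserves X A B π)) :
    ∀ z ∈ x :: y :: e, Joined X A B z := by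
  induction e generalizing x y with
  | nil =>
    rw [List.isChain_cons_cons] at he
    simp [he.1.2.1, he.1.2.2.1]
  | cons w e ih =>
    rw [List.isChain_cons_cons] at he
    intro z hz
    rcases List.mem_cons.1 hz with rfl | hz
    · exact he.1.2.1
    · exact ih he.2 z hz

theorem IsGate.map_mem (hX : IsGate X A B π) {k l : ℕ} {e : List V} (he : e ∈ genSet X (k + 1) l)
    (hP : e.IsChain (Preserves X A B π)) :
    e.map π ∈ genSet X (k + 1) l ∩ {e | ∀ x ∈ e, x ∈ A ∩ B} := by
  refine ⟨⟨?_, by simpa using he.2.1, (listLength_map_of_preserves hP).trans he.2.2⟩, ?_⟩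
  · rw [List.isChain_map]
    refine hP.imp fun x y h => adm_of_dist_pos ?_
    rw [h.2.2.2]
    exact h.1.dist_pos
  · match e, he, hP with
    | [], he, _ => simp [genSet] at he
    | [x], he, _ => simp [genSet] at he
    | x :: y :: e, _, hP =>
      intro w hw
      obtain ⟨z, hz, rfl⟩ := List.mem_map.1 hw
      obtain ⟨hzB, a, ha, hza⟩ := joined_of_isChain hP z hz
      exact hX.mem z hzB a ha hza

/-- If the magnitude homology of `A` and of `B` vanishes in a bidegree off the diagonal, then so
does that of `X`: since `π` induces a retraction of the chains in `B` onto the chains in `A ∩ B`, a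
cycle composed of chains in `A` and in `B` is a sum of a cycle in `A` and a cycle in `B`. -/
theorem IsGate.listDiagonal (hX : IsGate X A B π)
    (hA : ∀ k l : ℕ, k ≠ l → ∀ z ∈ supported ℤ ℤ (genSet X k l ∩ {e | ∀ x ∈ e, x ∈ A}),
      bd (Btw X) z = 0 → ∃ w, bd (Btw X) w = z)
    (hB : ∀ k l : ℕ, k ≠ l → ∀ z ∈ supported ℤ ℤ (genSet X k l ∩ {e | ∀ x ∈ e, x ∈ B}),
      bd (Btw X) z = 0 → ∃ w, bd (Btw X) w = z) : ListDiagonal X := by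
  intro k l hkl z hz hbz
  refine hX.exists_bd_eq (fun z hz hbz => ?_) hz hbz
  cases k with
  | zero =>
    have : genSet X 0 l = ∅ := by
      refine Set.eq_empty_of_forall_notMem fun e he => hkl ?_
      obtain ⟨a, rfl⟩ := List.length_eq_one_iff.1 he.2.1
      exact he.2.2
    rw [this, Set.empty_inter, supported_empty, Submodule.mem_bot] at hz
    exact ⟨0, by rw [hz, map_zero]⟩
  | succ k =>
    set g := spanProj {e : List V | ∀ x ∈ e, x ∈ A} z
    have hg : g ∈ supported ℤ ℤ (genSet X (k + 1) l ∩ {e | ∀ x ∈ e, x ∈ A}) :=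
      supported_mono (Set.subset_inter (Set.inter_subset_right.trans Set.inter_subset_left)
        Set.inter_subset_left) (spanProj_mem_inter {e : List V | ∀ x ∈ e, x ∈ A} hz)
    have hh : z - g ∈ supported ℤ ℤ (genSet X (k + 1) l ∩ {e | ∀ x ∈ e, x ∈ B}) :=
      fun e he =>
        have h := sub_spanProj_mem {e : List V | ∀ x ∈ e, x ∈ A} hz he
        ⟨h.1.1, h.1.2.resolve_left h.2⟩
    have hface : ∀ S : Set V, ∀ e ∈ genSet X (k + 1) l ∩ {e | ∀ x ∈ e, x ∈ S}, ∀ e',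
        Face (Btw X) e e' → e' ∈ {e : List V | e.IsChain (Adm X) ∧ ∀ x ∈ e, x ∈ S} :=
      fun S e he e' h => ⟨h.isChain_adm_iff.2 he.1.1, fun x hx => he.2 x (h.sublist.subset hx)⟩
    have hbh : bd (Btw X) (z - g) = -bd (Btw X) g := by rw [map_sub, hbz, zero_sub]
    -- the common boundary consists of lists in `A ∩ B`, on which the retraction is the identity
    have hu : bd (Btw X) (z - g) ∈
        supported ℤ ℤ {e : List V | e.IsChain (Adm X) ∧ ∀ x ∈ e, x ∈ A ∩ B} := by
      have h1 := bd_mem_of_face (hface B) hh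
      have h2 : bd (Btw X) (z - g) ∈ _ := hbh ▸ neg_mem (bd_mem_of_face (hface A) hg)
      exact fun e he => ⟨(h1 he).1, fun x hx => ⟨(h2 he).2 x hx, (h1 he).2 x hx⟩⟩
    set r := pushMap (Preserves X A B π) π
    have hr1 : r (bd (Btw X) (z - g)) = bd (Btw X) (z - g) := by
      refine eq_of_supported (g := LinearMap.id) (fun e he => ?_) hu
      have he1 : e.IsChain (Preserves X A B π) := by
        have := he.1
        refine List.IsChain.imp_of_mem_imp (fun x y hx hy h => ?_) this
        obtain ⟨hxA, hxB⟩ := he.2 x hx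
        obtain ⟨hyA, hyB⟩ := he.2 y hy
        exact ⟨h, ⟨hxB, x, hxA, by rfl⟩, ⟨hyB, y, hyA, by rfl⟩,
          by rw [hX.apply_eq hxA hxB, hX.apply_eq hyA hyB]⟩
      have he2 : e.map π = e :=
        (List.map_congr_left fun x hx => hX.apply_eq (he.2 x hx).1 (he.2 x hx).2).trans
          (List.map_id e)
      rw [pushMap_single π he1, he2, LinearMap.id_apply]
    have hhB : z - g ∈ supported ℤ ℤ {e | ∀ x ∈ e, x ∈ B} :=
      supported_mono Set.inter_subset_right hh
    have hr2 : bd (Btw X) (r (z - g)) = r (bd (Btw X) (z - g)) :=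
      bd_pushMap (β := Btw X) (β' := Btw X) (Q := Preserves X A B π) (f := π) (S := B)
        (fun x _ y hy z _ => hX.preserves_iff hy) hhB
    have hr3 : r (z - g) ∈ supported ℤ ℤ (genSet X (k + 1) l ∩ {e | ∀ x ∈ e, x ∈ A ∩ B}) := by
      refine map_mem_of_supported (fun e he => ?_) hh
      by_cases hP : e.IsChain (Preserves X A B π)
      · rw [pushMap_single π hP]
        exact single_mem_supported ℤ _ (hX.map_mem he.1 hP)
      · rw [pushMap_single_of_not π hP]
        exact zero_mem _
    obtain ⟨w₁, hw₁⟩ := hA (k + 1) l hkl (g + r (z - g))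
      (add_mem hg fun e he => ⟨(hr3 he).1, fun x hx => ((hr3 he).2 x hx).1⟩)
      (by rw [map_add, hr2, hr1, hbh, add_neg_cancel])
    obtain ⟨w₂, hw₂⟩ := hB (k + 1) l hkl (z - g - r (z - g))
      (sub_mem hh fun e he => ⟨(hr3 he).1, fun x hx => ((hr3 he).2 x hx).2⟩)
      (by rw [map_sub, hr2, hr1, sub_self])
    exact ⟨w₁ + w₂, by rw [map_add, hw₁, hw₂]; abel⟩

end Excision

/-! ### Isometric embeddings -/

section Embedding

variable {V W : Type*} {X : SimpleGraph V} {Y : SimpleGraph W} {f : W → V}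

theorem reachable_iff_of_edist_eq (hf : ∀ u v, Y.edist u v = X.edist (f u) (f v)) (u v : W) :
    X.Reachable (f u) (f v) ↔ Y.Reachable u v := by
  rw [← SimpleGraph.edist_ne_top_iff_reachable, ← SimpleGraph.edist_ne_top_iff_reachable, hf]

theorem dist_eq_of_edist_eq (hf : ∀ u v, Y.edist u v = X.edist (f u) (f v)) (u v : W) :
    X.dist (f u) (f v) = Y.dist u v := by
  rw [SimpleGraph.dist, SimpleGraph.dist, hf]

theorem injective_of_edist_eq (hf : ∀ u v, Y.edist u v = X.edist (f u) (f v)) :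
    Function.Injective f := fun u v h => by
  rw [← SimpleGraph.edist_eq_zero_iff (G := Y), hf, h, SimpleGraph.edist_self]

theorem adm_iff_of_edist_eq (hf : ∀ u v, Y.edist u v = X.edist (f u) (f v)) (u v : W) :
    Adm X (f u) (f v) ↔ Adm Y u v := by
  rw [Adm, Adm, reachable_iff_of_edist_eq hf, (injective_of_edist_eq hf).ne_iff]

theorem listLength_map_of_edist_eq (hf : ∀ u v, Y.edist u v = X.edist (f u) (f v)) (e : List W) :
    listLength X (e.map f) = listLength Y e := by
  induction e with
  | nil => rfl
  | cons x e ih =>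
    cases e with
    | nil => rfl
    | cons y e =>
      simp only [List.map_cons, listLength] at ih ⊢
      rw [ih, dist_eq_of_edist_eq hf]

theorem map_mem_genSet_iff (hf : ∀ u v, Y.edist u v = X.edist (f u) (f v)) {k l : ℕ} {e : List W} :
    e.map f ∈ genSet X k l ↔ e ∈ genSet Y k l := by
  simp only [genSet, Set.mem_ofPred_eq, List.isChain_map, adm_iff_of_edist_eq hf,
    List.length_map, listLength_map_of_edist_eq hf]

theorem pushMap_true_injective (hf : Function.Injective f) :
    Function.Injective (pushMap (fun _ _ => True) f) := by
  have : pushMap (fun _ _ => True) f = lmapDomain ℤ ℤ (List.map f) :=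
    lhom_ext' fun e => LinearMap.ext_ring (by
      simp only [LinearMap.comp_apply, lsingle_apply, pushMap_single_true, lmapDomain_apply,
        mapDomain_single])
  rw [this]
  exact mapDomain_injective (List.map_injective_iff.2 hf)

/-- The chains of an isometrically embedded graph `Y` are the chains of `X` with entries in the
image of `Y`, so the homology of the latter vanishes off the diagonal if `Y` is diagonal. -/
theorem ListDiagonal.exists_bd_eq_of_edist_eq (hY : ListDiagonal Y)
    (hf : ∀ u v, Y.edist u v = X.edist (f u) (f v)) {k l : ℕ} (hkl : k ≠ l) {z : List V →₀ ℤ}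
    (hz : z ∈ supported ℤ ℤ (genSet X k l ∩ {e | ∀ x ∈ e, x ∈ Set.range f}))
    (hbz : bd (Btw X) z = 0) : ∃ w, bd (Btw X) w = z := by
  have hbd : ∀ y, bd (Btw X) (pushMap (fun _ _ => True) f y) =
      pushMap (fun _ _ => True) f (bd (Btw Y) y) := fun y =>
    bd_pushMap (S := Set.univ) (β := Btw Y) (β' := Btw X) (fun a _ b _ c _ => by
      simp only [Btw, adm_iff_of_edist_eq hf, dist_eq_of_edist_eq hf]; tauto)
      (by simp [supported_univ])
  obtain ⟨y, hy, rfl⟩ : z ∈ (supported ℤ ℤ (genSet Y k l)).map (pushMap (fun _ _ => True) f) := by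
    refine map_mem_of_supported (f := LinearMap.id) (fun e he => ?_) hz
    have he2 : e ∈ Set.range (List.map f) := by
      rw [Set.range_list_map]
      exact he.2
    obtain ⟨e, rfl⟩ := he2
    exact ⟨single e 1, single_mem_supported ℤ _ ((map_mem_genSet_iff hf).1 he.1),
      pushMap_single_true f e⟩
  rw [hbd, ← map_zero (pushMap (fun _ _ => True) f)] at hbz
  obtain ⟨w, hw⟩ := hY k l hkl y hy (pushMap_true_injective (injective_of_edist_eq hf) hbz)
  exact ⟨pushMap (fun _ _ => True) f w, by rw [hbd, hw]⟩

end Embedding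

/-! ### Projecting decompositions -/

section Subgraph

variable {V : Type*} {X : SimpleGraph V} {G H : X.Subgraph}

/-- Graph homomorphisms do not increase distances. -/
theorem edist_map_le {V W : Type*} {X : SimpleGraph V} {Y : SimpleGraph W} (f : X →g Y) (u v : V) :
    Y.edist (f u) (f v) ≤ X.edist u v := by
  by_cases h : X.edist u v = ⊤
  · rw [h]
    exact le_top
  · obtain ⟨p, hp⟩ := SimpleGraph.exists_walk_of_edist_ne_top h
    rw [← hp, ← p.length_map f]
    exact SimpleGraph.edist_le _

/-- In a union of two subgraphs with convex intersection, a walk that ends in `G` can be shortened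
to a walk inside `G` if it starts in `G`, and to a walk inside `H` followed by a walk inside `G` if
it starts in `H`. -/
theorem edist_le_length (hGH : G ⊔ H = ⊤) (hU : IsConvex (G ⊓ H)) {u v : V} (p : X.Walk u v)
    (hv : v ∈ G.verts) :
    (∀ hu : u ∈ G.verts, G.coe.edist ⟨u, hu⟩ ⟨v, hv⟩ ≤ p.length) ∧
    ∀ hu : u ∈ H.verts, ∃ (w : V) (hG : w ∈ G.verts) (hH : w ∈ H.verts),
      H.coe.edist ⟨u, hu⟩ ⟨w, hH⟩ + G.coe.edist ⟨w, hG⟩ ⟨v, hv⟩ ≤ p.length := by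
  induction p with
  | nil => exact ⟨fun hu => by simp, fun hu => ⟨_, hv, hu, by simp⟩⟩
  | @cons u x v h p ih =>
    obtain ⟨ih1, ih2⟩ := ih hv
    have hadj : (G ⊔ H).Adj u x := by rw [hGH]; exact h
    have hlen : ((p.cons h).length : ℕ∞) = 1 + p.length := by
      rw [SimpleGraph.Walk.length_cons, Nat.cast_add, Nat.cast_one, add_comm]
    rw [hlen]
    rcases hadj with hadj | hadj
    · have h1 : ∀ hu : u ∈ G.verts, G.coe.edist ⟨u, hu⟩ ⟨v, hv⟩ ≤ 1 + p.length := fun hu => by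
        have hx := G.edge_vert hadj.symm
        have : G.coe.edist ⟨u, hu⟩ ⟨x, hx⟩ = 1 := SimpleGraph.edist_eq_one_iff_adj.2 hadj
        exact SimpleGraph.edist_triangle.trans (add_le_add this.le (ih1 hx))
      exact ⟨h1, fun hu => ⟨u, G.edge_vert hadj, hu, by
        rw [SimpleGraph.edist_self, zero_add]
        exact h1 _⟩⟩
    · have hx := H.edge_vert hadj.symm
      have hu := H.edge_vert hadj
      obtain ⟨w, hwG, hwH, hw⟩ := ih2 hx
      have h1 : H.coe.edist ⟨u, hu⟩ ⟨x, hx⟩ = 1 := SimpleGraph.edist_eq_one_iff_adj.2 hadj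
      have h2 : H.coe.edist ⟨u, hu⟩ ⟨w, hwH⟩ + G.coe.edist ⟨w, hwG⟩ ⟨v, hv⟩ ≤ 1 + p.length := by
        refine (add_le_add_left (SimpleGraph.edist_triangle (v := ⟨x, hx⟩)) _).trans ?_
        rw [h1, add_assoc]
        exact add_le_add_right hw 1
      refine ⟨fun huG => ?_, fun _ => ⟨w, hwG, hwH, h2⟩⟩
      -- between vertices of the convex subgraph `G ⊓ H`, distances in `G` are at most those in `H`
      have h3 : G.coe.edist ⟨u, huG⟩ ⟨w, hwG⟩ ≤ H.coe.edist ⟨u, hu⟩ ⟨w, hwH⟩ :=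
        calc G.coe.edist ⟨u, huG⟩ ⟨w, hwG⟩
            ≤ (G ⊓ H).coe.edist ⟨u, huG, hu⟩ ⟨w, hwG, hwH⟩ :=
              edist_map_le (SimpleGraph.Subgraph.inclusion inf_le_left) ⟨u, huG, hu⟩ ⟨w, hwG, hwH⟩
          _ = X.edist u w := hU _ _
          _ ≤ H.coe.edist ⟨u, hu⟩ ⟨w, hwH⟩ := edist_map_le H.hom ⟨u, hu⟩ ⟨w, hwH⟩
      exact SimpleGraph.edist_triangle.trans ((add_le_add_left h3 _).trans h2)

/-- Both parts of a union with convex intersection are convex. -/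
theorem isConvex_of_sup_eq_top (hGH : G ⊔ H = ⊤) (hU : IsConvex (G ⊓ H)) : IsConvex G := by
  intro u v
  refine le_antisymm ?_ (edist_map_le G.hom u v)
  by_cases h : X.edist (u : V) v = ⊤
  · rw [h]
    exact le_top
  · obtain ⟨p, hp⟩ := SimpleGraph.exists_walk_of_edist_ne_top h
    rw [← hp]
    exact (edist_le_length hGH hU p v.2).1 u.2

/-- The projection of `H` to `G ⊓ H` also splits the geodesics to the other vertices of `G`, since
these geodesics pass through `G ⊓ H`. -/
theorem IsProjectingDecomposition.exists_isGate {V : Type*} {X : SimpleGraph V} {G H : X.Subgraph}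
    (h : IsProjectingDecomposition X G H) : ∃ π, IsGate X G.verts H.verts π := by
  classical
  have key : ∀ b : V, ∃ p : V, ∀ hb : b ∈ H.verts, ∀ a ∈ G.verts, X.Reachable b a →
      p ∈ G.verts ∧ p ∈ H.verts ∧ X.Reachable b p ∧ X.dist b a = X.dist b p + X.dist p a := by
    intro b
    -- if no vertex of `G ⊓ H` is joined to `b` in `H`, then `b` is not joined to `G` at all
    by_cases hb : ∃ hb : b ∈ H.verts,
        ∃ u ∈ (H.restrict (G ⊓ H)).verts, H.coe.Reachable ⟨b, hb⟩ u
    · obtain ⟨hb, hbu⟩ := hb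
      obtain ⟨⟨p, hpH⟩, hp, hpu⟩ := h.projects.2 ⟨b, hb⟩ hbu
      have hpG : p ∈ G.verts := hp.1
      refine ⟨p, fun _ a ha hba => ?_⟩
      obtain ⟨q, hq⟩ := hba.exists_walk_length_eq_edist
      obtain ⟨w, hwG, hwH, hw⟩ := (edist_le_length h.union_eq h.convex_inter q ha).2 hb
      have h1 := hpu ⟨w, hwH⟩ ⟨hwG, hwH⟩
      have h2 : X.edist b p ≤ _ := edist_map_le H.hom ⟨b, hb⟩ ⟨p, hpH⟩
      have h3 : X.edist p w ≤ _ := edist_map_le H.hom ⟨p, hpH⟩ ⟨w, hwH⟩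
      have h4 : X.edist w a ≤ _ := edist_map_le G.hom ⟨w, hwG⟩ ⟨a, ha⟩
      have h5 : X.edist b p + X.edist p a ≤ X.edist b a :=
        calc X.edist b p + X.edist p a ≤ X.edist b p + (X.edist p w + X.edist w a) :=
              add_le_add_right SimpleGraph.edist_triangle _
          _ ≤ _ := add_le_add h2 (add_le_add h3 h4)
          _ ≤ q.length := by rw [← add_assoc, ← h1]; exact hw
          _ = X.edist b a := hq
      have h6 := h5.antisymm SimpleGraph.edist_triangle
      have h7 := SimpleGraph.edist_ne_top_iff_reachable.2 hba
      have h8 : X.Reachable b p := SimpleGraph.edist_ne_top_iff_reachable.1 fun h8 =>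
        h7 (by rw [← h6, h8, top_add])
      have h9 : X.Reachable p a := h8.symm.trans hba
      refine ⟨hpG, hpH, h8, ?_⟩
      rw [← hba.coe_dist_eq_edist, ← h8.coe_dist_eq_edist, ← h9.coe_dist_eq_edist] at h6
      exact_mod_cast h6.symm
    · refine ⟨b, fun hb' a ha hba => (hb ?_).elim⟩
      obtain ⟨q⟩ := hba
      obtain ⟨w, hwG, hwH, hw⟩ := (edist_le_length h.union_eq h.convex_inter q ha).2 hb'
      refine ⟨hb', ⟨w, hwH⟩, ⟨hwG, hwH⟩, SimpleGraph.edist_ne_top_iff_reachable.1 fun h8 => ?_⟩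
      rw [h8, top_add, top_le_iff] at hw
      exact ENat.natCast_ne_top _ hw
  choose π hπ using key
  refine ⟨π, fun x => ?_, fun b hb a ha hba => ?_, fun b hb a ha hba => ?_,
    fun b hb a ha hba => ?_⟩
  · have : x ∈ (G ⊔ H).verts := by rw [h.union_eq]; trivial
    exact this
  · exact ⟨(hπ b hb a ha hba).1, (hπ b hb a ha hba).2.1⟩
  · exact (hπ b hb a ha hba).2.2.1
  · exact (hπ b hb a ha hba).2.2.2

theorem IsProjectingDecomposition.listDiagonal {V : Type*} {X : SimpleGraph V} {G H : X.Subgraph}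
    (h : IsProjectingDecomposition X G H) (hG : ListDiagonal G.coe) (hH : ListDiagonal H.coe) :
    ListDiagonal X := by
  obtain ⟨π, hπ⟩ := h.exists_isGate
  have hcG := isConvex_of_sup_eq_top h.union_eq h.convex_inter
  have hcH : IsConvex H := isConvex_of_sup_eq_top (G := H) (H := G)
    (by rw [sup_comm, h.union_eq]) (by rw [inf_comm]; exact h.convex_inter)
  refine hπ.listDiagonal (fun k l hkl z hz => ?_) (fun k l hkl z hz => ?_)
  · exact hG.exists_bd_eq_of_edist_eq hcG hkl (by rwa [Subtype.range_coe])
  · exact hH.exists_bd_eq_of_edist_eq hcH hkl (by rwa [Subtype.range_coe])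

end Subgraph

end MagnitudeHomology

theorem mainTheorem9 :
    (∀ {V W : Type*} [Finite V] [Finite W] (G : SimpleGraph V) (H : SimpleGraph W),
      MagnitudeHomology.IsDiagonal G → MagnitudeHomology.IsDiagonal H →
        MagnitudeHomology.IsDiagonal (SimpleGraph.boxProd G H)) ∧
    (∀ {V : Type*} [Finite V] (X : SimpleGraph V) (G H : X.Subgraph),
      MagnitudeHomology.IsProjectingDecomposition X G H →
        MagnitudeHomology.IsDiagonal G.coe → MagnitudeHomology.IsDiagonal H.coe →
          MagnitudeHomology.IsDiagonal X) := by
  refine ⟨fun G H hG hH => ?_, fun X G H h hG hH => ?_⟩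
  · rw [MagnitudeHomology.isDiagonal_iff] at hG hH ⊢
    exact hG.boxProd hH
  · rw [MagnitudeHomology.isDiagonal_iff] at hG hH ⊢
    exact h.listDiagonal hG hH
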